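/- Let $n$ be a power of two, $d\ge 1$, $A\in\mathbb{R}^{n\times d}$ of rank $d$, $b\in\mathbb{R}^n$ and $\epsilon\in(0,1)$. Let $\mathcal{Z}=\min_{x\in\mathbb{R}^d}\|Ax-b\|_2$, let $x_{opt}=A^\dagger b$ (with $\dagger$ the Moore–Penrose inverse), let $\kappa(A)=\sigma_{\max}(A)/\sigma_{\min}(A)$, and let $U_AU_A^T$ be the orthogonal projection onto the column space of $A$. Put $$r=\left\lceil\max\left\{48^2\,d\ln(40nd)\ln\left(100^2 d\ln(40nd)\right),\ \frac{40\,d\ln(40nd)}{\epsilon}\right\}\right\rceil .$$ Let $H=\frac{1}{\sqrt n}H_n$ be the normalized $n\times n$ Hadamard matrix, where $H_1=[1]$ and $H_{2m}=\begin{bmatrix}H_m&H_m\\H_m&-H_m\end{bmatrix}$; let $D$ be the $n\times n$ diagonal matrix whose diagonal entries are independent uniform random signs; and let $S\in\mathbb{R}^{n\times r}$ be the matrix whose $t$-th column is $\sqrt{n/r}\,e_{i_t}$, where $i_1,\dots,i_r$ are independent, uniform on $\{1,\dots,n\}$ and independent of $D$. Let $$\tilde x_{opt}=\left(S^THDA\right)^\dagger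 S^THDb .$$ Then, with probability at least $0.8$, the following two claims hold simultaneously: first, $$\|A\tilde x_{opt}-b\|_2\le(1+\epsilon)\,\mathcal{Z};$$ second, for every $\gamma\in(0,1]$ with $\|U_AU_A^Tb\|_2\ge\gamma\|b\|_2$, $$\|x_{opt}-\tilde x_{opt}\|_2\le\sqrt{\epsilon}\left(\kappa(A)\sqrt{\gamma^{-2}-1}\right)\|x_{opt}\|_2 .$$ Finally, for every outcome of the random choices, $$n(d+1)+2n(d+1)\log_2(r+1)+O(rd^2)$$ time suffices to compute $\tilde x_{opt}$ from $A$, $b$, $r$ and the random choices. Precisely, there are an absolute constant $C$ and one fixed program for a real random access machine (exact real arithmetic $+,-,\times,\div$, comparisons, index arithmetic on natural numbers, indirect addressing) that, for all such $n,d,A,b,\epsilon$ and all outcomes of the random choices, outputs $\tilde x_{opt}$ after at most $n(d+1)+2n(d+1)\log_2(r+1)+C\,rd^2$ instructions on real numbers (arithmetic operations, copies, constants, comparisons), the total number of executed instructions, index computations and loop control included, being at most $C\left(n(d+1)\log_2(r+1)+rd^2\right)$. -/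

import Mathlib

open scoped Matrix

noncomputable section

namespace FastLS

/-! ### Linear algebra -/

/-- Euclidean norm of a real vector. -/
def l2 {ι : Type*} [Fintype ι] (v : ι → ℝ) : ℝ := ‖WithLp.toLp 2 v‖

/-- The optimal least squares value, `min` over `x` of `‖A x - b‖₂`. -/
def lsqValue {ι κ : Type*} [Fintype ι] [Fintype κ] (A : Matrix ι κ ℝ) (b : ι → ℝ) : ℝ :=
  ⨅ x : κ → ℝ, l2 (A *ᵥ x - b)

/-- The four Penrose equations: `P` is the Moore-Penrose generalized inverse of `M`. -/
structure IsMoorePenrose {ι κ : Type*} [Fintype ι] [Fintype κ]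
    (M : Matrix ι κ ℝ) (P : Matrix κ ι ℝ) : Prop where
  mul_mul_self : M * P * M = M
  self_mul_mul : P * M * P = P
  transpose_left : (M * P)ᵀ = M * P
  transpose_right : (P * M)ᵀ = P * M

theorem exists_isMoorePenrose {ι κ : Type*} [Fintype ι] [Fintype κ]
    (M : Matrix ι κ ℝ) : ∃ P : Matrix κ ι ℝ, IsMoorePenrose M P := by
  classical
  have hG : (Mᵀ * M).IsHermitian := by
    simpa using Matrix.isHermitian_conjTranspose_mul_self M
  set U : Matrix κ κ ℝ := (hG.eigenvectorUnitary : Matrix κ κ ℝ) with hU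
  have hU1 : Uᵀ * U = 1 := by
    have := Unitary.coe_star_mul_self hG.eigenvectorUnitary
    simpa [Matrix.star_eq_conjTranspose] using this
  set L : Matrix κ κ ℝ := Matrix.diagonal hG.eigenvalues with hL
  set K : Matrix κ κ ℝ := Matrix.diagonal (fun i => (hG.eigenvalues i)⁻¹) with hK
  have hspec : Mᵀ * M = U * L * Uᵀ := by
    have := hG.spectral_theorem
    rw [Unitary.conjStarAlgAut_apply] at this
    simpa [Matrix.star_eq_conjTranspose, Function.comp_def] using this
  set g : Matrix κ κ ℝ := U * K * Uᵀ with hg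
  have hgT : gᵀ = g := by
    simp [hg, hK, Matrix.transpose_mul, Matrix.mul_assoc]
  have hgG : g * (Mᵀ * M) = U * (K * L) * Uᵀ := by
    rw [hspec, hg]
    calc U * K * Uᵀ * (U * L * Uᵀ) = U * K * (Uᵀ * U) * L * Uᵀ := by
          simp only [Matrix.mul_assoc]
      _ = _ := by rw [hU1]; simp only [Matrix.mul_assoc, Matrix.one_mul]
  have hKLK : K * L * K = K := by
    simp only [hK, hL, Matrix.diagonal_mul_diagonal]
    congr 1; ext i
    by_cases h : hG.eigenvalues i = 0 <;> simp [h]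
  have hLKL : L * (K * L) = L := by
    simp only [hK, hL, Matrix.diagonal_mul_diagonal]
    congr 1; ext i
    by_cases h : hG.eigenvalues i = 0 <;> simp [h]
  have hGgG : (Mᵀ * M) * (g * (Mᵀ * M)) = Mᵀ * M := by
    rw [hgG]
    calc Mᵀ * M * (U * (K * L) * Uᵀ) = U * L * Uᵀ * (U * (K * L) * Uᵀ) := by rw [hspec]
      _ = U * L * (Uᵀ * U) * (K * L) * Uᵀ := by simp only [Matrix.mul_assoc]
      _ = U * (L * (K * L)) * Uᵀ := by
          rw [hU1]; simp only [Matrix.mul_assoc, Matrix.one_mul]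
      _ = Mᵀ * M := by rw [hLKL, hspec]
  have hgGT : (g * (Mᵀ * M))ᵀ = g * (Mᵀ * M) := by
    rw [hgG]
    simp [hK, hL, Matrix.transpose_mul, Matrix.mul_assoc, mul_comm]
  have hMgG : M * (g * (Mᵀ * M)) = M := by
    have h0 : (M * (g * (Mᵀ * M)) - M)ᴴ * (M * (g * (Mᵀ * M)) - M) = 0 := by
      have e : (M * (g * (Mᵀ * M)) - M)ᴴ = (g * (Mᵀ * M)) * Mᵀ - Mᵀ := by
        rw [Matrix.conjTranspose_eq_transpose_of_trivial, Matrix.transpose_sub,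
          Matrix.transpose_mul, hgGT]
      rw [e]
      calc ((g * (Mᵀ * M)) * Mᵀ - Mᵀ) * (M * (g * (Mᵀ * M)) - M)
          = (g * (Mᵀ * M)) * ((Mᵀ * M) * (g * (Mᵀ * M))) - (g * (Mᵀ * M)) * (Mᵀ * M)
              - ((Mᵀ * M) * (g * (Mᵀ * M)) - Mᵀ * M) := by
            simp only [Matrix.mul_sub, Matrix.sub_mul, Matrix.mul_assoc]
            abel
        _ = 0 := by rw [hGgG]; simp
    exact sub_eq_zero.mp (Matrix.conjTranspose_mul_self_eq_zero.mp h0)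
  refine ⟨g * Mᵀ, ?_, ?_, ?_, ?_⟩
  · calc M * (g * Mᵀ) * M = M * (g * (Mᵀ * M)) := by simp only [Matrix.mul_assoc]
      _ = M := hMgG
  · calc g * Mᵀ * M * (g * Mᵀ) = (g * (Mᵀ * M)) * g * Mᵀ := by simp only [Matrix.mul_assoc]
      _ = U * (K * L) * (Uᵀ * U) * K * Uᵀ * Mᵀ := by
          rw [hgG]; simp only [hg, Matrix.mul_assoc]
      _ = U * (K * L * K) * Uᵀ * Mᵀ := by
          rw [hU1]; simp only [Matrix.mul_assoc, Matrix.one_mul]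
      _ = g * Mᵀ := by rw [hKLK]
  · simp only [Matrix.transpose_mul, Matrix.transpose_transpose, hgT, Matrix.mul_assoc]
  · have : g * Mᵀ * M = g * (Mᵀ * M) := by simp only [Matrix.mul_assoc]
    rw [this, hgGT]

theorem IsMoorePenrose.unique {ι κ : Type*} [Fintype ι] [Fintype κ]
    {M : Matrix ι κ ℝ} {P Q : Matrix κ ι ℝ} (hP : IsMoorePenrose M P)
    (hQ : IsMoorePenrose M Q) : P = Q := by
  have h1 : M * P = M * Q := by
    calc M * P = (M * P)ᵀ := hP.transpose_left.symm
      _ = (M * Q * M * P)ᵀ := by rw [hQ.mul_mul_self]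
      _ = (M * P)ᵀ * (M * Q)ᵀ := by rw [← Matrix.transpose_mul]; simp only [Matrix.mul_assoc]
      _ = M * P * M * Q := by
          rw [hP.transpose_left, hQ.transpose_left]; simp only [Matrix.mul_assoc]
      _ = M * Q := by rw [hP.mul_mul_self]
  have h2 : P * M = Q * M := by
    calc P * M = (P * M)ᵀ := hP.transpose_right.symm
      _ = (P * (M * Q * M))ᵀ := by rw [hQ.mul_mul_self]
      _ = (Q * M)ᵀ * (P * M)ᵀ := by rw [← Matrix.transpose_mul]; simp only [Matrix.mul_assoc]
      _ = Q * (M * P * M) := by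
          rw [hP.transpose_right, hQ.transpose_right]; simp only [Matrix.mul_assoc]
      _ = Q * M := by rw [hP.mul_mul_self]
  calc P = P * M * P := hP.self_mul_mul.symm
    _ = Q * (M * P) := by rw [h2, Matrix.mul_assoc]
    _ = Q * M * Q := by rw [h1, Matrix.mul_assoc]
    _ = Q := hQ.self_mul_mul

/-- The Moore-Penrose generalized inverse `M†`. -/
def pinv {ι κ : Type*} [Fintype ι] [Fintype κ] (M : Matrix ι κ ℝ) : Matrix κ ι ℝ :=
  (exists_isMoorePenrose M).choose

theorem pinv_spec {ι κ : Type*} [Fintype ι] [Fintype κ] (M : Matrix ι κ ℝ) :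
    IsMoorePenrose M (pinv M) :=
  (exists_isMoorePenrose M).choose_spec

/-- The least squares solution of smallest Euclidean norm, `x_opt = A† b`. -/
def xOpt {ι κ : Type*} [Fintype ι] [Fintype κ] (A : Matrix ι κ ℝ) (b : ι → ℝ) : κ → ℝ :=
  pinv A *ᵥ b

/-- The condition number: largest singular value over smallest nonzero singular value. -/
def condNumber {n d : ℕ} (A : Matrix (Fin n) (Fin d) ℝ) : ℝ :=
  (Matrix.toEuclideanLin A).singularValues 0 /
    (Matrix.toEuclideanLin A).singularValues (A.rank - 1)

/-- The orthogonal projection `U_A U_Aᵀ b` of `b` onto the column space of `A`. -/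
def colProj {n d : ℕ} (A : Matrix (Fin n) (Fin d) ℝ) (b : Fin n → ℝ) :
    EuclideanSpace ℝ (Fin n) :=
  (LinearMap.range (Matrix.toEuclideanLin A)).starProjection (WithLp.toLp 2 b)

/-! ### The randomized Hadamard transform and the sampling algorithm -/

/-- Splitting the `2 ^ (k + 1)` indices into the first and the last `2 ^ k`. -/
def halves (k : ℕ) : Fin (2 ^ k) ⊕ Fin (2 ^ k) ≃ Fin (2 ^ (k + 1)) :=
  finSumFinEquiv.trans (finCongr (by rw [pow_succ]; omega))

/-- The unnormalized Hadamard matrix of size `2 ^ k`, by its block recursion. -/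
def hadamardMat : (k : ℕ) → Matrix (Fin (2 ^ k)) (Fin (2 ^ k)) ℝ
  | 0 => Matrix.of fun _ _ => 1
  | k + 1 => Matrix.reindex (halves k) (halves k)
      (Matrix.fromBlocks (hadamardMat k) (hadamardMat k) (hadamardMat k) (-hadamardMat k))

/-- The normalized Hadamard matrix `H`. -/
def normHadamard (k : ℕ) : Matrix (Fin (2 ^ k)) (Fin (2 ^ k)) ℝ :=
  (1 / Real.sqrt ((2 : ℝ) ^ k)) • hadamardMat k

/-- The random choices of the algorithm: `n` signs and `r` row indices. Under the uniform law
on this finite type all of them are independent and uniform. -/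
abbrev Coins (n r : ℕ) : Type := (Fin n → ℤˣ) × (Fin r → Fin n)

/-- The diagonal sign matrix `D`. -/
def signDiag {n r : ℕ} (ω : Coins n r) : Matrix (Fin n) (Fin n) ℝ :=
  Matrix.diagonal fun i => ((ω.1 i : ℤ) : ℝ)

/-- The sampling matrix `S`: its `t`-th column is `√(n / r) e_i`, with `i` the `t`-th sample. -/
def sampMat {n r : ℕ} (ω : Coins n r) : Matrix (Fin n) (Fin r) ℝ :=
  Matrix.of fun i t => if ω.2 t = i then Real.sqrt ((n : ℝ) / (r : ℝ)) else 0

/-- The preconditioner `X = Sᵀ H D`. -/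
def precond {k r : ℕ} (ω : Coins (2 ^ k) r) : Matrix (Fin r) (Fin (2 ^ k)) ℝ :=
  (sampMat ω)ᵀ * normHadamard k * signDiag ω

/-- The output `(Sᵀ H D A)† Sᵀ H D b` of the algorithm. -/
def xTilde {k d r : ℕ} (A : Matrix (Fin (2 ^ k)) (Fin d) ℝ) (b : Fin (2 ^ k) → ℝ)
    (ω : Coins (2 ^ k) r) : Fin d → ℝ :=
  pinv (precond ω * A) *ᵥ (precond ω *ᵥ b)

/-- The number of sampled rows (rounded up to an integer). -/
def sampleSize (n d : ℕ) (ε : ℝ) : ℕ :=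
  ⌈max (48 ^ 2 * (d : ℝ) * Real.log (40 * n * d) *
          Real.log (100 ^ 2 * d * Real.log (40 * n * d)))
        (40 * d * Real.log (40 * n * d) / ε)⌉₊

/-! ### A real random access machine

One fixed program text handles inputs of all sizes. The memory consists of arrays of natural
numbers (used for indices) and of two-dimensional arrays of real numbers. Real numbers can be
accessed only through field operations, copies, integer constants and comparisons. -/

/-- Index expressions. `get a e` is the entry with index `e` of the natural number array `a`. -/
inductive IExp : Type
  | lit (m : ℕ)
  | get (a : ℕ) (e : IExp)
  | add (e f : IExp)
  | sub (e f : IExp)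
  | mul (e f : IExp)
  | div (e f : IExp)

/-- Arithmetic operations on real numbers. -/
inductive ROp : Type
  | add | sub | mul | div

/-- An entry of a real array, at a computed row and column. -/
structure Cell : Type where
  arr : ℕ
  row : IExp
  col : IExp

/-- Programs. -/
inductive Prog : Type
  | skip
  | setIdx (a : ℕ) (i e : IExp)
  | const (x : Cell) (e : IExp)
  | copy (x y : Cell)
  | arith (op : ROp) (x y z : Cell)
  | seq (p q : Prog)
  | ifIdx (e f : IExp) (p q : Prog)
  | ifReal (x y : Cell) (p q : Prog)
  | loop (v : ℕ) (e : IExp) (p : Prog)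

/-- Memory contents, with two counters: `ops` counts the executed instructions that handle real
numbers (arithmetic operations, copies, constants, comparisons), `steps` counts all executed
instructions, those for index computations, tests and loop control included. -/
@[ext] structure State : Type where
  nat : ℕ → ℕ → ℕ
  real : ℕ → ℕ → ℕ → ℝ
  ops : ℕ
  steps : ℕ

def IExp.eval (s : State) : IExp → ℕ
  | lit m => m
  | get a e => s.nat a (e.eval s)
  | add e f => e.eval s + f.eval s
  | sub e f => e.eval s - f.eval s
  | mul e f => e.eval s * f.eval s
  | div e f => e.eval s / f.eval s

/-- Division by zero returns zero. -/
def ROp.eval : ROp → ℝ → ℝ → ℝ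
  | add, x, y => x + y
  | sub, x, y => x - y
  | mul, x, y => x * y
  | div, x, y => x / y

def State.read (s : State) (x : Cell) : ℝ := s.real x.arr (x.row.eval s) (x.col.eval s)

/-- Charge for an instruction that handles no real number. -/
def State.tick (s : State) : State := { s with steps := s.steps + 1 }

/-- Charge for an instruction that handles real numbers. -/
def State.tickReal (s : State) : State := { s with ops := s.ops + 1, steps := s.steps + 1 }

def State.setNat (s : State) (a i m : ℕ) : State :=
  { s with nat := Function.update s.nat a (Function.update (s.nat a) i m) }

def State.write (s : State) (x : Cell) (c : ℝ) : State :=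
  { s with real := Function.update s.real x.arr (Function.update (s.real x.arr) (x.row.eval s)
      (Function.update (s.real x.arr (x.row.eval s)) (x.col.eval s) c)) }

/-- `iter f m` applies `f 0`, then `f 1`, up to `f (m - 1)`. -/
def iter (f : ℕ → State → State) : ℕ → State → State
  | 0, s => s
  | m + 1, s => f m (iter f m s)

open Classical in
/-- Execution. The loop `loop v e p` evaluates `e` once, to `m`, and then runs `p` for the values
`0, …, m - 1` of the loop variable, which is held in entry `0` of the natural number array `v`. -/
def Prog.run : Prog → State → State
  | skip, s => s
  | setIdx a i e, s => (s.setNat a (i.eval s) (e.eval s)).tick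
  | const x e, s => (s.write x (e.eval s : ℝ)).tickReal
  | copy x y, s => (s.write x (s.read y)).tickReal
  | arith op x y z, s => (s.write x (op.eval (s.read y) (s.read z))).tickReal
  | seq p q, s => q.run (p.run s)
  | ifIdx e f p q, s => if e.eval s ≤ f.eval s then p.run s.tick else q.run s.tick
  | ifReal x y p q, s => if s.read x ≤ s.read y then p.run s.tickReal else q.run s.tickReal
  | loop v e p, s => iter (fun i t => p.run (t.setNat v 0 i).tick) (e.eval s) s.tick

/-- Initial memory. Real arrays `0`, `1`, `2` hold `A`, `b` and the random signs (the latter two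
in column `0`). Natural number array `0` holds the sampled row indices, counted from `0`, and
array `1` holds `n`, `d`, `r`. All other entries and both counters are zero. -/
def initState {n d r : ℕ} (A : Matrix (Fin n) (Fin d) ℝ) (b : Fin n → ℝ) (ω : Coins n r) :
    State where
  nat a i :=
    match a with
    | 0 => if h : i < r then (ω.2 ⟨i, h⟩ : ℕ) else 0
    | 1 => match i with
      | 0 => n
      | 1 => d
      | 2 => r
      | _ => 0
    | _ => 0
  real a i j :=
    match a with
    | 0 => if h : i < n ∧ j < d then A ⟨i, h.1⟩ ⟨j, h.2⟩ else 0
    | 1 => if h : i < n ∧ j = 0 then b ⟨i, h.1⟩ else 0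
    | 2 => if h : i < n ∧ j = 0 then ((ω.1 ⟨i, h.1⟩ : ℤ) : ℝ) else 0
    | _ => 0
  ops := 0
  steps := 0

/-- The program leaves the vector `x` in column `0` of real array `3`. -/
def State.Outputs {d : ℕ} (s : State) (x : Fin d → ℝ) : Prop :=
  ∀ j : Fin d, s.real 3 j 0 = x j

end FastLS

end

/-! Accuracy. Let U have orthonormal columns spanning the column space of A, and let W be the
unnormalized Hadamard matrix with its columns multiplied by the random signs, so that WᵀW = nI.
Rescaling the sketch does not change its least squares solution (`xTilde_eq`), so the algorithm
solves the problem restricted to r sampled rows of WA and Wb. Let u_i be the rows of WU, let g be W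
times the optimal residual, and let Z be the norm of that residual. Then ∑ u_i u_iᵀ = nI and ∑ g_i
u_i = 0. Two properties of the sample suffice (`sketch_error_le`): ∑_t (u_{i_t}·z)² ≥ 0.72 r |z|²
for all z, and |∑_t g_{i_t} u_{i_t}|² ≤ (ε/2) r² Z². Writing A(x̃ - x_opt) = Uz, the sketched normal
equations and Cauchy-Schwarz give |z|² ≤ εZ²; Pythagoras and the extreme singular values of A turn
this into both claims (`accuracy_of_error_le`).

Probability. Hoeffding's inequality and a union bound over the nd entries of WU give |u_i|² ≤ 2d
ln(40nd) for all i, except with probability 1/20. For such signs the second property fails with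
probability at most 1/10, by Markov's inequality for the second moment (`sum_sq_sample_sum`). The
first fails with probability at most 1/20 (`card_ill_conditioned_le`): the potential tr B^{-(p+1)},
for B = 0.2 r I + ∑_t u_{i_t} u_{i_t}ᵀ, has mean at most the value it would take if every sample
added 0.95 I (`sum_trace_inv_pow_le`), and Markov's inequality then bounds the smallest eigenvalue
of B from below. All probabilities are obtained by counting outcomes, and the failures add up to
1/5.

Running time. Only the first j levels of the fast transform are carried out, where 2^j is the
largest power of two not exceeding min(n, r+1). The Hadamard matrix is a Kronecker product, so with
n = 2^(j+s) each sampled entry is a signed sum of 2^s partially transformed ones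
(`sum_walsh_partialWalsh`). Since r 2^s ≤ 2n + r, this costs a constant number of passes over the
data, which a second copy of log₂(r+1) ≥ 6 pays for. The sampled problem is solved by Gram-Schmidt
in O(rd²) operations, in a form valid for every outcome, rank deficient ones included
(`OrthoStage.pinv_mulVec`). Correctness and cost of a program are proved together through the
judgement `Runs`. -/

noncomputable section

namespace FastLS

/-! ### A program logic for the random access machine -/

/-- Value of an index expression in given natural number memory. -/
def IExp.val (N : ℕ → ℕ → ℕ) : IExp → ℕ
  | lit m => m
  | get a e => N a (e.val N)
  | add e f => e.val N + f.val N
  | sub e f => e.val N - f.val N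
  | mul e f => e.val N * f.val N
  | div e f => e.val N / f.val N

theorem IExp.eval_eq_val (s : State) (e : IExp) : e.eval s = e.val s.nat := by
  induction e <;> simp_all [IExp.eval, IExp.val]

/-- Natural number memory after an assignment. -/
def setN (N : ℕ → ℕ → ℕ) (a i m : ℕ) : ℕ → ℕ → ℕ :=
  Function.update N a (Function.update (N a) i m)

/-- Real memory after an assignment. -/
def setR (R : ℕ → ℕ → ℕ → ℝ) (a i j : ℕ) (c : ℝ) : ℕ → ℕ → ℕ → ℝ :=
  Function.update R a (Function.update (R a) i (Function.update (R a i) j c))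

theorem setN_apply (N : ℕ → ℕ → ℕ) (a i m b j : ℕ) :
    setN N a i m b j = if b = a ∧ j = i then m else N b j := by
  unfold setN
  by_cases hb : b = a
  · subst hb
    by_cases hj : j = i <;> simp [hj]
  · simp [hb]

theorem setR_apply (R : ℕ → ℕ → ℕ → ℝ) (a i j : ℕ) (c : ℝ) (a' i' j' : ℕ) :
    setR R a i j c a' i' j' = if a' = a ∧ i' = i ∧ j' = j then c else R a' i' j' := by
  unfold setR
  by_cases ha : a' = a
  · subst ha
    by_cases hi : i' = i
    · subst hi
      by_cases hj : j' = j <;> simp [hj]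
    · simp [hi]
  · simp [ha]

theorem setN_ne (N : ℕ → ℕ → ℕ) {a i m b : ℕ} (h : b ≠ a) : setN N a i m b = N b := by
  simp [setN, h]

theorem setR_ne (R : ℕ → ℕ → ℕ → ℝ) {a i j : ℕ} {c : ℝ} {b : ℕ} (h : b ≠ a) :
    setR R a i j c b = R b := by
  simp [setR, h]

/-- Contents of a cell. -/
def Cell.val (x : Cell) (N : ℕ → ℕ → ℕ) (R : ℕ → ℕ → ℕ → ℝ) : ℝ :=
  R x.arr (x.row.val N) (x.col.val N)

/-- From memory `N`, `R` the program reaches a memory satisfying `Q`, with at most `c`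
instructions on real numbers and at most `w` instructions. -/
def Runs (p : Prog) (N : ℕ → ℕ → ℕ) (R : ℕ → ℕ → ℕ → ℝ) (c w : ℕ)
    (Q : (ℕ → ℕ → ℕ) → (ℕ → ℕ → ℕ → ℝ) → Prop) : Prop :=
  ∀ o t : ℕ, Q (p.run ⟨N, R, o, t⟩).nat (p.run ⟨N, R, o, t⟩).real ∧
    (p.run ⟨N, R, o, t⟩).ops ≤ o + c ∧ (p.run ⟨N, R, o, t⟩).steps ≤ t + w

section rules

variable {N : ℕ → ℕ → ℕ} {R : ℕ → ℕ → ℕ → ℝ} {c w c' w' : ℕ}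
  {Q Q' : (ℕ → ℕ → ℕ) → (ℕ → ℕ → ℕ → ℝ) → Prop} {p q : Prog}

theorem Runs.mono (h : Runs p N R c w Q) (hc : c ≤ c') (hw : w ≤ w')
    (hQ : ∀ N R, Q N R → Q' N R) : Runs p N R c' w' Q' := fun o t =>
  ⟨hQ _ _ (h o t).1, (h o t).2.1.trans (by omega), (h o t).2.2.trans (by omega)⟩

theorem Runs.skip (h : Q N R) : Runs .skip N R c w Q := fun o t => by
  simp [Prog.run, h]

theorem Runs.seq (hp : Runs p N R c w Q) (hq : ∀ N R, Q N R → Runs q N R c' w' Q') :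
    Runs (.seq p q) N R (c + c') (w + w') Q' := fun o t => by
  obtain ⟨h1, h2, h3⟩ := hp o t
  obtain ⟨h4, h5, h6⟩ := hq _ _ h1 (p.run ⟨N, R, o, t⟩).ops (p.run ⟨N, R, o, t⟩).steps
  simp only [Prog.run]
  exact ⟨h4, h5.trans (by omega), h6.trans (by omega)⟩

theorem Runs.setIdx {a : ℕ} {i e : IExp} (h : Q (setN N a (i.val N) (e.val N)) R) :
    Runs (.setIdx a i e) N R c (w + 1) Q := fun o t => by
  simp only [Prog.run, State.setNat, State.tick, IExp.eval_eq_val]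
  exact ⟨h, by omega, by omega⟩

theorem Runs.const {x : Cell} {e : IExp}
    (h : Q N (setR R x.arr (x.row.val N) (x.col.val N) (e.val N))) :
    Runs (.const x e) N R (c + 1) (w + 1) Q := fun o t => by
  simp only [Prog.run, State.write, State.tickReal, IExp.eval_eq_val]
  exact ⟨h, by omega, by omega⟩

theorem Runs.copy {x y : Cell}
    (h : Q N (setR R x.arr (x.row.val N) (x.col.val N) (y.val N R))) :
    Runs (.copy x y) N R (c + 1) (w + 1) Q := fun o t => by
  simp only [Prog.run, State.write, State.tickReal, State.read, IExp.eval_eq_val]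
  exact ⟨h, by omega, by omega⟩

theorem Runs.arith {op : ROp} {x y z : Cell}
    (h : Q N (setR R x.arr (x.row.val N) (x.col.val N) (op.eval (y.val N R) (z.val N R)))) :
    Runs (.arith op x y z) N R (c + 1) (w + 1) Q := fun o t => by
  simp only [Prog.run, State.write, State.tickReal, State.read, IExp.eval_eq_val]
  exact ⟨h, by omega, by omega⟩

theorem Runs.ifIdx {e f : IExp} (h1 : e.val N ≤ f.val N → Runs p N R c w Q)
    (h2 : f.val N < e.val N → Runs q N R c w Q) :
    Runs (.ifIdx e f p q) N R c (w + 1) Q := fun o t => by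
  simp only [Prog.run, State.tick, IExp.eval_eq_val]
  split_ifs with h
  · obtain ⟨h1, h2, h3⟩ := h1 h o (t + 1)
    exact ⟨h1, h2, h3.trans (by omega)⟩
  · obtain ⟨h1, h2, h3⟩ := h2 (by omega) o (t + 1)
    exact ⟨h1, h2, h3.trans (by omega)⟩

theorem iter_invariant {f : ℕ → State → State} {c w : ℕ} (I : ℕ → (ℕ → ℕ → ℕ) →
    (ℕ → ℕ → ℕ → ℝ) → Prop) (s : State) (h0 : I 0 s.nat s.real) (m : ℕ)
    (h : ∀ i < m, ∀ t : State, I i t.nat t.real → I (i + 1) (f i t).nat (f i t).real ∧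
      (f i t).ops ≤ t.ops + c ∧ (f i t).steps ≤ t.steps + w) :
    I m (iter f m s).nat (iter f m s).real ∧ (iter f m s).ops ≤ s.ops + m * c ∧
      (iter f m s).steps ≤ s.steps + m * w := by
  induction m with
  | zero => simpa [iter] using h0
  | succ m ih =>
    obtain ⟨h1, h2, h3⟩ := ih fun i hi => h i (by omega)
    obtain ⟨h4, h5, h6⟩ := h m (by omega) _ h1
    simp only [iter]
    refine ⟨h4, h5.trans ?_, h6.trans ?_⟩
    · rw [Nat.succ_mul]; omega
    · rw [Nat.succ_mul]; omega

theorem Runs.loop {v : ℕ} {e : IExp} (I : ℕ → (ℕ → ℕ → ℕ) → (ℕ → ℕ → ℕ → ℝ) → Prop)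
    {m : ℕ} (hm : e.val N = m) (h0 : I 0 N R)
    (h : ∀ i < m, ∀ N R, I i N R → Runs p (setN N v 0 i) R c w (I (i + 1)))
    (hQ : ∀ N R, I m N R → Q N R) :
    Runs (.loop v e p) N R (m * c) (m * (w + 1) + 1) Q := fun o t => by
  simp only [Prog.run, State.tick, IExp.eval_eq_val, hm]
  obtain ⟨h1, h2, h3⟩ := iter_invariant (c := c) (w := w + 1) I
    (f := fun i t => p.run (t.setNat v 0 i).tick) ⟨N, R, o, t + 1⟩ h0 m (by
      intro i hi s hs
      obtain ⟨h1, h2, h3⟩ := h i hi _ _ hs s.ops (s.steps + 1)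
      exact ⟨h1, h2, h3.trans (by omega)⟩)
  exact ⟨hQ _ _ h1, h2, h3.trans (by simp only; omega)⟩

end rules

theorem Runs.setIdx_seq {N R c w Q} {a : ℕ} {i e : IExp} {q : Prog}
    (h : Runs q (setN N a (i.val N) (e.val N)) R c w Q) :
    Runs (.seq (.setIdx a i e) q) N R c (w + 1) Q := by
  refine (Runs.seq (c := 0) (w := 1) (c' := c) (w' := w) (Runs.setIdx (w := 0)
    (Q := fun N' R' => N' = setN N a (i.val N) (e.val N) ∧ R' = R) ⟨rfl, rfl⟩) ?_).mono
    (by omega) (by omega) fun _ _ h => h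
  rintro N' R' ⟨rfl, rfl⟩
  exact h

theorem Runs.const_seq {N R c w Q} {x : Cell} {e : IExp} {q : Prog}
    (h : Runs q N (setR R x.arr (x.row.val N) (x.col.val N) (e.val N)) c w Q) :
    Runs (.seq (.const x e) q) N R (c + 1) (w + 1) Q := by
  refine (Runs.seq (c := 1) (w := 1) (c' := c) (w' := w) (Runs.const (c := 0) (w := 0)
    (Q := fun N' R' => N' = N ∧ R' = setR R x.arr (x.row.val N) (x.col.val N) (e.val N))
    ⟨rfl, rfl⟩) ?_).mono
    (by omega) (by omega) fun _ _ h => h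
  rintro N' R' ⟨rfl, rfl⟩
  exact h

theorem Runs.copy_seq {N R c w Q} {x y : Cell} {q : Prog}
    (h : Runs q N (setR R x.arr (x.row.val N) (x.col.val N) (y.val N R)) c w Q) :
    Runs (.seq (.copy x y) q) N R (c + 1) (w + 1) Q := by
  refine (Runs.seq (c := 1) (w := 1) (c' := c) (w' := w) (Runs.copy (c := 0) (w := 0)
    (Q := fun N' R' => N' = N ∧ R' = setR R x.arr (x.row.val N) (x.col.val N) (y.val N R))
    ⟨rfl, rfl⟩) ?_).mono
    (by omega) (by omega) fun _ _ h => h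
  rintro N' R' ⟨rfl, rfl⟩
  exact h

theorem Runs.arith_seq {N R c w Q} {op : ROp} {x y z : Cell} {q : Prog}
    (h : Runs q N (setR R x.arr (x.row.val N) (x.col.val N)
      (op.eval (y.val N R) (z.val N R))) c w Q) :
    Runs (.seq (.arith op x y z) q) N R (c + 1) (w + 1) Q := by
  refine (Runs.seq (c := 1) (w := 1) (c' := c) (w' := w) (Runs.arith (c := 0) (w := 0)
    (Q := fun N' R' => N' = N ∧ R' = setR R x.arr (x.row.val N) (x.col.val N)
      (op.eval (y.val N R) (z.val N R))) ⟨rfl, rfl⟩) ?_).mono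
    (by omega) (by omega) fun _ _ h => h
  rintro N' R' ⟨rfl, rfl⟩
  exact h

/-! ### Inner products and row operations -/

/-- The value of a scalar variable, held in entry `0` of an array. -/
abbrev var (a : ℕ) : IExp := .get a (.lit 0)

/-- The real scalar variable held in array `a`. -/
abbrev scal (a : ℕ) : Cell := ⟨a, .lit 0, .lit 0⟩

/-- Equality of memories outside the arrays in `S`. -/
def EqOff {α : Type*} (S : Finset ℕ) (f g : ℕ → α) : Prop := ∀ a ∉ S, g a = f a

theorem EqOff.trans {α : Type*} {S T : Finset ℕ} {f g h : ℕ → α} (h1 : EqOff S f g)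
    (h2 : EqOff T g h) : EqOff (S ∪ T) f h := fun a ha => by
  rw [Finset.notMem_union] at ha
  rw [h2 a ha.2, h1 a ha.1]

theorem EqOff.mono {α : Type*} {S T : Finset ℕ} {f g : ℕ → α} (h1 : EqOff S f g)
    (h : S ⊆ T) : EqOff T f g := fun a ha => h1 a fun h' => ha (h h')

theorem EqOff.refl {α : Type*} (S : Finset ℕ) (f : ℕ → α) : EqOff S f f := fun _ _ => rfl

theorem EqOff.setN {S : Finset ℕ} {f g : ℕ → ℕ → ℕ} (h : EqOff S f g) {a : ℕ} (ha : a ∈ S)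
    (i m : ℕ) : EqOff S f (setN g a i m) := fun b hb => by
  rw [setN_ne _ (by rintro rfl; exact hb ha), h b hb]

theorem EqOff.setR {S : Finset ℕ} {f g : ℕ → ℕ → ℕ → ℝ} (h : EqOff S f g) {a : ℕ} (ha : a ∈ S)
    (i j : ℕ) (c : ℝ) : EqOff S f (setR g a i j c) := fun b hb => by
  rw [setR_ne _ (by rintro rfl; exact hb ha), h b hb]

/-- Put the sum of the products of the cells `x` and `y`, over the values below `len` of the
variable `v`, into array `9`. -/
def dotProg (v : ℕ) (len : IExp) (x y : Cell) : Prog :=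
  .seq (.const (scal 9) (.lit 0)) <| .loop v len <|
    .seq (.arith .mul (scal 10) x y) (.arith .add (scal 9) (scal 9) (scal 10))

theorem Cell.val_congr {x : Cell} {N N' : ℕ → ℕ → ℕ} {R R' : ℕ → ℕ → ℕ → ℝ} (hN : N' = N)
    (hR : R' x.arr = R x.arr) : x.val N' R' = x.val N R := by
  simp [Cell.val, hN, hR]

theorem dotProg_runs {v : ℕ} {len : IExp} {x y : Cell} {N R} {m : ℕ} (f g : ℕ → ℝ)
    (hm : len.val N = m) (hx : x.arr ∉ ({9, 10} : Finset ℕ)) (hy : y.arr ∉ ({9, 10} : Finset ℕ))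
    (hf : ∀ i < m, x.val (setN N v 0 i) R = f i) (hg : ∀ i < m, y.val (setN N v 0 i) R = g i) :
    Runs (dotProg v len x y) N R (m * 2 + 1) (m * 3 + 2) fun N' R' =>
      EqOff {v} N N' ∧ EqOff {9, 10} R R' ∧ R' 9 0 0 = ∑ i ∈ Finset.range m, f i * g i := by
  -- Comparing the memories after overwriting the loop variable says that nothing else in the index
  -- memory has changed.
  refine Runs.const_seq (Runs.loop (fun i N' R' => (∀ k, setN N' v 0 k = setN N v 0 k) ∧
    EqOff {9, 10} R R' ∧ R' 9 0 0 = ∑ i ∈ Finset.range i, f i * g i) hm ?_ ?_ ?_)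
  · refine ⟨fun _ => rfl, (EqOff.refl _ _).setR (by simp) _ _ _, ?_⟩
    simp [setR_apply, IExp.val]
  · rintro i hi N' R' ⟨h1, h2, h3⟩
    refine Runs.arith_seq (Runs.arith (c := 0) (w := 0) ?_)
    rw [Cell.val_congr (R := R) (h1 i) (h2 _ hx), Cell.val_congr (R := R) (h1 i) (h2 _ hy),
      hf i hi, hg i hi]
    refine ⟨?_, ?_, ?_⟩
    · intro k
      rw [← h1 k]
      funext a b
      simp only [setN_apply]
      split_ifs <;> rfl
    · exact (h2.setR (by simp) _ _ _).setR (by simp) _ _ _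
    · simp [Cell.val, IExp.val, setR_apply, ROp.eval, h3, Finset.sum_range_succ]
  · rintro N' R' ⟨h1, h2, h3⟩
    refine ⟨fun a ha => ?_, h2, h3⟩
    have := congrFun (h1 0) a
    rwa [setN_ne _ (by simpa using ha), setN_ne _ (by simpa using ha)] at this

/-- Subtract the multiple of row `u'` by the scalar in array `11` from row `u` of array `a`. -/
def axpyProg (v : ℕ) (len : IExp) (a u u' : ℕ) : Prog :=
  .loop v len <| .seq (.arith .mul (scal 10) (scal 11) ⟨a, var u', var v⟩)
    (.arith .sub ⟨a, var u, var v⟩ ⟨a, var u, var v⟩ (scal 10))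

/-- Because the two rows differ, the subtracted row keeps its original entries while the other one
is being overwritten. -/
theorem axpyProg_runs {v : ℕ} {len : IExp} {a u u' : ℕ} {N R} {m : ℕ} (hm : len.val N = m)
    (hu : u ≠ v) (hu' : u' ≠ v) (ha : a ≠ 10) (ha' : a ≠ 11) (hne : N u 0 ≠ N u' 0) :
    Runs (axpyProg v len a u u') N R (m * 2) (m * 3 + 1) fun N' R' =>
      EqOff {v} N N' ∧ EqOff {a, 10} R R' ∧
      (∀ i j, R' a i j = if i = N u 0 ∧ j < m then R a i j - R 11 0 0 * R a (N u' 0) j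
        else R a i j) := by
  refine Runs.loop (fun k N' R' => EqOff {v} N N' ∧ EqOff {a, 10} R R' ∧
      (∀ i j, R' a i j = if i = N u 0 ∧ j < k then R a i j - R 11 0 0 * R a (N u' 0) j
        else R a i j)) hm ?_ ?_ ?_
  · exact ⟨EqOff.refl _ _, EqOff.refl _ _, by simp⟩
  · rintro k hk N' R' ⟨h1, h2, h3⟩
    refine Runs.arith_seq (Runs.arith (c := 0) (w := 0) ?_)
    have e1 : setN N' v 0 k u 0 = N u 0 := by rw [setN_ne _ hu, h1 u (by simpa using hu)]
    have e2 : setN N' v 0 k u' 0 = N u' 0 := by rw [setN_ne _ hu', h1 u' (by simpa using hu')]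
    have e3 : setN N' v 0 k v 0 = k := by simp [setN_apply]
    refine ⟨h1.setN (by simp) _ _, (h2.setR (by simp) _ _ _).setR (by simp) _ _ _, ?_⟩
    intro i j
    have e4 : R' 11 = R 11 := h2 11 (by simp [ha'.symm])
    simp only [Cell.val, IExp.val, setR_apply, ROp.eval, e1, e2, e3, ha, h3, e4, hne.symm,
      false_and, if_false, true_and, and_self, if_true]
    by_cases hi : i = N u 0
    · subst hi
      rcases lt_trichotomy j k with h | h | h
      · simp [h.ne, h, h.trans (Nat.lt_succ_self k)]
      · subst h; simp
      · simp [h.ne', not_lt.mpr h.le, show ¬ j < k + 1 by omega]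
    · simp [hi]
  · exact fun _ _ h => h

/-- A double loop whose body fills one entry of a block of rows of the array `A`. -/
theorem fillLoop_runs {u v : ℕ} {eu ev : IExp} {body : Prog} {N : ℕ → ℕ → ℕ}
    {R : ℕ → ℕ → ℕ → ℝ} {m₁ m₂ c w A ρ : ℕ}
    (S T : Finset ℕ) (f : ℕ → ℕ → ℝ) (huv : u ≠ v) (hu : u ∉ S)
    (h₁ : eu.val N = m₁)
    (h₂ : ∀ N', EqOff (insert u (insert v S)) N N' → ev.val N' = m₂)
    (hbody : ∀ i < m₁, ∀ j < m₂, ∀ N' R', EqOff (insert u (insert v S)) N N' → N' u 0 = i →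
      N' v 0 = j → EqOff (insert A T) R R' → (∀ a < ρ, ∀ b, R' A a b = R A a b) →
      Runs body N' R' c w fun N'' R'' => EqOff (insert v S) N' N'' ∧ EqOff (insert A T) R' R'' ∧
        ∀ a b, R'' A a b = if a = ρ + i ∧ b = j then f i j else R' A a b) :
    Runs (.loop u eu (.loop v ev body)) N R (m₁ * (m₂ * c)) (m₁ * (m₂ * (w + 1) + 2) + 1)
      fun N' R' => EqOff (insert u (insert v S)) N N' ∧ EqOff (insert A T) R R' ∧
        ∀ a b, R' A a b = if ρ ≤ a ∧ a < ρ + m₁ ∧ b < m₂ then f (a - ρ) b else R A a b := by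
  refine Runs.loop (w := m₂ * (w + 1) + 1) (fun k N' R' => EqOff (insert u (insert v S)) N N' ∧
    EqOff (insert A T) R R' ∧
    ∀ a b, R' A a b = if ρ ≤ a ∧ a < ρ + k ∧ b < m₂ then f (a - ρ) b else R A a b) h₁ ?_ ?_ ?_
  · refine ⟨EqOff.refl _ _, EqOff.refl _ _, fun a b => ?_⟩
    rw [if_neg (by omega)]
  · rintro i hi N₁ R₁ ⟨g1, g2, g3⟩
    have g1' : EqOff (insert u (insert v S)) N (setN N₁ u 0 i) := g1.setN (by simp) _ _
    refine Runs.loop (fun k N' R' => EqOff (insert u (insert v S)) N N' ∧ N' u 0 = i ∧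
      EqOff (insert A T) R R' ∧
      ∀ a b, R' A a b = if ρ ≤ a ∧ (a < ρ + i ∧ b < m₂ ∨ a = ρ + i ∧ b < k) then f (a - ρ) b
        else R A a b) (h₂ _ g1') ?_ ?_ ?_
    · refine ⟨g1', by simp [setN_apply], g2, fun a b => ?_⟩
      rw [g3]
      congr 1
      simp
    · rintro j hj N₂ R₂ ⟨k1, k2, k3, k4⟩
      refine (hbody i hi j hj _ R₂ (k1.setN (by simp) _ _) (by rw [setN_ne _ huv, k2])
        (by simp [setN_apply]) k3 (fun a ha b => ?_)).mono le_rfl le_rfl ?_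
      -- Rows before `ρ` are never written, so the body may read them. This is how a butterfly level
      -- reads the previous level of the same array.
      · rw [k4, if_neg (by omega)]
      · rintro N₃ R₃ ⟨l1, l2, l3⟩
        refine ⟨?_, ?_, ?_, ?_⟩
        · refine ((k1.setN (a := v) (by simp) 0 j).trans l1).mono ?_
          intro a; simp only [Finset.mem_union, Finset.mem_insert]; tauto
        · rw [l1 u (by simp [huv, hu]), setN_ne _ huv, k2]
        · exact (k3.trans l2).mono (by simp)
        · intro a b
          rw [l3, k4]
          by_cases hab : a = ρ + i ∧ b = j
          · obtain ⟨rfl, rfl⟩ := hab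
            simp
          · rw [if_neg hab]
            congr 1
            apply propext
            constructor
            · rintro ⟨q1, q2⟩; exact ⟨q1, by omega⟩
            · rintro ⟨q1, q2⟩; exact ⟨q1, by omega⟩
    · rintro N₂ R₂ ⟨k1, k2, k3, k4⟩
      refine ⟨k1, k3, fun a b => ?_⟩
      rw [k4]
      congr 1
      apply propext
      constructor
      · rintro ⟨q1, q2⟩; omega
      · rintro ⟨q1, q2⟩; omega
  · exact fun _ _ h => h

/-! ### Least squares by Gram-Schmidt orthogonalization -/

/-- The normal equations determine `x` up to the kernel of `M`, and lying in the range of `Mᵀ`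
removes that freedom. No rank condition enters, so the criterion also covers samples for which the
sketched matrix is singular. -/
theorem pinv_mulVec_eq {ι κ : Type*} [Fintype ι] [Fintype κ] (M : Matrix ι κ ℝ) (y : ι → ℝ)
    (x : κ → ℝ) (u : ι → ℝ) (hx : x = Mᵀ *ᵥ u) (hn : Mᵀ *ᵥ (y - M *ᵥ x) = 0) :
    pinv M *ᵥ y = x := by
  set P := pinv M
  obtain ⟨h1, h2, h3, h4⟩ := pinv_spec M
  have hy : Mᵀ *ᵥ y = Mᵀ *ᵥ (M *ᵥ x) := by
    rw [Matrix.mulVec_sub] at hn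
    exact sub_eq_zero.mp hn
  have hMP : M * P = Pᵀ * Mᵀ := by rw [← Matrix.transpose_mul]; exact h3.symm
  calc P *ᵥ y = (P * (M * P)) *ᵥ y := by rw [← Matrix.mul_assoc, h2]
    _ = P *ᵥ (Pᵀ *ᵥ (Mᵀ *ᵥ y)) := by rw [hMP]; simp only [Matrix.mulVec_mulVec]
    _ = (P * (Pᵀ * Mᵀ) * M) *ᵥ x := by
        rw [hy]; simp only [Matrix.mulVec_mulVec, Matrix.mul_assoc]
    _ = (P * M) *ᵥ x := by rw [← hMP, ← Matrix.mul_assoc, h2]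
    _ = ((P * M)ᵀ * Mᵀ) *ᵥ u := by rw [h4, hx, Matrix.mulVec_mulVec]
    _ = (M * P * M)ᵀ *ᵥ u := by rw [← Matrix.transpose_mul, Matrix.mul_assoc]
    _ = x := by rw [h1, hx]

/-- Pairing the hypothesis with `Mᵀ v` gives |M Mᵀ v|² = 0, and pairing that with `v` gives |Mᵀ v|²
= 0. -/
theorem transpose_mulVec_eq_zero {ι κ : Type*} [Fintype ι] [Fintype κ] (M : Matrix ι κ ℝ)
    (v : ι → ℝ) (h : Mᵀ *ᵥ (M *ᵥ (Mᵀ *ᵥ v)) = 0) : Mᵀ *ᵥ v = 0 := by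
  have h1 : (M *ᵥ (Mᵀ *ᵥ v)) ⬝ᵥ (M *ᵥ (Mᵀ *ᵥ v)) = 0 := by
    rw [Matrix.dotProduct_mulVec, ← Matrix.mulVec_transpose, h, zero_dotProduct]
  have h2 : (Mᵀ *ᵥ v) ⬝ᵥ (Mᵀ *ᵥ v) = 0 := by
    rw [Matrix.dotProduct_mulVec, ← Matrix.mulVec_transpose, Matrix.transpose_transpose,
      dotProduct_self_eq_zero.mp h1, zero_dotProduct]
  exact dotProduct_self_eq_zero.mp h2

/-- State of the orthogonalization after the rows before `J` have been treated and row `J` has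
been made orthogonal to the rows before `I`. -/
structure OrthoStage {r d : ℕ} (M : Matrix (Fin r) (Fin d) ℝ) (w₀ : ℕ → Fin r → ℝ)
    (c₀ : ℕ → Fin d → ℝ) (J I : ℕ) (w : ℕ → Fin r → ℝ) (c : ℕ → Fin d → ℝ) : Prop where
  tail : ∀ j, J < j → c j = c₀ j
  residual : ∀ j, w j - M *ᵥ c j = w₀ j - M *ᵥ c₀ j
  ortho : ∀ i j, i < j → j < J → w i ⬝ᵥ w j = 0
  ortho_current : ∀ i < I, w i ⬝ᵥ w J = 0
  row : ∀ j, j ≤ d → ∃ u, c j = Mᵀ *ᵥ u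
  span : ∀ j, c j - c₀ j ∈ Submodule.span ℝ (c '' {i | i < j})

theorem OrthoStage.init {r d : ℕ} {M : Matrix (Fin r) (Fin d) ℝ} {w₀ : ℕ → Fin r → ℝ}
    {c₀ : ℕ → Fin d → ℝ} (hrow : ∀ j, j ≤ d → ∃ u, c₀ j = Mᵀ *ᵥ u) :
    OrthoStage M w₀ c₀ 0 0 w₀ c₀ :=
  ⟨fun _ _ => rfl, fun _ => rfl, fun _ _ _ h => by omega, fun _ h => by omega, hrow,
    fun j => by simp⟩

theorem OrthoStage.next {r d : ℕ} {M : Matrix (Fin r) (Fin d) ℝ} {w₀ w : ℕ → Fin r → ℝ}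
    {c₀ c : ℕ → Fin d → ℝ} {J : ℕ} (h : OrthoStage M w₀ c₀ J J w c) :
    OrthoStage M w₀ c₀ (J + 1) 0 w c where
  tail j hj := h.tail j (by omega)
  residual := h.residual
  ortho i j hij hj := by
    rcases Nat.lt_succ_iff_lt_or_eq.mp hj with h' | h'
    · exact h.ortho i j hij h'
    · subst h'; exact h.ortho_current i hij
  ortho_current i hi := by omega
  row := h.row
  span := h.span

/-- The same combination is subtracted from the vector and from its coefficients, so w - M c never
changes; it is zero for the rows before `d`. -/
theorem OrthoStage.step {r d : ℕ} {M : Matrix (Fin r) (Fin d) ℝ} {w₀ w w' : ℕ → Fin r → ℝ}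
    {c₀ c c' : ℕ → Fin d → ℝ} {J I : ℕ} (h : OrthoStage M w₀ c₀ J I w c) (hI : I < J)
    (hJ : J ≤ d) (h₀ : w₀ I = M *ᵥ c₀ I) {τ : ℝ} (hτ : τ = (w J ⬝ᵥ w I) / (w I ⬝ᵥ w I))
    (hw : w' J = w J - τ • w I) (hw' : ∀ j ≠ J, w' j = w j)
    (hc : c' J = c J - τ • c I) (hc' : ∀ j ≠ J, c' j = c j) :
    OrthoStage M w₀ c₀ J (I + 1) w' c' where
  tail j hj := by rw [hc' j hj.ne', h.tail j hj]
  residual j := by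
    by_cases hj : j = J
    · have hI' : w I = M *ᵥ c I := by
        have := h.residual I
        rwa [h₀, sub_self, sub_eq_zero] at this
      subst hj
      rw [hw, hc, Matrix.mulVec_sub, Matrix.mulVec_smul, ← hI', ← h.residual j]
      abel
    · rw [hc' j hj, hw' j hj, h.residual]
  ortho i j hij hj := by
    rw [hw' i (by omega), hw' j (by omega), h.ortho i j hij hj]
  ortho_current i hi := by
    rw [hw' i (by omega), hw, dotProduct_sub, dotProduct_smul, smul_eq_mul]
    rcases Nat.lt_succ_iff_lt_or_eq.mp hi with h' | h'
    · rw [h.ortho_current i h', h.ortho i I h' hI]; ring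
    · subst h'
      -- For a vanishing vector the division returns 0, so nothing is subtracted, and orthogonality
      -- to it is automatic.
      by_cases h0 : w i ⬝ᵥ w i = 0
      · rw [dotProduct_self_eq_zero.mp h0]; simp
      · rw [hτ, dotProduct_comm (w i) (w J)]; field_simp; ring
  row j hj := by
    by_cases hjJ : j = J
    · subst hjJ
      obtain ⟨u, hu⟩ := h.row j hj
      obtain ⟨u', hu'⟩ := h.row I (by omega)
      exact ⟨u - τ • u', by rw [hc, hu, hu', Matrix.mulVec_sub, Matrix.mulVec_smul]⟩
    · rw [hc' j hjJ]; exact h.row j hj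
  span j := by
    rcases lt_trichotomy j J with hj | hj | hj
    · rw [hc' j hj.ne]
      have : c' '' {i | i < j} = c '' {i | i < j} :=
        Set.image_congr fun i (hi : i < j) => hc' i (by omega)
      rw [this]; exact h.span j
    · subst hj
      have : c' '' {i | i < j} = c '' {i | i < j} :=
        Set.image_congr fun i (hi : i < j) => hc' i (by omega)
      rw [this, hc, sub_right_comm]
      exact Submodule.sub_mem _ (h.span j)
        (Submodule.smul_mem _ _ (Submodule.subset_span ⟨I, hI, rfl⟩))
    · rw [hc' j hj.ne', h.tail j hj]; simp

/-- At the end w_d = y + M c_d is orthogonal to every M c_i, hence to every M MᵀM e_j, which forces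
Mᵀ w_d = 0. So -c_d solves the normal equations, and it stayed in the row space. -/
theorem OrthoStage.pinv_mulVec {r d : ℕ} {M : Matrix (Fin r) (Fin d) ℝ} {y : Fin r → ℝ}
    {w₀ w : ℕ → Fin r → ℝ} {c₀ c : ℕ → Fin d → ℝ} (h : OrthoStage M w₀ c₀ (d + 1) 0 w c)
    (h₀ : ∀ j < d, w₀ j = M *ᵥ c₀ j) (hc₀ : ∀ j : Fin d, c₀ j = Mᵀ *ᵥ M.col j)
    (hc : c₀ d = 0) (hw : w₀ d = y) : pinv M *ᵥ y = - c d := by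
  have hwd : w d = y + M *ᵥ c d := by
    have := h.residual d
    rw [hc, hw, Matrix.mulVec_zero, sub_zero] at this
    rw [← this]; abel
  have hwi : ∀ i < d, w i = M *ᵥ c i := fun i hi => by
    have := h.residual i
    rwa [h₀ i hi, sub_self, sub_eq_zero] at this
  obtain ⟨u, hu⟩ := h.row d le_rfl
  have key : ∀ x ∈ Submodule.span ℝ (c '' {i | i < d}), (M *ᵥ x) ⬝ᵥ w d = 0 := by
    intro x hx
    induction hx using Submodule.span_induction with
    | mem x hx =>
      obtain ⟨i, hi, rfl⟩ := hx
      rw [← hwi i hi]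
      exact h.ortho i d hi (by omega)
    | zero => simp
    | add x y _ _ hx hy => rw [Matrix.mulVec_add, add_dotProduct, hx, hy, add_zero]
    | smul a x _ hx => rw [Matrix.mulVec_smul, smul_dotProduct, hx, smul_zero]
  have key2 : ∀ j : Fin d, (M *ᵥ (Mᵀ *ᵥ M.col j)) ⬝ᵥ w d = 0 := by
    intro j
    rw [← hc₀ j]
    apply key
    -- The original coefficient vector is c_j minus the correction c_j - c₀_j, and both lie in the
    -- span of the final coefficient vectors.
    have h1 : c j ∈ Submodule.span ℝ (c '' {i | i < d}) :=
      Submodule.subset_span ⟨j, j.2, rfl⟩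
    have h2 := Submodule.span_mono (R := ℝ) (Set.image_mono (f := c)
      (show {i | i < (j : ℕ)} ⊆ {i | i < d} from fun i hi => lt_trans hi j.2)) (h.span j)
    simpa using Submodule.sub_mem _ h1 h2
  have key3 : Mᵀ *ᵥ w d = 0 := by
    apply transpose_mulVec_eq_zero
    funext j
    rw [Pi.zero_apply, ← key2 j, dotProduct_comm, Matrix.dotProduct_mulVec,
      Matrix.dotProduct_mulVec, ← Matrix.mulVec_transpose, ← Matrix.mulVec_transpose,
      Matrix.transpose_transpose, dotProduct_comm]
    rfl
  refine pinv_mulVec_eq M y (- c d) (-u) (by rw [hu, Matrix.mulVec_neg]) ?_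
  rw [Matrix.mulVec_neg, sub_neg_eq_add, ← hwd, key3]

/-- Column `j` of `MᵀM` is put into row `j` of array `7`, its image under `M` into row `j` of
array `8`; row `d` of these arrays gets `0` and the right hand side. -/
def gramProg : Prog :=
  .seq (.loop 12 (.get 1 (.lit 1)) (.loop 10 (.get 1 (.lit 1)) (.seq
    (dotProg 11 (.get 1 (.lit 2)) ⟨6, var 11, var 12⟩ ⟨6, var 11, var 10⟩)
    (.copy ⟨7, var 12, var 10⟩ (scal 9))))) <|
  .seq (.loop 12 (.get 1 (.lit 1)) (.loop 10 (.get 1 (.lit 2)) (.seq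
    (dotProg 11 (.get 1 (.lit 1)) ⟨7, var 12, var 11⟩ ⟨6, var 10, var 11⟩)
    (.copy ⟨8, var 12, var 10⟩ (scal 9))))) <|
  .loop 10 (.get 1 (.lit 2)) (.copy ⟨8, .get 1 (.lit 1), var 10⟩ ⟨6, var 10, .get 1 (.lit 1)⟩)

/-- One Gram-Schmidt step: make row `V₁₂` of array `8` orthogonal to row `V₁₀`. -/
def orthoStepProg : Prog :=
  .seq (dotProg 11 (.get 1 (.lit 2)) ⟨8, var 12, var 11⟩ ⟨8, var 10, var 11⟩) <|
  .seq (.copy (scal 11) (scal 9)) <|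
  .seq (dotProg 11 (.get 1 (.lit 2)) ⟨8, var 10, var 11⟩ ⟨8, var 10, var 11⟩) <|
  .seq (.arith .div (scal 11) (scal 11) (scal 9)) <|
  .seq (axpyProg 11 (.get 1 (.lit 2)) 8 12 10) (axpyProg 11 (.get 1 (.lit 1)) 7 12 10)

def orthoProg : Prog :=
  .loop 12 (.add (.get 1 (.lit 1)) (.lit 1)) (.loop 10 (var 12) orthoStepProg)

/-- Put the least squares solution for the rows stored in array `6` into array `3`. -/
def leastSquaresProg : Prog :=
  .seq gramProg <| .seq orthoProg <|
    .loop 10 (.get 1 (.lit 1)) (.arith .sub ⟨3, var 10, .lit 0⟩ (scal 20)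
      ⟨7, .get 1 (.lit 1), var 10⟩)

/-- Starting from the vectors MᵀM e_j instead of e_j keeps all later combinations in the row space
of `M`, so that the minimal norm solution comes out. The initial zeros of array 7 serve as the
coefficients of the right hand side. -/
theorem gramProg_runs {N : ℕ → ℕ → ℕ} {R : ℕ → ℕ → ℕ → ℝ} {d r : ℕ} (hd : N 1 1 = d)
    (hr : N 1 2 = r) (M : Matrix (Fin r) (Fin d) ℝ) (y : Fin r → ℝ)
    (hM : ∀ t a, R 6 (t : Fin r) (a : Fin d) = M t a) (hy : ∀ t, R 6 (t : Fin r) d = y t)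
    (h7 : ∀ a, R 7 d a = 0) :
    Runs gramProg N R (d * (d * (r * 2 + 2)) + (d * (r * (d * 2 + 2)) + r))
      ((d * (d * (r * 3 + 4) + 2) + 1) + ((d * (r * (d * 3 + 4) + 2) + 1) + (r * 2 + 1)))
      fun N' R' => EqOff {10, 11, 12} N N' ∧ EqOff {7, 8, 9, 10} R R' ∧
      (∀ j : Fin d, (fun a : Fin d => R' 7 j a) = Mᵀ *ᵥ M.col j) ∧
      (∀ j < d, (fun t : Fin r => R' 8 j t) = M *ᵥ fun a : Fin d => R' 7 j a) ∧
      (∀ a, R' 7 d a = 0) ∧ ∀ t : Fin r, R' 8 d t = y t := by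
  refine Runs.seq (fillLoop_runs (ρ := 0) (A := 7) {11} {9, 10}
    (fun i j => ∑ t ∈ Finset.range r, R 6 t i * R 6 t j) (by decide) (by decide) hd
    (fun N' h => by simp [IExp.val, h 1 (by decide), hd]) ?_) ?_
  · intro i hi j hj N' R' h1 h2 h3 h4 h5
    refine Runs.seq (c' := 1) (w' := 1) (dotProg_runs (m := r) (fun t => R 6 t i) (fun t => R 6 t j)
      (by simp [IExp.val, h1 1 (by decide), hr]) (by decide) (by decide)
      (fun k hk => by simp [Cell.val, IExp.val, setN_apply, h2, h4 6 (by decide)])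
      (fun k hk => by simp [Cell.val, IExp.val, setN_apply, h3, h4 6 (by decide)])) ?_
    rintro N'' R'' ⟨k1, k2, k3⟩
    refine Runs.copy (c := 0) (w := 0) ⟨k1.mono (by decide), (k2.mono (by decide)).setR (by decide) _ _ _, ?_⟩
    intro a b
    simp [setR_apply, Cell.val, IExp.val, k3, k1 12 (by decide), k1 10 (by decide), h2, h3,
      k2 7 (by decide)]
  rintro N₁ R₁ ⟨f1, f2, f3⟩
  refine Runs.seq (fillLoop_runs (ρ := 0) (A := 8) {11} {9, 10}
    (fun i j => ∑ t ∈ Finset.range d, R₁ 7 i t * R₁ 6 j t) (by decide) (by decide)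
    (by simp [IExp.val, f1 1 (by decide), hd])
    (fun N' h => by simp [IExp.val, h 1 (by decide), f1 1 (by decide), hr]) ?_) ?_
  · intro i hi j hj N' R' h1 h2 h3 h4 h5
    refine Runs.seq (c' := 1) (w' := 1) (dotProg_runs (m := d) (fun t => R₁ 7 i t) (fun t => R₁ 6 j t)
      (by simp [IExp.val, h1 1 (by decide), f1 1 (by decide), hd]) (by decide) (by decide)
      (fun k hk => by simp [Cell.val, IExp.val, setN_apply, h2, h4 7 (by decide)])
      (fun k hk => by simp [Cell.val, IExp.val, setN_apply, h3, h4 6 (by decide)])) ?_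
    rintro N'' R'' ⟨k1, k2, k3⟩
    refine Runs.copy (c := 0) (w := 0) ⟨k1.mono (by decide), (k2.mono (by decide)).setR (by decide) _ _ _, ?_⟩
    intro a b
    simp [setR_apply, Cell.val, IExp.val, k3, k1 12 (by decide), k1 10 (by decide), h2, h3,
      k2 8 (by decide)]
  rintro N₂ R₂ ⟨g1, g2, g3⟩
  have hN2 : N₂ 1 = N 1 := by rw [g1 1 (by decide), f1 1 (by decide)]
  refine (Runs.loop (c := 1) (w := 1) (m := r) (fun k N' R' => EqOff {10} N₂ N' ∧ EqOff {8} R₂ R' ∧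
    ∀ a b, R' 8 a b = if a = d ∧ b < k then R₂ 6 b d else R₂ 8 a b)
    (by simp [IExp.val, hN2, hr]) ?_ ?_ fun _ _ h => h).mono (by omega) le_rfl ?_
  · exact ⟨EqOff.refl _ _, EqOff.refl _ _, by simp⟩
  · rintro k hk N' R' ⟨h1, h2, h3⟩
    refine Runs.copy (c := 0) (w := 0) ⟨h1.setN (by decide) _ _, h2.setR (by decide) _ _ _, ?_⟩
    intro a b
    simp only [setR_apply, Cell.val, IExp.val, setN_apply, h1 1 (by decide), hN2, hd,
      h2 6 (by decide), h3, true_and, if_true, and_true]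
    rcases lt_trichotomy b k with h | h | h
    · simp [h.ne, h, h.trans (Nat.lt_succ_self k)]
    · subst h; simp
    · simp [h.ne', not_lt.mpr h.le, show ¬ b < k + 1 by omega]
  · rintro N₃ R₃ ⟨h1, h2, h3⟩
    have e7 : R₃ 7 = R₁ 7 := by rw [h2 7 (by decide), g2 7 (by decide)]
    have e6 : R₁ 6 = R 6 := f2 6 (by decide)
    have e6' : R₂ 6 = R 6 := by rw [g2 6 (by decide), e6]
    refine ⟨((f1.trans g1).trans h1).mono (by decide), ((f2.trans g2).trans h2).mono (by decide),
      ?_, ?_, ?_, ?_⟩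
    · intro j
      funext a
      rw [e7, f3, if_pos (by simp)]
      simp only [Nat.sub_zero, Finset.sum_range, hM, Matrix.mulVec, dotProduct,
        Matrix.transpose_apply, Matrix.col_apply]
      exact Finset.sum_congr rfl fun _ _ => mul_comm _ _
    · intro j hj
      funext t
      rw [h3, if_neg (by omega), g3, if_pos (by simp [hj])]
      simp only [Nat.sub_zero, Finset.sum_range, e6, hM, Matrix.mulVec, dotProduct, e7]
      exact Finset.sum_congr rfl fun _ _ => mul_comm _ _
    · intro a
      rw [e7, f3, if_neg (by omega), h7]
    · intro t
      rw [h3, if_pos (by simp), e6', hy]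

theorem orthoStepProg_runs {N : ℕ → ℕ → ℕ} {R : ℕ → ℕ → ℕ → ℝ} {d r J I : ℕ} (hd : N 1 1 = d)
    (hr : N 1 2 = r) (hJ : N 12 0 = J) (hI : N 10 0 = I) (hIJ : I < J) (hJd : J ≤ d)
    {M : Matrix (Fin r) (Fin d) ℝ} {w₀ : ℕ → Fin r → ℝ} {c₀ : ℕ → Fin d → ℝ}
    (h₀ : w₀ I = M *ᵥ c₀ I)
    (h : OrthoStage M w₀ c₀ J I (fun j t => R 8 j t) (fun j a => R 7 j a)) :
    Runs orthoStepProg N R (6 * r + 2 * d + 4) (9 * r + 3 * d + 8)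
      fun N' R' => EqOff {11} N N' ∧ EqOff {7, 8, 9, 10, 11} R R' ∧
      OrthoStage M w₀ c₀ J (I + 1) (fun j t => R' 8 j t) (fun j a => R' 7 j a) := by
  set w : ℕ → Fin r → ℝ := fun j t => R 8 j t with hw
  set c : ℕ → Fin d → ℝ := fun j t => R 7 j t with hc
  refine Runs.mono (c := (r * 2 + 1) + ((r * 2 + 1 + (r * 2 + d * 2 + 1)) + 1))
    (w := (r * 3 + 2) + ((r * 3 + 2 + (r * 3 + 1 + (d * 3 + 1) + 1)) + 1))
    (Runs.seq (dotProg_runs (m := r) (fun t => R 8 J t) (fun t => R 8 I t)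
      (by simp [IExp.val, hr]) (by decide) (by decide)
      (fun k hk => by simp [Cell.val, IExp.val, setN_apply, hJ])
      (fun k hk => by simp [Cell.val, IExp.val, setN_apply, hI])) ?_)
      (by omega) (by omega) fun _ _ h => h
  rintro N₁ R₁ ⟨f1, f2, f3⟩
  refine Runs.copy_seq ?_
  refine Runs.seq (dotProg_runs (m := r) (fun t => R 8 I t) (fun t => R 8 I t)
      (by simp [IExp.val, hr, f1 1 (by decide)]) (by decide) (by decide)
      (fun k hk => by simp [Cell.val, IExp.val, setN_apply, hI, f1 10 (by decide), setR_apply,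
        f2 8 (by decide)])
      (fun k hk => by simp [Cell.val, IExp.val, setN_apply, hI, f1 10 (by decide), setR_apply,
        f2 8 (by decide)])) ?_
  rintro N₂ R₂ ⟨g1, g2, g3⟩
  refine Runs.arith_seq ?_
  have hN2 : EqOff {11} N N₂ := (f1.trans g1).mono (by decide)
  set R₃ := setR R₂ (scal 11).arr ((scal 11).row.val N₂) ((scal 11).col.val N₂)
    (ROp.div.eval ((scal 11).val N₂ R₂) ((scal 9).val N₂ R₂)) with hR₃
  have hR3 : EqOff {9, 10, 11} R R₃ := by
    refine EqOff.setR ?_ (by decide) _ _ _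
    refine EqOff.mono (EqOff.trans (EqOff.setR (f2.mono ?_) (S := {9, 10, 11}) ?_ _ _ _) g2) ?_ <;>
      decide
  have hτ : R₃ 11 0 0 = (w J ⬝ᵥ w I) / (w I ⬝ᵥ w I) := by
    simp only [hR₃, setR_apply, IExp.val, ROp.eval, Cell.val, and_self, if_true,
      g2 11 (by decide), f3, g3]
    simp only [Finset.sum_range]
    rfl
  clear_value R₃
  refine (Runs.seq (axpyProg_runs (m := r) (by simp [IExp.val, hN2 1 (by decide), hr])
    (by decide) (by decide) (by decide) (by decide)
    (by rw [hN2 12 (by decide), hN2 10 (by decide), hI, hJ]; omega)) ?_)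
  rintro N₄ R₄ ⟨k1, k2, k3⟩
  have hN4 : EqOff {11} N N₄ := (hN2.trans k1).mono (by decide)
  refine Runs.mono (axpyProg_runs (m := d) (by simp [IExp.val, hN4 1 (by decide), hd])
    (by decide) (by decide) (by decide) (by decide)
    (by rw [hN4 12 (by decide), hN4 10 (by decide), hI, hJ]; omega)) le_rfl le_rfl ?_
  rintro N₅ R₅ ⟨l1, l2, l3⟩
  rw [hN2 12 (by decide), hN2 10 (by decide), hI, hJ] at k3
  rw [hN4 12 (by decide), hN4 10 (by decide), hI, hJ] at l3
  refine ⟨(hN4.trans l1).mono (by decide), ((hR3.trans k2).trans l2).mono (by decide), ?_⟩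
  have e8 : R₅ 8 = R₄ 8 := l2 8 (by decide)
  refine h.step hIJ hJd h₀ hτ ?_ ?_ ?_ ?_
  · funext t
    simp [e8, k3, hw, hR3 8 (by decide)]
  · intro j hj
    funext t
    simp [e8, k3, hw, hR3 8 (by decide), hj]
  · funext t
    simp [l3, hc, k2 7 (by decide), k2 11 (by decide), hR3 7 (by decide)]
  · intro j hj
    funext t
    simp [l3, hc, k2 7 (by decide), hR3 7 (by decide), hj]

theorem orthoProg_runs {N : ℕ → ℕ → ℕ} {R : ℕ → ℕ → ℕ → ℝ} {d r : ℕ} (hd : N 1 1 = d)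
    (hr : N 1 2 = r) {M : Matrix (Fin r) (Fin d) ℝ}
    {w₀ : ℕ → Fin r → ℝ} {c₀ : ℕ → Fin d → ℝ}
    (h₀ : ∀ i < d, w₀ i = M *ᵥ c₀ i)
    (h : OrthoStage M w₀ c₀ 0 0 (fun j t => R 8 j t) (fun j a => R 7 j a)) :
    Runs orthoProg N R ((d + 1) * (d * (6 * r + 2 * d + 4)))
      ((d + 1) * (d * (9 * r + 3 * d + 9) + 2) + 1)
      fun N' R' => EqOff {10, 11, 12} N N' ∧ EqOff {7, 8, 9, 10, 11} R R' ∧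
      OrthoStage M w₀ c₀ (d + 1) 0 (fun j t => R' 8 j t) (fun j a => R' 7 j a) := by
  refine Runs.loop (w := d * (9 * r + 3 * d + 9) + 1) (fun J N' R' => EqOff {10, 11, 12} N N' ∧
    EqOff {7, 8, 9, 10, 11} R R' ∧
    OrthoStage M w₀ c₀ J 0 (fun j t => R' 8 j t) (fun j a => R' 7 j a))
    (by simp [IExp.val, hd]) ⟨EqOff.refl _ _, EqOff.refl _ _, h⟩ ?_ fun _ _ h => h
  rintro J hJ N₁ R₁ ⟨f1, f2, f3⟩
  refine Runs.mono (c := J * (6 * r + 2 * d + 4)) (w := J * (9 * r + 3 * d + 9) + 1)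
    (Runs.loop (w := 9 * r + 3 * d + 8) (m := J) (fun I N' R' => EqOff {10, 11, 12} N N' ∧ N' 12 0 = J ∧
    EqOff {7, 8, 9, 10, 11} R R' ∧
    OrthoStage M w₀ c₀ J I (fun j t => R' 8 j t) (fun j a => R' 7 j a)) ?_ ?_ ?_
    (Q := fun N' R' => EqOff {10, 11, 12} N N' ∧
    EqOff {7, 8, 9, 10, 11} R R' ∧
    OrthoStage M w₀ c₀ (J + 1) 0 (fun j t => R' 8 j t) (fun j a => R' 7 j a)) ?_)
    (Nat.mul_le_mul_right _ (by omega)) (Nat.add_le_add_right (Nat.mul_le_mul_right _ (by omega)) _)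
    fun _ _ h => h
  · simp [IExp.val, setN_apply]
  · exact ⟨f1.setN (by decide) _ _, by simp [setN_apply], f2, f3⟩
  · rintro I hI N₂ R₂ ⟨g1, g2, g3, g4⟩
    have g1' := g1.setN (a := 10) (by decide) 0 I
    refine (orthoStepProg_runs (J := J) (I := I) (by rw [g1' 1 (by decide), hd])
      (by rw [g1' 1 (by decide), hr]) (by simp [setN_apply, g2]) (by simp [setN_apply]) hI
      (by omega) (h₀ I (by omega)) g4).mono le_rfl le_rfl ?_
    rintro N₃ R₃ ⟨h1, h2, h3⟩
    refine ⟨(g1'.trans h1).mono (by decide), ?_, (g3.trans h2).mono (by decide), h3⟩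
    rw [h1 12 (by decide)]
    simp [setN_apply, g2]
  · rintro N₂ R₂ ⟨g1, g2, g3, g4⟩
    exact ⟨g1, g3, g4.next⟩

theorem leastSquaresProg_runs {N : ℕ → ℕ → ℕ} {R : ℕ → ℕ → ℕ → ℝ} {d r : ℕ} (hd0 : 0 < d)
    (hdr : d ≤ r) (hd : N 1 1 = d)
    (hr : N 1 2 = r) (M : Matrix (Fin r) (Fin d) ℝ) (y : Fin r → ℝ)
    (hM : ∀ t a, R 6 (t : Fin r) (a : Fin d) = M t a) (hy : ∀ t, R 6 (t : Fin r) d = y t)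
    (h7 : ∀ j a, R 7 j a = 0) (h20 : R 20 0 0 = 0) :
    Runs leastSquaresProg N R (40 * (r * d ^ 2)) (80 * (r * d ^ 2))
      fun _ R' => ∀ j : Fin d, R' 3 j 0 = (pinv M *ᵥ y) j := by
  -- From 1 ≤ d ≤ r, all lower order terms are absorbed into r d².
  have hcost : r ≤ r * d ∧ r * d ≤ r * d * d ∧ d * d * d ≤ r * d * d ∧ d * d ≤ r * d ∧ 1 ≤ r := by
    refine ⟨Nat.le_mul_of_pos_right _ hd0, Nat.le_mul_of_pos_right _ hd0, ?_, ?_, by omega⟩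
    · exact Nat.mul_le_mul_right _ (Nat.mul_le_mul_right _ hdr)
    · exact Nat.mul_le_mul_right _ hdr
  refine Runs.mono (Runs.seq (gramProg_runs hd hr M y hM hy (h7 d)) (Q' := fun _ R' =>
    ∀ j : Fin d, R' 3 j 0 = (pinv M *ᵥ y) j)
    (c' := ((d + 1) * (d * (6 * r + 2 * d + 4))) + d * 1)
    (w' := ((d + 1) * (d * (9 * r + 3 * d + 9) + 2) + 1) + (d * 2 + 1)) ?_) ?_ ?_ fun _ _ h => h
  · rintro N₁ R₁ ⟨f1, f2, f3, f4, f5, f6⟩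
    refine Runs.seq (orthoProg_runs (M := M) (w₀ := fun j t => R₁ 8 j t) (c₀ := fun j a => R₁ 7 j a)
      (by rw [f1 1 (by decide), hd]) (by rw [f1 1 (by decide), hr]) f4 (OrthoStage.init ?_)) ?_
    · intro j hj
      rcases hj.lt_or_eq with hj | rfl
      · exact ⟨_, f3 ⟨j, hj⟩⟩
      · exact ⟨0, by funext a; simp [f5]⟩
    · rintro N₂ R₂ ⟨g1, g2, g3⟩
      have hx := g3.pinv_mulVec (y := y) f4 f3 (by funext a; simp [f5]) (by funext t; simp [f6])
      have hN : N₂ 1 = N 1 := by rw [g1 1 (by decide), f1 1 (by decide)]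
      -- Array 20 is never written, so its entry supplies the constant 0 from which c_d is
      -- subtracted.
      refine Runs.loop (w := 1) (fun k N' R' => EqOff {10} N₂ N' ∧ EqOff {3} R₂ R' ∧
        ∀ j < k, R' 3 j 0 = - R₂ 7 d j) (m := d) (by simp [IExp.val, hN, hd])
        ⟨EqOff.refl _ _, EqOff.refl _ _, by simp⟩ ?_ ?_
      · rintro k hk N' R' ⟨h1, h2, h3⟩
        refine Runs.arith (c := 0) (w := 0) ⟨h1.setN (by decide) _ _, h2.setR (by decide) _ _ _, ?_⟩
        intro j hj
        simp only [setR_apply, Cell.val, IExp.val, setN_apply, h1 1 (by decide), hN, hd,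
          h2 20 (by decide), h2 7 (by decide), ROp.eval, g2 20 (by decide), f2 20 (by decide), h20]
        rcases Nat.lt_succ_iff_lt_or_eq.mp hj with h | h
        · simp [h.ne, h3 j h]
        · simp [h]
      · rintro N' R' ⟨h1, h2, h3⟩ j
        rw [h3 j j.2, hx]
        rfl
  · obtain ⟨h1, h2, h3, h4, h5⟩ := hcost
    nlinarith only [h1, h2, h3, h4, h5, hdr]
  · obtain ⟨h1, h2, h3, h4, h5⟩ := hcost
    nlinarith only [h1, h2, h3, h4, h5, hdr]

/-! ### The Walsh-Hadamard transform -/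

/-- The entries of the unnormalized Hadamard matrix of size `2 ^ l`; only the last `l` binary
digits of the indices are used. -/
def walsh (l a c : ℕ) : ℝ :=
  ∏ b ∈ Finset.range l, if a.testBit b ∧ c.testBit b then -1 else 1

theorem walsh_succ (l a c : ℕ) :
    walsh (l + 1) a c = walsh l a c * if a.testBit l ∧ c.testBit l then -1 else 1 :=
  Finset.prod_range_succ _ _

theorem walsh_comm (l a c : ℕ) : walsh l a c = walsh l c a := by
  simp only [walsh, and_comm]

theorem walsh_congr_left {l a a' : ℕ} (c : ℕ) (h : ∀ b < l, a.testBit b = a'.testBit b) :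
    walsh l a c = walsh l a' c :=
  Finset.prod_congr rfl fun b hb => by rw [h b (Finset.mem_range.mp hb)]

theorem walsh_congr_right {l c c' : ℕ} (a : ℕ) (h : ∀ b < l, c.testBit b = c'.testBit b) :
    walsh l a c = walsh l a c' := by
  rw [walsh_comm, walsh_congr_left a h, walsh_comm]

theorem walsh_mul_self (l a c : ℕ) : walsh l a c * walsh l a c = 1 := by
  rw [walsh, ← Finset.prod_mul_distrib]
  exact Finset.prod_eq_one fun b _ => by split_ifs <;> norm_num

theorem testBit_add_two_pow_mul {l a : ℕ} (x : ℕ) {b : ℕ} (hb : b < l) :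
    (2 ^ l * x + a).testBit b = a.testBit b := by
  have h : (2 ^ l * x + a) % 2 ^ l = a % 2 ^ l := by simp
  have h1 := Nat.testBit_mod_two_pow (2 ^ l * x + a) l b
  have h2 := Nat.testBit_mod_two_pow a l b
  rw [h] at h1
  simpa [hb, h1] using h2.symm.trans h1 |>.symm

/-- Kronecker factorization: the low `j` and the high `s` binary digits contribute independent sign
factors. -/
theorem walsh_tensor (j s hi lo c o : ℕ) (hlo : lo < 2 ^ j) (ho : o < 2 ^ j) :
    walsh (j + s) (2 ^ j * hi + lo) (2 ^ j * c + o) = walsh j lo o * walsh s hi c := by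
  rw [walsh, Finset.prod_range_add]
  congr 1
  · refine Finset.prod_congr rfl fun b hb => ?_
    rw [testBit_add_two_pow_mul _ (Finset.mem_range.mp hb),
      testBit_add_two_pow_mul _ (Finset.mem_range.mp hb)]
  · refine Finset.prod_congr rfl fun b _ => ?_
    rw [Nat.testBit_two_pow_mul_add _ hlo, Nat.testBit_two_pow_mul_add _ ho]
    simp

theorem walsh_of_lt {l s : ℕ} (hls : l ≤ s) (a : ℕ) {c : ℕ} (hc : c < 2 ^ l) :
    walsh s a c = walsh l a c := by
  obtain ⟨t, rfl⟩ := Nat.exists_eq_add_of_le hls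
  rw [walsh, Finset.prod_range_add, walsh, mul_eq_left₀]
  · refine Finset.prod_eq_one fun b _ => ?_
    rw [Nat.testBit_lt_two_pow (hc.trans_le (Nat.pow_le_pow_right (by norm_num) (by omega)))]
    simp
  · exact Finset.prod_ne_zero_iff.mpr fun b _ => by split_ifs <;> norm_num

theorem walsh_two_pow_add {l : ℕ} (a : ℕ) {o : ℕ} (ho : o < 2 ^ l) :
    walsh (l + 1) a (2 ^ l + o) = walsh l a o * if a.testBit l then -1 else 1 := by
  rw [walsh_succ]
  congr 1
  · refine walsh_congr_right a fun b hb => ?_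
    simpa using testBit_add_two_pow_mul (a := o) 1 hb
  · rw [Nat.testBit_two_pow_add_eq, Nat.testBit_lt_two_pow ho]
    simp

theorem hadamardMat_apply (k : ℕ) (i j : Fin (2 ^ k)) : hadamardMat k i j = walsh k i j := by
  induction k with
  | zero => simp [hadamardMat, walsh]
  | succ k ih =>
    obtain ⟨x, rfl⟩ := (halves k).surjective i
    obtain ⟨y, rfl⟩ := (halves k).surjective j
    have hl : ∀ a : Fin (2 ^ k), ((halves k (Sum.inl a) : Fin _) : ℕ) = a := fun a => by
      simp [halves]
    have hr : ∀ a : Fin (2 ^ k), ((halves k (Sum.inr a) : Fin _) : ℕ) = 2 ^ k + a := fun a => by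
      simp [halves, add_comm]
    have h0 : ∀ a : Fin (2 ^ k), (a : ℕ).testBit k = false := fun a =>
      Nat.testBit_lt_two_pow a.2
    have hrow : ∀ (a : Fin (2 ^ k)) (c : ℕ), walsh k (2 ^ k + a) c = walsh k a c := fun a c =>
      walsh_congr_left c fun b hb => by simpa using testBit_add_two_pow_mul (a := a) 1 hb
    simp only [hadamardMat, Matrix.reindex_apply, Matrix.submatrix_apply, Equiv.symm_apply_apply]
    rcases x with a | a <;> rcases y with c | c
    · rw [Matrix.fromBlocks_apply₁₁, ih, hl, hl, walsh_succ, h0]; simp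
    · rw [Matrix.fromBlocks_apply₁₂, ih, hl, hr, walsh_two_pow_add _ c.2, h0]; simp
    · rw [Matrix.fromBlocks_apply₂₁, ih, hl, hr, walsh_succ, h0, hrow]; simp
    · rw [Matrix.fromBlocks_apply₂₂, Matrix.neg_apply, ih, hr, hr, walsh_two_pow_add _ c.2,
        hrow, Nat.testBit_two_pow_add_eq, h0]; simp

/-- The partial transform of `z` on the last `l` binary digits of the index. -/
def partialWalsh (z : ℕ → ℝ) (l i : ℕ) : ℝ :=
  ∑ o ∈ Finset.range (2 ^ l), walsh l i o * z (2 ^ l * (i / 2 ^ l) + o)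

theorem partialWalsh_zero (z : ℕ → ℝ) (i : ℕ) : partialWalsh z 0 i = z i := by
  simp [partialWalsh, walsh]

/-- The butterfly: a block of length 2^(l+1) splits into halves, and the second half enters with the
sign given by bit `l` of the row index, here +. The odd case has sign - and its partner on the other
side. -/
theorem partialWalsh_succ_of_even (z : ℕ → ℝ) (l i : ℕ) (h : i / 2 ^ l % 2 = 0) :
    partialWalsh z (l + 1) i = partialWalsh z l i + partialWalsh z l (i + 2 ^ l) := by
  have hb : i.testBit l = false := by rw [Nat.testBit_eq_decide_div_mod_eq]; simp [h]
  have hdiv : 2 ^ (l + 1) * (i / 2 ^ (l + 1)) = 2 ^ l * (i / 2 ^ l) := by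
    rw [pow_succ, ← Nat.div_div_eq_div_mul, mul_assoc]
    congr 1; omega
  have hpos : 0 < 2 ^ l := by positivity
  rw [partialWalsh, hdiv, pow_succ, mul_two, Finset.sum_range_add]
  congr 1
  · refine Finset.sum_congr rfl fun o ho => ?_
    rw [walsh_succ, hb]; simp
  · refine Finset.sum_congr rfl fun o ho => ?_
    rw [walsh_two_pow_add _ (Finset.mem_range.mp ho), hb, Nat.add_div_right _ hpos]
    congr 1
    · simp only [Bool.false_eq_true, if_false, mul_one]
      exact walsh_congr_left o fun b hb => by
        rw [add_comm]
        simpa using (testBit_add_two_pow_mul (a := i) 1 hb).symm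
    · congr 1; rw [Nat.mul_succ]; omega

theorem partialWalsh_succ_of_odd (z : ℕ → ℝ) (l i : ℕ) (h : i / 2 ^ l % 2 = 1) :
    partialWalsh z (l + 1) i = partialWalsh z l (i - 2 ^ l) - partialWalsh z l i := by
  have hb : i.testBit l = true := by rw [Nat.testBit_eq_decide_div_mod_eq]; simp [h]
  have hpos : 0 < 2 ^ l := by positivity
  have hle : 2 ^ l ≤ i := by
    by_contra hlt
    rw [Nat.div_eq_of_lt (by omega)] at h
    omega
  obtain ⟨i, rfl⟩ := Nat.exists_eq_add_of_le' hle
  rw [Nat.add_div_right _ hpos] at h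
  have hdiv : 2 ^ (l + 1) * ((i + 2 ^ l) / 2 ^ (l + 1)) = 2 ^ l * (i / 2 ^ l) := by
    rw [pow_succ, ← Nat.div_div_eq_div_mul, mul_assoc, Nat.add_div_right _ hpos]
    congr 1; omega
  have hw : ∀ o, walsh l (i + 2 ^ l) o = walsh l i o := fun o =>
    walsh_congr_left o fun b hb => by
      rw [add_comm]
      simpa using testBit_add_two_pow_mul (a := i) 1 hb
  rw [partialWalsh, hdiv, pow_succ, mul_two, Finset.sum_range_add, sub_eq_add_neg,
    Nat.add_sub_cancel, partialWalsh, partialWalsh, ← Finset.sum_neg_distrib]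
  congr 1
  · refine Finset.sum_congr rfl fun o ho => ?_
    rw [walsh_succ, Nat.testBit_lt_two_pow (Finset.mem_range.mp ho), hw]; simp
  · refine Finset.sum_congr rfl fun o ho => ?_
    rw [walsh_two_pow_add _ (Finset.mem_range.mp ho), hb, Nat.add_div_right _ hpos, Nat.mul_succ,
      add_assoc]
    simp

theorem sum_range_mul_eq (f : ℕ → ℝ) (m q : ℕ) :
    ∑ i ∈ Finset.range (m * q), f i =
      ∑ c ∈ Finset.range q, ∑ o ∈ Finset.range m, f (m * c + o) := by
  induction q with
  | zero => simp
  | succ q ih => rw [Nat.mul_succ, Finset.sum_range_add, ih, Finset.sum_range_succ]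

/-- By the Kronecker factorization, once the low `j` digits are transformed, an entry of the full
transform is a sum over the 2^s blocks, taken at one fixed offset inside each block. -/
theorem sum_walsh_partialWalsh (z : ℕ → ℝ) (j s i : ℕ) :
    ∑ c ∈ Finset.range (2 ^ s), walsh s (i / 2 ^ j) c *
        partialWalsh z j (c * 2 ^ j + (i - i / 2 ^ j * 2 ^ j)) =
      ∑ i' ∈ Finset.range (2 ^ (j + s)), walsh (j + s) i i' * z i' := by
  have hpos : 0 < 2 ^ j := by positivity
  have hlo : i - i / 2 ^ j * 2 ^ j = i % 2 ^ j := by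
    rw [mul_comm]; have := Nat.div_add_mod i (2 ^ j); omega
  have hlt := Nat.mod_lt i hpos
  rw [pow_add, sum_range_mul_eq, hlo]
  refine Finset.sum_congr rfl fun c _ => ?_
  rw [partialWalsh, Finset.mul_sum]
  refine Finset.sum_congr rfl fun o ho => ?_
  have h1 : (c * 2 ^ j + i % 2 ^ j) / 2 ^ j = c := by
    rw [mul_comm, Nat.mul_add_div hpos, Nat.div_eq_of_lt hlt]; simp
  have h2 : walsh j (c * 2 ^ j + i % 2 ^ j) o = walsh j (i % 2 ^ j) o :=
    walsh_congr_left o fun b hb => by rw [mul_comm]; exact testBit_add_two_pow_mul _ hb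
  conv_rhs => rw [← Nat.div_add_mod i (2 ^ j)]
  rw [walsh_tensor _ _ _ _ _ _ hlt (Finset.mem_range.mp ho), h1, h2]
  ring

/-! ### The sampled transform -/

/-- Put the largest power of two `m ≤ min n (r + 1)` into array `2`, its exponent into array `4`
and `n / m` into array `3`. -/
def blockSizeProg : Prog :=
  .seq (.setIdx 2 (.lit 0) (.lit 1)) <|
  .seq (.loop 10 (.get 1 (.lit 2)) <|
    .ifIdx (.mul (.lit 2) (var 2)) (.add (.get 1 (.lit 2)) (.lit 1))
      (.ifIdx (.mul (.lit 2) (var 2)) (.get 1 (.lit 0))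
        (.seq (.setIdx 2 (.lit 0) (.mul (.lit 2) (var 2)))
          (.setIdx 4 (.lit 0) (.add (var 4) (.lit 1)))) .skip) .skip) <|
  .setIdx 3 (.lit 0) (.div (.get 1 (.lit 0)) (var 2))

/-- The final disjunction records maximality: either the block is the whole vector, or doubling it
would exceed r + 1. -/
theorem blockSizeProg_runs {N : ℕ → ℕ → ℕ} {R : ℕ → ℕ → ℕ → ℝ} {n k r : ℕ} (hn : N 1 0 = n)
    (hk : n = 2 ^ k) (hr : N 1 2 = r) (h4 : N 4 0 = 0) :
    Runs blockSizeProg N R 0 (r * 5 + 3) fun N' R' => EqOff {2, 3, 4, 10} N N' ∧ R' = R ∧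
      ∃ j s, j + s = k ∧ N' 2 0 = 2 ^ j ∧ N' 4 0 = j ∧ N' 3 0 = 2 ^ s ∧ 2 ^ j ≤ r + 1 ∧
        (s = 0 ∨ r + 1 < 2 * 2 ^ j) := by
  refine Runs.setIdx_seq (Runs.mono (c := r * 0 + 0) (w := (r * (4 + 1) + 1) + 1)
    (Runs.seq (w' := 1) (Runs.loop (m := r) (w := 4)
    (fun i N' R' => EqOff {2, 4, 10} N N' ∧ R' = R ∧ ∃ j, N' 2 0 = 2 ^ j ∧ N' 4 0 = j ∧
      2 ^ j ≤ r + 1 ∧ 2 ^ j ≤ n ∧ (j = i ∨ r + 1 < 2 * 2 ^ j ∨ n < 2 * 2 ^ j)) ?_ ?_ ?_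
      fun _ _ h => h) ?_) (by omega) (by omega) fun _ _ h => h)
  · simp [IExp.val, setN_apply, hr]
  · refine ⟨(EqOff.refl _ _).setN (by decide) _ _, rfl, 0, by simp [setN_apply, IExp.val],
      by simp [setN_apply, h4], by simp, by rw [hk]; exact Nat.one_le_two_pow, by simp⟩
  · rintro i hi N₁ R₁ ⟨f1, rfl, j, f2, f3, f4, f5, f6⟩
    have g1 := f1.setN (a := 10) (by decide) 0 i
    have e2 : setN N₁ 10 0 i 2 0 = 2 ^ j := by simp [setN_apply, f2]
    have e4 : setN N₁ 10 0 i 4 0 = j := by simp [setN_apply, f3]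
    refine Runs.ifIdx (fun h => Runs.ifIdx (fun h' => Runs.setIdx_seq (Runs.setIdx (w := 0) ?_))
      (fun h' => Runs.skip ?_)) (fun h => Runs.skip ?_)
    · simp only [IExp.val, e2, g1 1 (by decide), hr, hn] at h h'
      refine ⟨(g1.setN (by decide) _ _).setN (by decide) _ _, rfl, j + 1, ?_, ?_, ?_, ?_, ?_⟩
      · simp only [IExp.val, e2, setN_apply]
        simp [pow_succ, mul_comm]
      · simp only [IExp.val, setN_apply]
        simp [f3]
      · rw [pow_succ]; omega
      · rw [pow_succ]; omega
      · rcases f6 with f6 | f6 | f6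
        · left; omega
        · omega
        · omega
    · simp only [IExp.val, e2, g1 1 (by decide), hn] at h'
      exact ⟨g1, rfl, j, e2, e4, f4, f5, Or.inr (Or.inr h')⟩
    · simp only [IExp.val, e2, g1 1 (by decide), hr] at h
      exact ⟨g1, rfl, j, e2, e4, f4, f5, Or.inr (Or.inl h)⟩
  · rintro N₁ R₁ ⟨f1, rfl, j, f2, f3, f4, f5, f6⟩
    have hjk : j ≤ k := by
      rw [hk] at f5
      exact (Nat.pow_le_pow_iff_right (by norm_num)).mp f5
    obtain ⟨s, rfl⟩ := Nat.exists_eq_add_of_le hjk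
    refine Runs.setIdx (w := 0) ⟨(f1.mono (by decide)).setN (by decide) _ _, rfl, j, s, rfl, ?_, ?_,
      ?_, f4, ?_⟩
    · simp [setN_apply, f2]
    · simp [setN_apply, f3]
    · simp only [IExp.val, setN_apply, f2, f1 1 (by decide), hn, hk, pow_add]
      simp
    · rcases f6 with f6 | f6 | f6
      -- If every pass doubled the block, its size is 2^r, and r < 2^r already gives maximality.
      · subst f6
        right
        have : j < 2 ^ j := Nat.lt_two_pow_self
        omega
      · exact Or.inr f6
      · left
        rw [hk, pow_add] at f6
        have : 2 ^ s < 2 := by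
          have : 0 < 2 ^ j := by positivity
          nlinarith
        by_contra hs
        have : 2 ^ 1 ≤ 2 ^ s := Nat.pow_le_pow_right (by norm_num) (by omega)
        omega

/-- Multiply the rows of `A` and `b` by the signs; the result goes into array `4`. -/
def signProg : Prog :=
  .loop 10 (.get 1 (.lit 0)) <| .loop 11 (.add (.get 1 (.lit 1)) (.lit 1)) <|
    .ifIdx (.add (var 11) (.lit 1)) (.get 1 (.lit 1))
      (.arith .mul ⟨4, var 10, var 11⟩ ⟨0, var 10, var 11⟩ ⟨2, var 10, .lit 0⟩)
      (.arith .mul ⟨4, var 10, var 11⟩ ⟨1, var 10, .lit 0⟩ ⟨2, var 10, .lit 0⟩)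

theorem signProg_runs {N : ℕ → ℕ → ℕ} {R : ℕ → ℕ → ℕ → ℝ} {n d : ℕ} (hn : N 1 0 = n)
    (hd : N 1 1 = d) :
    Runs signProg N R (n * ((d + 1) * 1)) (n * ((d + 1) * 3 + 2) + 1) fun N' R' =>
      EqOff {10, 11} N N' ∧ EqOff {4} R R' ∧
      ∀ i < n, ∀ a ≤ d, R' 4 i a = (if a < d then R 0 i a else R 1 i 0) * R 2 i 0 := by
  refine Runs.mono (fillLoop_runs (ρ := 0) (A := 4) (m₂ := d + 1) ∅ ∅
    (fun i a => (if a < d then R 0 i a else R 1 i 0) * R 2 i 0) (by decide) (by decide)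
    (by simp [IExp.val, hn]) (fun N' h => by simp [IExp.val, h 1 (by decide), hd]) ?_) le_rfl le_rfl
    ?_
  · intro i hi j hj N' R' h1 h2 h3 h4 h5
    have e : N' 1 = N 1 := h1 1 (by decide)
    refine Runs.ifIdx (fun h => Runs.arith (c := 0) (w := 0) ?_)
      (fun h => Runs.arith (c := 0) (w := 0) ?_)
    · simp only [IExp.val, h3, e, hd] at h
      refine ⟨EqOff.refl _ _, (EqOff.refl _ _).setR (by decide) _ _ _, fun a b => ?_⟩
      have : j < d := by omega
      simp [setR_apply, Cell.val, IExp.val, h2, h3, h4 0 (by decide), h4 2 (by decide), ROp.eval,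
        this]
    · simp only [IExp.val, h3, e, hd] at h
      refine ⟨EqOff.refl _ _, (EqOff.refl _ _).setR (by decide) _ _ _, fun a b => ?_⟩
      have : ¬ j < d := by omega
      simp [setR_apply, Cell.val, IExp.val, h2, h3, h4 1 (by decide), h4 2 (by decide), ROp.eval,
        this]
  · rintro N' R' ⟨h1, h2, h3⟩
    refine ⟨h1.mono (by decide), h2.mono (by decide), fun i hi a ha => ?_⟩
    rw [h3, if_pos (by omega)]; rfl

/-- The levels of the partial Walsh-Hadamard transform; level `l` is kept in the rows of array `4`
from row `l n` on. -/
def butterflyProg : Prog :=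
  .seq (.setIdx 5 (.lit 0) (.lit 1)) <| .loop 12 (var 4) <| .seq
    (.loop 10 (.get 1 (.lit 0)) <| .loop 11 (.add (.get 1 (.lit 1)) (.lit 1)) <|
      .ifIdx (.sub (.div (var 10) (var 5)) (.mul (.lit 2) (.div (.div (var 10) (var 5)) (.lit 2))))
        (.lit 0)
        (.arith .add
          ⟨4, .add (.mul (.add (var 12) (.lit 1)) (.get 1 (.lit 0))) (var 10), var 11⟩
          ⟨4, .add (.mul (var 12) (.get 1 (.lit 0))) (var 10), var 11⟩
          ⟨4, .add (.mul (var 12) (.get 1 (.lit 0))) (.add (var 10) (var 5)), var 11⟩)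
        (.arith .sub
          ⟨4, .add (.mul (.add (var 12) (.lit 1)) (.get 1 (.lit 0))) (var 10), var 11⟩
          ⟨4, .add (.mul (var 12) (.get 1 (.lit 0))) (.sub (var 10) (var 5)), var 11⟩
          ⟨4, .add (.mul (var 12) (.get 1 (.lit 0))) (var 10), var 11⟩))
    (.setIdx 5 (.lit 0) (.mul (.lit 2) (var 5)))

theorem add_two_pow_lt_of_even {i l k : ℕ} (hi : i < 2 ^ k) (hl : l < k) (h : i / 2 ^ l % 2 = 0) :
    i + 2 ^ l < 2 ^ k := by
  obtain ⟨t, rfl⟩ := Nat.exists_eq_add_of_lt hl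
  have hpos : 0 < 2 ^ l := by positivity
  have h1 : 2 ^ (l + t + 1) = 2 ^ l * (2 * 2 ^ t) := by ring
  rw [h1] at hi ⊢
  have h2 : i / 2 ^ l < 2 * 2 ^ t := (Nat.div_lt_iff_lt_mul hpos).mpr (by rwa [mul_comm])
  have h3 : i / 2 ^ l + 2 ≤ 2 * 2 ^ t := by omega
  have h4 := Nat.div_add_mod i (2 ^ l)
  have h5 := Nat.mod_lt i hpos
  calc i + 2 ^ l < 2 ^ l * (i / 2 ^ l) + 2 ^ l + 2 ^ l := by omega
    _ = 2 ^ l * (i / 2 ^ l + 2) := by ring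
    _ ≤ _ := Nat.mul_le_mul_left _ h3

theorem butterflyProg_runs {N : ℕ → ℕ → ℕ} {R : ℕ → ℕ → ℕ → ℝ} {n d k j : ℕ} (hn : N 1 0 = n)
    (hk : n = 2 ^ k) (hj : j ≤ k) (hd : N 1 1 = d) (h4 : N 4 0 = j) (z : ℕ → ℕ → ℝ)
    (hz : ∀ i < n, ∀ a ≤ d, R 4 i a = z a i) :
    Runs butterflyProg N R (j * (n * ((d + 1) * 1))) (j * (n * ((d + 1) * 3 + 2) + 3) + 2)
      fun N' R' => EqOff {5, 10, 11, 12} N N' ∧ EqOff {4} R R' ∧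
      ∀ i < n, ∀ a ≤ d, R' 4 (j * n + i) a = partialWalsh (z a) j i := by
  refine Runs.setIdx_seq (Runs.loop (w := n * ((d + 1) * (2 + 1) + 2) + 1 + 1) (fun l N' R' =>
    EqOff {5, 10, 11, 12} N N' ∧ EqOff {4} R R' ∧ N' 5 0 = 2 ^ l ∧
    ∀ i < n, ∀ a ≤ d, R' 4 (l * n + i) a = partialWalsh (z a) l i) ?_ ?_ ?_ ?_)
  · simp [IExp.val, setN_apply, h4]
  · refine ⟨(EqOff.refl _ _).setN (by decide) _ _, EqOff.refl _ _, by simp [setN_apply, IExp.val],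
      fun i hi a ha => ?_⟩
    rw [Nat.zero_mul, Nat.zero_add, partialWalsh_zero, hz i hi a ha]
  · rintro l hl N₁ R₁ ⟨f1, f2, f3, f4⟩
    have f1' := f1.setN (a := 12) (by decide) 0 l
    refine Runs.mono (c := n * ((d + 1) * 1) + 0) (Runs.seq (w' := 1) (fillLoop_runs (c := 1) (w := 2)
      (ρ := (l + 1) * n) (A := 4) (m₂ := d + 1) ∅ ∅ (fun i a => partialWalsh (z a) (l + 1) i) (by decide)
      (by decide) (by simp [IExp.val, f1' 1 (by decide), hn])
      (fun N' h => by simp [IExp.val, h 1 (by decide), f1' 1 (by decide), hd]) ?_) ?_)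
      (by omega) le_rfl fun _ _ h => h
    · intro i hi a ha N' R' h1 h2 h3 h4 h5
      have e1 : N' 1 = N 1 := by rw [h1 1 (by decide), f1' 1 (by decide)]
      have e5 : N' 5 0 = 2 ^ l := by rw [h1 5 (by decide), setN_apply]; simp [f3]
      have e12 : N' 12 0 = l := by rw [h1 12 (by decide), setN_apply]; simp
      have hrd : ∀ i' < n, R' 4 (l * n + i') a = partialWalsh (z a) l i' := fun i' hi' => by
        rw [h5 _ (by rw [Nat.succ_mul]; omega), f4 i' hi' a (by omega)]
      refine Runs.ifIdx (fun h => Runs.arith (c := 0) (w := 0) ?_)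
        (fun h => Runs.arith (c := 0) (w := 0) ?_)
      · simp only [IExp.val, h2, e5] at h
        -- The tested quantity x - 2⌊x/2⌋ is x mod 2, so the comparison with 0 decides the parity.
        have hpar : i / 2 ^ l % 2 = 0 := by omega
        refine ⟨EqOff.refl _ _, (EqOff.refl _ _).setR (by decide) _ _ _, fun a' b => ?_⟩
        simp only [setR_apply, Cell.val, IExp.val, h2, h3, e1, e5, e12, hn, ROp.eval, true_and]
        rw [hrd i hi, hrd (i + 2 ^ l) (by rw [hk] at hi ⊢; exact add_two_pow_lt_of_even hi (by omega) hpar),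
          partialWalsh_succ_of_even _ _ _ hpar]
      · simp only [IExp.val, h2, e5] at h
        have hpar : i / 2 ^ l % 2 = 1 := by omega
        refine ⟨EqOff.refl _ _, (EqOff.refl _ _).setR (by decide) _ _ _, fun a' b => ?_⟩
        simp only [setR_apply, Cell.val, IExp.val, h2, h3, e1, e5, e12, hn, ROp.eval, true_and]
        rw [hrd i hi, hrd (i - 2 ^ l) (by omega), partialWalsh_succ_of_odd _ _ _ hpar]
    · rintro N₂ R₂ ⟨g1, g2, g3⟩
      have e5 : N₂ 5 0 = 2 ^ l := by rw [g1 5 (by decide), setN_apply]; simp [f3]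
      refine Runs.setIdx (w := 0) ⟨?_, ?_, ?_, ?_⟩
      · exact ((f1'.trans g1).setN (by decide) _ _).mono (by decide)
      · exact (f2.trans g2).mono (by decide)
      · simp [setN_apply, IExp.val, e5, pow_succ, mul_comm]
      · intro i hi a ha
        rw [g3, if_pos (by omega), Nat.add_sub_cancel_left]
  · rintro N' R' ⟨h1, h2, h3, h4⟩
    exact ⟨h1, h2, h4⟩

/-- Row `V₇` of the Walsh-Hadamard matrix, up to column `V₃`, is put into row `0` of array `5`. -/
def walshRowProg : Prog :=
  .seq (.setIdx 9 (.lit 0) (.lit 1)) <| .loop 10 (var 3) <|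
    .ifIdx (var 10) (.lit 0) (.const ⟨5, .lit 0, var 10⟩ (.lit 1)) <| .seq
      (.ifIdx (.mul (.lit 2) (var 9)) (var 10) (.setIdx 9 (.lit 0) (.mul (.lit 2) (var 9))) .skip)
      (.ifIdx (.sub (.div (var 7) (var 9)) (.mul (.lit 2) (.div (.div (var 7) (var 9)) (.lit 2))))
        (.lit 0) (.copy ⟨5, .lit 0, var 10⟩ ⟨5, .lit 0, .sub (var 10) (var 9)⟩)
        (.arith .sub ⟨5, .lit 0, var 10⟩ (scal 20) ⟨5, .lit 0, .sub (var 10) (var 9)⟩))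

/-- Entry 2^b + o with o < 2^b is the earlier entry o, negated exactly when bit `b` of the row index
is set. Hence one real instruction per entry is enough. -/
theorem walshRowProg_runs {N : ℕ → ℕ → ℕ} {R : ℕ → ℕ → ℕ → ℝ} {s hi : ℕ} (h3 : N 3 0 = 2 ^ s)
    (h7 : N 7 0 = hi) (h20 : R 20 0 0 = 0) :
    Runs walshRowProg N R (2 ^ s * 1) (2 ^ s * 6 + 2) fun N' R' =>
      EqOff {9, 10} N N' ∧ EqOff {5} R R' ∧ ∀ c < 2 ^ s, R' 5 0 c = walsh s hi c := by
  -- The bound i ≤ 2·2^b is not strict, because the power of two is doubled only at the start of the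
  -- pass that needs it.
  refine Runs.setIdx_seq (Runs.loop (w := 5) (fun i N' R' => EqOff {9, 10} N N' ∧
    EqOff {5} R R' ∧ (∃ b, N' 9 0 = 2 ^ b ∧ 2 ^ b ≤ max i 1 ∧ i ≤ 2 * 2 ^ b) ∧
    ∀ c < i, R' 5 0 c = walsh s hi c) ?_ ?_ ?_ fun N' R' h => ⟨h.1, h.2.1, h.2.2.2⟩)
  · simp [IExp.val, setN_apply, h3]
  · exact ⟨(EqOff.refl _ _).setN (by decide) _ _, EqOff.refl _ _,
      ⟨0, by simp [setN_apply, IExp.val], by simp, by simp⟩, by simp⟩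
  · rintro i hi' N₁ R₁ ⟨f1, f2, ⟨b, f3, f4, f5⟩, f6⟩
    have f1' := f1.setN (a := 10) (by decide) 0 i
    have e9 : setN N₁ 10 0 i 9 0 = 2 ^ b := by simp [setN_apply, f3]
    have e10 : setN N₁ 10 0 i 10 0 = i := by simp [setN_apply]
    generalize setN N₁ 10 0 i = N₂ at f1' e9 e10
    refine Runs.ifIdx (fun h => Runs.const (c := 0) ?_) (fun h => ?_)
    · simp only [IExp.val, e10, Nat.le_zero] at h
      subst h
      refine ⟨f1', f2.setR (by decide) _ _ _, ⟨b, e9, by simpa using f4, ?_⟩, ?_⟩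
      · have : 1 ≤ 2 ^ b := Nat.one_le_two_pow
        omega
      · intro c hc
        obtain rfl : c = 0 := by omega
        simp [setR_apply, IExp.val, e10, walsh]
    · simp only [IExp.val, e10] at h
      refine Runs.mono (Runs.seq (c := 0) (w := 2) (c' := 1) (w' := 2)
        (Q := fun N' R' => R' = R₁ ∧ EqOff {9, 10} N N' ∧ N' 10 0 = i ∧
          ∃ b, N' 9 0 = 2 ^ b ∧ 2 ^ b ≤ i ∧ i < 2 * 2 ^ b)
        (Runs.ifIdx (fun h' => Runs.setIdx (w := 0) ?_) (fun h' => Runs.skip ?_)) ?_)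
        (by omega) (by omega) fun _ _ h => h
      · simp only [IExp.val, e9, e10] at h'
        refine ⟨rfl, f1'.setN (by decide) _ _, by simp [setN_apply, e10], b + 1, ?_, ?_, ?_⟩
        · simp [setN_apply, IExp.val, e9, pow_succ, mul_comm]
        · rw [pow_succ]; omega
        · have : 1 ≤ 2 ^ b := Nat.one_le_two_pow
          rw [pow_succ]; omega
      · simp only [IExp.val, e9, e10] at h'
        exact ⟨rfl, f1', e10, b, e9, by omega, by omega⟩
      · clear e9 f3 f4 f5 b
        rintro N₃ R₃ ⟨rfl, g1, g2, b, g3, g4, g5⟩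
        have hbs : b < s := (Nat.pow_lt_pow_iff_right (a := 2) (by norm_num)).mp (g4.trans_lt hi')
        obtain ⟨o, rfl⟩ := Nat.exists_eq_add_of_le g4
        have ho : o < 2 ^ b := by omega
        have key : walsh s hi (2 ^ b + o) = walsh s hi o * if hi.testBit b then -1 else 1 := by
          rw [walsh_of_lt (l := b + 1) (by omega) hi (by rw [pow_succ]; omega),
            walsh_two_pow_add hi ho, walsh_of_lt hbs.le hi ho]
        have hfin : ∃ b_1, N₃ 9 0 = 2 ^ b_1 ∧ 2 ^ b_1 ≤ max (2 ^ b + o + 1) 1 ∧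
            2 ^ b + o + 1 ≤ 2 * 2 ^ b_1 := ⟨b, g3, by omega, by omega⟩
        refine Runs.ifIdx (fun h => Runs.copy (c := 0) (w := 0) ?_)
          (fun h => Runs.arith (c := 0) (w := 0) ?_)
        · simp only [IExp.val, g1 7 (by decide), h7, g3] at h
          have hb : hi.testBit b = false := by
            rw [Nat.testBit_eq_decide_div_mod_eq]; simp; omega
          refine ⟨g1, f2.setR (by decide) _ _ _, hfin, fun c hc => ?_⟩
          simp only [setR_apply, Cell.val, IExp.val, g2, g3, true_and, Nat.add_sub_cancel_left]
          split_ifs with hc'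
          · rw [hc', key, hb, f6 o (by omega)]; simp
          · exact f6 c (by omega)
        · simp only [IExp.val, g1 7 (by decide), h7, g3] at h
          have hb : hi.testBit b = true := by
            rw [Nat.testBit_eq_decide_div_mod_eq]; simp; omega
          refine ⟨g1, f2.setR (by decide) _ _ _, hfin, fun c hc => ?_⟩
          simp only [setR_apply, Cell.val, IExp.val, g2, g3, true_and, Nat.add_sub_cancel_left,
            ROp.eval, f2 20 (by decide), h20]
          split_ifs with hc'
          · rw [hc', key, hb, f6 o (by omega)]; simp
          · exact f6 c (by omega)

/-- The sampled rows of the transform are put into array `6`. -/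
def sampleProg : Prog :=
  .loop 12 (.get 1 (.lit 2)) <|
    .seq (.setIdx 7 (.lit 0) (.div (.get 0 (var 12)) (var 2))) <|
    .seq (.setIdx 8 (.lit 0) (.sub (.get 0 (var 12)) (.mul (var 7) (var 2)))) <|
    .seq walshRowProg <| .loop 11 (.add (.get 1 (.lit 1)) (.lit 1)) <|
      .seq (dotProg 10 (var 3) ⟨5, .lit 0, var 10⟩
        ⟨4, .add (.mul (var 4) (.get 1 (.lit 0))) (.add (.mul (var 10) (var 2)) (var 8)), var 11⟩)
      (.copy ⟨6, var 12, var 11⟩ (scal 9))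

theorem sampleProg_runs {N : ℕ → ℕ → ℕ} {R : ℕ → ℕ → ℕ → ℝ} {n d r k j s : ℕ} (hn : N 1 0 = n)
    (hk : n = 2 ^ k) (hjs : j + s = k) (hd : N 1 1 = d) (hr : N 1 2 = r) (h2 : N 2 0 = 2 ^ j)
    (h3 : N 3 0 = 2 ^ s) (h4 : N 4 0 = j) (h20 : R 20 0 0 = 0)
    (z : ℕ → ℕ → ℝ) (hz : ∀ i < n, ∀ a ≤ d, R 4 (j * n + i) a = partialWalsh (z a) j i) :
    Runs sampleProg N R (r * (2 ^ s + (d + 1) * (2 ^ s * 2 + 2)))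
      (r * ((2 ^ s * 6 + 2) + ((d + 1) * (2 ^ s * 3 + 4) + 1) + 3) + 1)
      fun N' R' => EqOff {7, 8, 9, 10, 11, 12} N N' ∧ EqOff {5, 6, 9, 10} R R' ∧
      ∀ t < r, ∀ a ≤ d, R' 6 t a = ∑ i ∈ Finset.range n, walsh k (N 0 t) i * z a i := by
  refine Runs.loop (w := (2 ^ s * 6 + 2) + ((d + 1) * (2 ^ s * 3 + 4) + 1) + 2)
    (fun t N' R' => EqOff {7, 8, 9, 10, 11, 12} N N' ∧
    EqOff {5, 6, 9, 10} R R' ∧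
      ∀ t' < t, ∀ a ≤ d, R' 6 t' a = ∑ i ∈ Finset.range n, walsh k (N 0 t') i * z a i)
    (by simp [IExp.val, hr]) ⟨EqOff.refl _ _, EqOff.refl _ _, by simp⟩ ?_ fun _ _ h => h
  rintro t ht N₁ R₁ ⟨f1, f2, f3⟩
  set i := N 0 t with hi
  set N₂ := setN (setN (setN N₁ 12 0 t) 7 0 (i / 2 ^ j)) 8 0 (i - i / 2 ^ j * 2 ^ j) with hN₂
  have g1 : EqOff {7, 8, 9, 10, 11, 12} N N₂ :=
    ((f1.setN (by decide) _ _).setN (by decide) _ _).setN (by decide) _ _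
  have g7 : N₂ 7 0 = i / 2 ^ j := by simp [hN₂, setN_apply]
  have g8 : N₂ 8 0 = i - i / 2 ^ j * 2 ^ j := by simp [hN₂, setN_apply]
  have g12 : N₂ 12 0 = t := by simp [hN₂, setN_apply]
  refine Runs.setIdx_seq (Runs.setIdx_seq ?_)
  have hmem : setN (setN (setN N₁ 12 0 t) 7 ((IExp.lit 0).val (setN N₁ 12 0 t))
      ((((IExp.get 0 (var 12)).div (var 2))).val (setN N₁ 12 0 t))) 8
      ((IExp.lit 0).val (setN (setN N₁ 12 0 t) 7 ((IExp.lit 0).val (setN N₁ 12 0 t))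
      ((((IExp.get 0 (var 12)).div (var 2))).val (setN N₁ 12 0 t))))
      (((IExp.get 0 (var 12)).sub ((var 7).mul (var 2))).val
      (setN (setN N₁ 12 0 t) 7 ((IExp.lit 0).val (setN N₁ 12 0 t))
      ((((IExp.get 0 (var 12)).div (var 2))).val (setN N₁ 12 0 t)))) = N₂ := by
    simp [IExp.val, hN₂, setN_apply, f1 0 (by decide), f1 2 (by decide), h2, hi]
  rw [hmem]
  clear hmem
  clear_value N₂
  refine Runs.seq (c' := (d + 1) * (2 ^ s * 2 + 2)) (w' := (d + 1) * (2 ^ s * 3 + 4) + 1)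
    (walshRowProg_runs (s := s) (hi := i / 2 ^ j) (by rw [g1 3 (by decide), h3]) g7
    (by rw [f2 20 (by decide), h20])) ?_ |>.mono (by omega) le_rfl fun _ _ h => h
  rintro N₃ R₃ ⟨k1, k2, k3⟩
  have k1' : EqOff {7, 8, 9, 10, 11, 12} N N₃ := (g1.trans k1).mono (by decide)
  refine Runs.loop (c := 2 ^ s * 2 + 2) (w := 2 ^ s * 3 + 3) (m := d + 1) (fun a N' R' =>
    EqOff {10, 11} N₃ N' ∧ EqOff {6, 9, 10} R₃ R' ∧
    ∀ t' a', R' 6 t' a' = if t' = t ∧ a' < a then ∑ i' ∈ Finset.range n, walsh k i i' * z a' i'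
      else R₃ 6 t' a')
    (by simp [IExp.val, k1' 1 (by decide), hd]) ⟨EqOff.refl _ _, EqOff.refl _ _, by simp⟩ ?_ ?_
  · rintro a ha N₄ R₄ ⟨l1, l2, l3⟩
    have l1' := l1.setN (a := 11) (by decide) 0 a
    have m1 : EqOff {7, 8, 9, 10, 11, 12} N (setN N₄ 11 0 a) := (k1'.trans l1').mono (by decide)
    have e8 : setN N₄ 11 0 a 8 0 = i - i / 2 ^ j * 2 ^ j := by
      rw [l1' 8 (by decide), k1 8 (by decide), g8]
    have e12 : setN N₄ 11 0 a 12 0 = t := by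
      rw [l1' 12 (by decide), k1 12 (by decide), g12]
    have e11 : setN N₄ 11 0 a 11 0 = a := by simp [setN_apply]
    generalize setN N₄ 11 0 a = N₅ at l1' m1 e8 e12 e11
    refine Runs.mono (Runs.seq (c' := 1) (w' := 1) (dotProg_runs (m := 2 ^ s)
      (fun c => walsh s (i / 2 ^ j) c)
      (fun c => partialWalsh (z a) j (c * 2 ^ j + (i - i / 2 ^ j * 2 ^ j)))
      (by simp [IExp.val, m1 3 (by decide), h3]) (by decide) (by decide) ?_ ?_) ?_)
      (by omega) (by omega) fun _ _ h => h
    · intro c hc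
      simp [Cell.val, IExp.val, setN_apply, l2 5 (by decide), k3 c hc]
    · intro c hc
      simp only [Cell.val, IExp.val, setN_apply, e8, e11, m1 4 (by decide), m1 1 (by decide),
        m1 2 (by decide), h4, h2, hn, l2 4 (by decide), k2 4 (by decide), f2 4 (by decide)]
      simp only [Nat.reduceEqDiff, false_and, if_false, and_self, if_true]
      refine hz _ ?_ a (by omega)
      have hpos : 0 < 2 ^ j := by positivity
      have hlo : i - i / 2 ^ j * 2 ^ j < 2 ^ j := by
        have h1 := Nat.div_add_mod i (2 ^ j)
        have h2 := Nat.mod_lt i hpos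
        rw [mul_comm] at h1
        omega
      calc c * 2 ^ j + (i - i / 2 ^ j * 2 ^ j) < (c + 1) * 2 ^ j := by rw [Nat.succ_mul]; omega
        _ ≤ 2 ^ s * 2 ^ j := Nat.mul_le_mul_right _ hc
        _ = n := by rw [hk, ← hjs, pow_add, mul_comm]
    · rintro N₆ R₆ ⟨p1, p2, p3⟩
      rw [sum_walsh_partialWalsh, hjs, ← hk] at p3
      refine Runs.copy (c := 0) (w := 0) ⟨(l1'.trans p1).mono (by decide),
        ((l2.trans p2).setR (by decide) _ _ _).mono (by decide), fun t' a' => ?_⟩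
      simp only [setR_apply, Cell.val, IExp.val, p3, p1 12 (by decide), p1 11 (by decide), e12, e11,
        p2 6 (by decide), l3, true_and]
      by_cases ht' : t' = t
      · rcases lt_trichotomy a' a with h | h | h
        · simp [h.ne, h, h.trans (Nat.lt_succ_self a)]
        · subst h; simp [ht']
        · simp [h.ne', not_lt.mpr h.le, show ¬ a' < a + 1 by omega]
      · simp [ht']
  · rintro N₄ R₄ ⟨l1, l2, l3⟩
    refine ⟨(k1'.trans l1).mono (by decide), ((f2.trans k2).trans l2).mono (by decide), ?_⟩
    intro t' ht' a ha
    rw [l3]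
    split_ifs with h
    · rw [h.1]
    · rw [k2 6 (by decide)]
      exact f3 t' (by omega) a ha

/-! ### Removing the scaling of the sketch -/

theorem precond_apply {k r : ℕ} (ω : Coins (2 ^ k) r) (t : Fin r) (i : Fin (2 ^ k)) :
    precond ω t i = √(((2 ^ k : ℕ) : ℝ) / r) * (1 / √((2 : ℝ) ^ k)) *
      (walsh k (ω.2 t) i * ((ω.1 i : ℤ) : ℝ)) := by
  rw [precond, signDiag, Matrix.mul_diagonal, Matrix.mul_apply,
    Finset.sum_eq_single (ω.2 t)]
  · simp only [sampMat, Matrix.transpose_apply, Matrix.of_apply, if_true, normHadamard,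
      Matrix.smul_apply, smul_eq_mul, hadamardMat_apply]
    ring
  · intro b _ hb
    simp [sampMat, hb.symm]
  · simp

theorem pinv_smul {ι κ : Type*} [Fintype ι] [Fintype κ] (M : Matrix ι κ ℝ) {c : ℝ} (hc : c ≠ 0) :
    pinv (c • M) = c⁻¹ • pinv M := by
  obtain ⟨h1, h2, h3, h4⟩ := pinv_spec M
  refine (pinv_spec (c • M)).unique ⟨?_, ?_, ?_, ?_⟩ <;>
    simp only [Matrix.smul_mul, Matrix.mul_smul, smul_smul, h1, h2, h3, h4,
      mul_inv_cancel₀ hc, inv_mul_cancel₀ hc, one_smul]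

/-- The unscaled sampled rows of the transform of a matrix. -/
def sampledTransform {k r : ℕ} (ω : Coins (2 ^ k) r) : Matrix (Fin r) (Fin (2 ^ k)) ℝ :=
  Matrix.of fun t i => walsh k (ω.2 t) i * ((ω.1 i : ℤ) : ℝ)

/-- The nonzero scalar of the preconditioner cancels between the pseudoinverse and the right hand
side. The machine, which has no square roots, can therefore work with entries ±1. -/
theorem xTilde_eq {k d r : ℕ} (hr : 0 < r) (A : Matrix (Fin (2 ^ k)) (Fin d) ℝ)
    (b : Fin (2 ^ k) → ℝ) (ω : Coins (2 ^ k) r) :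
    xTilde A b ω = pinv (sampledTransform ω * A) *ᵥ (sampledTransform ω *ᵥ b) := by
  set c := √(((2 ^ k : ℕ) : ℝ) / r) * (1 / √((2 : ℝ) ^ k)) with hc
  have hc0 : c ≠ 0 := by
    have : (0 : ℝ) < r := by exact_mod_cast hr
    positivity
  have h : precond ω = c • sampledTransform ω := by
    ext t i
    rw [precond_apply]
    simp [sampledTransform, hc]
  rw [xTilde, h, Matrix.smul_mul, pinv_smul _ hc0, Matrix.smul_mulVec, Matrix.smul_mulVec,
    Matrix.mulVec_smul, smul_smul, inv_mul_cancel₀ hc0, one_smul]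

/-! ### Assembly of the program and its total cost -/

/-- The sketching algorithm for least squares. -/
def mainProg : Prog :=
  .seq blockSizeProg <| .seq signProg <| .seq butterflyProg <| .seq sampleProg leastSquaresProg

theorem mainProg_runs {k d r : ℕ} (hd : 0 < d) (hdr : d ≤ r) (A : Matrix (Fin (2 ^ k)) (Fin d) ℝ)
    (b : Fin (2 ^ k) → ℝ) (ω : Coins (2 ^ k) r) :
    ∃ j s, j + s = k ∧ 2 ^ j ≤ r + 1 ∧ (s = 0 ∨ r + 1 < 2 * 2 ^ j) ∧
    (mainProg.run (initState A b ω)).Outputs (xTilde A b ω) ∧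
    (mainProg.run (initState A b ω)).ops ≤ 2 ^ k * ((d + 1) * 1) + (j * (2 ^ k * ((d + 1) * 1)) +
      (r * (2 ^ s + (d + 1) * (2 ^ s * 2 + 2)) + 40 * (r * d ^ 2))) ∧
    (mainProg.run (initState A b ω)).steps ≤ r * 5 + 3 + (2 ^ k * ((d + 1) * 3 + 2) + 1 +
      (j * (2 ^ k * ((d + 1) * 3 + 2) + 3) + 2 +
      (r * ((2 ^ s * 6 + 2) + ((d + 1) * (2 ^ s * 3 + 4) + 1) + 3) + 1 + 80 * (r * d ^ 2)))) := by
  set N := (initState A b ω).nat with hN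
  set R := (initState A b ω).real with hR
  have n0 : N 1 0 = 2 ^ k := rfl
  have n1 : N 1 1 = d := rfl
  have n2 : N 1 2 = r := rfl
  have run1 := blockSizeProg_runs (R := R) (k := k) n0 rfl n2 rfl
  have key : ∃ j s, j + s = k ∧ 2 ^ j ≤ r + 1 ∧ (s = 0 ∨ r + 1 < 2 * 2 ^ j) ∧
    Runs mainProg N R (0 + (2 ^ k * ((d + 1) * 1) + (j * (2 ^ k * ((d + 1) * 1)) +
      (r * (2 ^ s + (d + 1) * (2 ^ s * 2 + 2)) + 40 * (r * d ^ 2)))))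
      (r * 5 + 3 + (2 ^ k * ((d + 1) * 3 + 2) + 1 +
      (j * (2 ^ k * ((d + 1) * 3 + 2) + 3) + 2 +
      (r * ((2 ^ s * 6 + 2) + ((d + 1) * (2 ^ s * 3 + 4) + 1) + 3) + 1 + 80 * (r * d ^ 2)))))
      fun _ R' => ∀ j : Fin d, R' 3 j 0 = xTilde A b ω j := by
    obtain ⟨f1, f2, j, s, hjs, e2, e4, e3, hj, hs⟩ := (run1 0 0).1
    refine ⟨j, s, hjs, hj, hs, Runs.seq (Q := fun N' R' => EqOff {2, 3, 4, 10} N N' ∧ R' = R ∧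
      N' 2 0 = 2 ^ j ∧ N' 4 0 = j ∧ N' 3 0 = 2 ^ s) ?_ ?_⟩
    · intro o t
      obtain ⟨⟨f1, f2, j', s', hjs', e2', e4', e3', hj', hs'⟩, h2, h3⟩ := run1 o t
      -- For each value of the counters the block exponent is only known to exist; maximality makes
      -- it the same for all of them.
      have hjj : j' = j := by
        by_contra hne
        rcases Nat.lt_or_gt_of_ne hne with h | h
        · have h3 : 2 * 2 ^ j' ≤ 2 ^ j := by
            rw [← Nat.pow_succ']; exact Nat.pow_le_pow_right (by norm_num) h
          omega
        · have h3 : 2 * 2 ^ j ≤ 2 ^ j' := by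
            rw [← Nat.pow_succ']; exact Nat.pow_le_pow_right (by norm_num) h
          omega
      obtain rfl : s' = s := by omega
      subst hjj
      exact ⟨⟨f1, f2, e2', e4', e3'⟩, h2, h3⟩
    clear f1 f2 e2 e4 e3
    rintro N₁ R₁ ⟨f1, rfl, e2, e4, e3⟩
    refine Runs.seq (signProg_runs (n := 2 ^ k) (d := d) (by rw [f1 1 (by decide), n0])
      (by rw [f1 1 (by decide), n1])) ?_
    rintro N₂ R₂ ⟨g1, g2, g3⟩
    have g1' := f1.trans g1
    set z : ℕ → ℕ → ℝ := fun a i => (if a < d then R 0 i a else R 1 i 0) * R 2 i 0 with hz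
    refine Runs.seq (butterflyProg_runs (n := 2 ^ k) (k := k) (j := j) (d := d)
      (by rw [g1' 1 (by decide), n0]) rfl (by omega) (by rw [g1' 1 (by decide), n1])
      (by rw [g1 4 (by decide), e4]) z g3) ?_
    rintro N₃ R₃ ⟨h1, h2, h3⟩
    have h1' := g1'.trans h1
    have h2' := g2.trans h2
    refine Runs.seq (sampleProg_runs (n := 2 ^ k) (k := k) (j := j) (s := s) (d := d) (r := r)
      (by rw [h1' 1 (by decide), n0]) rfl hjs (by rw [h1' 1 (by decide), n1])
      (by rw [h1' 1 (by decide), n2]) (by rw [h1 2 (by decide), g1 2 (by decide), e2])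
      (by rw [h1 3 (by decide), g1 3 (by decide), e3])
      (by rw [h1 4 (by decide), g1 4 (by decide), e4])
      (by rw [h2' 20 (by decide)]; rfl) z h3) ?_
    rintro N₄ R₄ ⟨k1, k2, k3⟩
    have k1' := h1'.trans k1
    have k2' := h2'.trans k2
    have hsample : ∀ t : Fin r, N₃ 0 t = ω.2 t := fun t => by
      rw [h1' 0 (by decide)]
      simp [hN, initState]
    rw [xTilde_eq (by omega)]
    refine leastSquaresProg_runs hd hdr (by rw [k1' 1 (by decide), n1])
      (by rw [k1' 1 (by decide), n2]) _ _ ?_ ?_ ?_ ?_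
    · intro t a
      rw [k3 t t.2 a a.2.le, hsample, Finset.sum_range, Matrix.mul_apply]
      refine Finset.sum_congr rfl fun i _ => ?_
      have : (i : ℕ) < 2 ^ k := i.2
      simp [sampledTransform, hz, hR, initState, this]
      ring
    · intro t
      rw [k3 t t.2 d le_rfl, hsample, Finset.sum_range]
      refine Finset.sum_congr rfl fun i _ => ?_
      have : (i : ℕ) < 2 ^ k := i.2
      simp [sampledTransform, hz, hR, initState, this]
      ring
    · intro i a
      rw [k2' 7 (by decide)]; rfl
    · rw [k2' 20 (by decide)]; rfl
  obtain ⟨j, s, h1, h2, h3, h4⟩ := key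
  refine ⟨j, s, h1, h2, h3, ?_⟩
  have h5 : initState A b ω = ⟨N, R, 0, 0⟩ := rfl
  rw [h5]
  obtain ⟨h6, h7, h8⟩ := h4 0 0
  rw [Nat.zero_add, Nat.zero_add] at h7
  rw [Nat.zero_add] at h8
  exact ⟨h6, h7, h8⟩

/-- With D = n(d+1), the sampling phase contributes at most 5D plus multiples of r d². As 6 ≤ `L`,
this fits into the second copy of L D, the first one paying for the `j` butterfly levels. -/
theorem main_cost_bounds {n d r j s k : ℕ} {L : ℝ} (hn : n = 2 ^ k) (hjs : j + s = k) (hd : 0 < d)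
    (hj : (j : ℝ) ≤ L) (hL : 6 ≤ L) (hs : s = 0 ∨ r + 1 < 2 * 2 ^ j) (hr : 0 < r) :
    ((n * ((d + 1) * 1) + (j * (n * ((d + 1) * 1)) +
      (r * (2 ^ s + (d + 1) * (2 ^ s * 2 + 2)) + 40 * (r * d ^ 2))) : ℕ) : ℝ) ≤
      n * (d + 1) + 2 * n * (d + 1) * L + 200 * (r * d ^ 2) ∧
    ((r * 5 + 3 + (n * ((d + 1) * 3 + 2) + 1 + (j * (n * ((d + 1) * 3 + 2) + 3) + 2 +
      (r * ((2 ^ s * 6 + 2) + ((d + 1) * (2 ^ s * 3 + 4) + 1) + 3) + 1 +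
        80 * (r * d ^ 2)))) : ℕ) : ℝ) ≤ 200 * (n * (d + 1) * L + r * d ^ 2) := by
  -- If s = 0 the left side is r; otherwise r < 2·2^j, and 2^j 2^s = n.
  have hx : r * 2 ^ s ≤ 2 * n + r := by
    rcases hs with rfl | hs
    · omega
    · have : r * 2 ^ s ≤ (2 * 2 ^ j) * 2 ^ s := Nat.mul_le_mul_right _ (by omega)
      rw [hn, ← hjs, pow_add]
      calc _ ≤ _ := this
        _ ≤ _ := by rw [mul_assoc]; omega
  have hx' : (r : ℝ) * 2 ^ s ≤ 2 * n + r := by exact_mod_cast hx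
  have hd1 : (1 : ℝ) ≤ d := by exact_mod_cast hd
  have hr1 : (1 : ℝ) ≤ r := by exact_mod_cast hr
  have hn1 : (1 : ℝ) ≤ n := by
    have : 1 ≤ n := by rw [hn]; exact Nat.one_le_two_pow
    exact_mod_cast this
  push_cast
  set x : ℝ := r * 2 ^ s with hxdef
  have hxd : x * (d + 1) ≤ (2 * n + r) * (d + 1) := mul_le_mul_of_nonneg_right hx' (by positivity)
  have hrd1 : (r : ℝ) * d ≤ r * d ^ 2 := by nlinarith [mul_nonneg (mul_nonneg
    (zero_le_one.trans hr1) (zero_le_one.trans hd1)) (sub_nonneg.mpr hd1)]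
  have hrd2 : (r : ℝ) ≤ r * d := by nlinarith
  set D : ℝ := n * (d + 1) with hD
  have hDn : 2 * (n : ℝ) ≤ D := by rw [hD]; nlinarith
  have hjD : (j : ℝ) * D ≤ L * D := mul_le_mul_of_nonneg_right hj (by positivity)
  have hLD : 6 * D ≤ L * D := mul_le_mul_of_nonneg_right hL (by positivity)
  have hLn : L * 2 ≤ L * D := mul_le_mul_of_nonneg_left (by linarith) (by linarith)
  have hj0 : (0 : ℝ) ≤ j := by positivity
  have hjn : (j : ℝ) * (2 * n) ≤ L * D := mul_le_mul hj hDn (by positivity) (by linarith)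
  constructor
  · have e : (n : ℝ) * ((d + 1) * 1) + (j * (n * ((d + 1) * 1)) +
      (r * (2 ^ s + (d + 1) * (2 ^ s * 2 + 2)) + 40 * (r * (d : ℝ) ^ 2))) =
      D + j * D + x + 2 * (x * (d + 1)) + 2 * (r * d) + 2 * r + 40 * (r * d ^ 2) := by
      rw [hD, hxdef]; ring
    have e2 : (n : ℝ) * (d + 1) + 2 * n * (d + 1) * L + 200 * (r * d ^ 2) =
      D + 2 * (L * D) + 200 * (r * d ^ 2) := by rw [hD]; ring
    have e3 : (2 * n + r) * ((d : ℝ) + 1) = 2 * D + r * d + r := by rw [hD]; ring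
    rw [hD, e2]
    rw [e3] at hxd
    linarith
  · have e : (r : ℝ) * 5 + 3 + (n * ((d + 1) * 3 + 2) + 1 + (j * (n * ((d + 1) * 3 + 2) + 3) + 2 +
      (r * ((2 ^ s * 6 + 2) + ((d + 1) * (2 ^ s * 3 + 4) + 1) + 3) + 1 +
        80 * (r * (d : ℝ) ^ 2)))) = 15 * r + 7 + 3 * D + 2 * n + 3 * (j * D) + j * (2 * n) + 3 * j +
        6 * x + 3 * (x * (d + 1)) + 4 * (r * d) + 80 * (r * d ^ 2) := by
      rw [hD, hxdef]; ring
    have e3 : (2 * n + r) * ((d : ℝ) + 1) = 2 * D + r * d + r := by rw [hD]; ring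
    rw [hD, e, mul_comm D L]
    rw [e3] at hxd
    linarith

theorem log_ge_three {x : ℝ} (hx : 40 ≤ x) : 3 ≤ Real.log x := by
  rw [Real.le_log_iff_exp_le (by linarith)]
  have h := Real.exp_one_lt_d9
  have : Real.exp 3 = Real.exp 1 ^ 3 := by rw [← Real.exp_nat_mul]; norm_num
  rw [this]
  calc Real.exp 1 ^ 3 ≤ 2.7182818286 ^ 3 := by
        exact pow_le_pow_left₀ (Real.exp_pos 1).le h.le 3
    _ ≤ 40 := by norm_num
    _ ≤ x := hx

theorem forty_le {n d : ℕ} (hn : 0 < n) (hd : 0 < d) : (40 : ℝ) ≤ 40 * n * d := by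
  have : (1 : ℝ) ≤ n * d := by exact_mod_cast Nat.mul_pos hn hd
  linarith

/-- Used for d ≤ r in the least squares cost and for log₂(r+1) ≥ 6 in the total cost; both
logarithms in the sample size are at least 3. -/
theorem sampleSize_ge {n d : ℕ} (hn : 0 < n) (hd : 0 < d) (ε : ℝ) :
    63 * d ≤ sampleSize n d ε := by
  have h1 := log_ge_three (forty_le hn hd)
  have hd1 : (1 : ℝ) ≤ d := by exact_mod_cast hd
  have h2 : (3 : ℝ) ≤ Real.log (100 ^ 2 * d * Real.log (40 * n * d)) := by
    apply log_ge_three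
    nlinarith
  have h3 : ((63 * d : ℕ) : ℝ) ≤ sampleSize n d ε := by
    refine le_trans ?_ (Nat.le_ceil _)
    refine le_trans ?_ (le_max_left _ _)
    push_cast
    have h4 : (9 : ℝ) ≤ Real.log (40 * n * d) * Real.log (100 ^ 2 * d * Real.log (40 * n * d)) := by
      nlinarith
    nlinarith
  exact_mod_cast h3

theorem mainProg_cost {k d : ℕ} (A : Matrix (Fin (2 ^ k)) (Fin d) ℝ) (b : Fin (2 ^ k) → ℝ) (ε : ℝ)
    (hd : 0 < d) (n r : ℕ) (hn : n = 2 ^ k) (hr : r = sampleSize n d ε) (ω : Coins (2 ^ k) r) :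
    (mainProg.run (initState A b ω)).Outputs (xTilde A b ω) ∧
      ((mainProg.run (initState A b ω)).ops : ℝ) ≤
        n * (d + 1) + 2 * n * (d + 1) * Real.logb 2 (r + 1) + 200 * (r * d ^ 2) ∧
      ((mainProg.run (initState A b ω)).steps : ℝ) ≤
        200 * (n * (d + 1) * Real.logb 2 (r + 1) + r * d ^ 2) := by
  subst hn
  have hrd : 63 * d ≤ r := by
    rw [hr]; exact sampleSize_ge (by positivity) hd ε
  obtain ⟨j, s, hjs, hj, hs, hout, hops, hsteps⟩ := mainProg_runs hd (by omega) A b ω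
  have hjL : (j : ℝ) ≤ Real.logb 2 (r + 1) := by
    rw [Real.le_logb_iff_rpow_le (by norm_num) (by positivity), Real.rpow_natCast]
    exact_mod_cast hj
  have hL : (6 : ℝ) ≤ Real.logb 2 (r + 1) := by
    rw [Real.le_logb_iff_rpow_le (by norm_num) (by positivity)]
    have : (64 : ℝ) ≤ r + 1 := by exact_mod_cast (by omega : 64 ≤ r + 1)
    norm_num at *
    exact this
  obtain ⟨h1, h2⟩ := main_cost_bounds rfl hjs hd hjL hL hs (by omega)
  exact ⟨hout, (Nat.cast_le.mpr hops).trans h1, (Nat.cast_le.mpr hsteps).trans h2⟩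

/-! ### The smallest eigenvalue of a sum of random rank one matrices -/

/-- Chebyshev's sum inequality: powers are similarly ordered, so the symmetrized double sum of
products of differences is nonnegative. -/
theorem weighted_chebyshev {κ : Type*} [Fintype κ] (ρ l : κ → ℝ) (hρ : ∀ i, 0 ≤ ρ i) (hl : ∀ i, 0 ≤ l i) (a b : ℕ) :
    (∑ i, ρ i * l i ^ a) * (∑ i, ρ i * l i ^ b) ≤ (∑ i, ρ i) * ∑ i, ρ i * l i ^ (a + b) := by
  have key : 0 ≤ ∑ i, ∑ j, ρ i * ρ j * ((l i ^ a - l j ^ a) * (l i ^ b - l j ^ b)) := by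
    refine Finset.sum_nonneg fun i _ => Finset.sum_nonneg fun j _ => ?_
    refine mul_nonneg (mul_nonneg (hρ i) (hρ j)) ?_
    rcases le_total (l i) (l j) with h | h
    · exact mul_nonneg_of_nonpos_of_nonpos
        (sub_nonpos.mpr (pow_le_pow_left₀ (hl i) h a))
        (sub_nonpos.mpr (pow_le_pow_left₀ (hl i) h b))
    · exact mul_nonneg
        (sub_nonneg.mpr (pow_le_pow_left₀ (hl j) h a))
        (sub_nonneg.mpr (pow_le_pow_left₀ (hl j) h b))
  have e : ∑ i, ∑ j, ρ i * ρ j * ((l i ^ a - l j ^ a) * (l i ^ b - l j ^ b)) =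
      2 * ((∑ i, ρ i) * ∑ i, ρ i * l i ^ (a + b)) -
      2 * ((∑ i, ρ i * l i ^ a) * (∑ i, ρ i * l i ^ b)) := by
    have h1 : ∀ i j, ρ i * ρ j * ((l i ^ a - l j ^ a) * (l i ^ b - l j ^ b)) =
        (ρ i * l i ^ (a + b)) * ρ j + ρ i * (ρ j * l j ^ (a + b)) -
        ((ρ i * l i ^ a) * (ρ j * l j ^ b) + (ρ i * l i ^ b) * (ρ j * l j ^ a)) := by
      intro i j; ring
    simp only [h1, Finset.sum_sub_distrib, Finset.sum_add_distrib, ← Finset.mul_sum,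
      ← Finset.sum_mul]
    ring
  linarith

theorem dotProduct_mulVec_symm {κ : Type*} [Fintype κ] {C : Matrix κ κ ℝ} (hC : Cᵀ = C) (x y : κ → ℝ) :
    x ⬝ᵥ (C *ᵥ y) = y ⬝ᵥ (C *ᵥ x) := by
  rw [Matrix.dotProduct_mulVec, ← Matrix.mulVec_transpose, hC, dotProduct_comm]

theorem posSemidef_transpose {κ : Type*} {C : Matrix κ κ ℝ} (hC : C.PosSemidef) : Cᵀ = C := by
  have := hC.1
  rwa [Matrix.IsHermitian, Matrix.conjTranspose_eq_transpose_of_trivial] at this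

section potential

variable {κ : Type*} [Fintype κ] [DecidableEq κ]

theorem posSemidef_pow_spectral {C : Matrix κ κ ℝ} (hC : C.PosSemidef) :
    ∃ (Q : Matrix κ κ ℝ) (l : κ → ℝ), Qᵀ * Q = 1 ∧ (∀ i, 0 ≤ l i) ∧
      ∀ m : ℕ, C ^ m = Q * Matrix.diagonal (fun i => l i ^ m) * Qᵀ := by
  set U : Matrix κ κ ℝ := (hC.1.eigenvectorUnitary : Matrix κ κ ℝ) with hU
  have hU1 : Uᵀ * U = 1 := by
    have := Unitary.coe_star_mul_self hC.1.eigenvectorUnitary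
    simpa [Matrix.star_eq_conjTranspose] using this
  have hU2 : U * Uᵀ = 1 := mul_eq_one_comm.mp hU1
  have hspec : C = U * Matrix.diagonal hC.1.eigenvalues * Uᵀ := by
    have := hC.1.spectral_theorem
    rw [Unitary.conjStarAlgAut_apply] at this
    simpa [Matrix.star_eq_conjTranspose, Function.comp_def] using this
  refine ⟨U, hC.1.eigenvalues, hU1, hC.eigenvalues_nonneg, fun m => ?_⟩
  induction m with
  | zero => simp [hU2]
  | succ m ih =>
    rw [pow_succ, ih]
    calc U * Matrix.diagonal (fun i => hC.1.eigenvalues i ^ m) * Uᵀ * C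
        = U * Matrix.diagonal (fun i => hC.1.eigenvalues i ^ m) * Uᵀ *
          (U * Matrix.diagonal hC.1.eigenvalues * Uᵀ) := congrArg _ hspec
      _ = U * Matrix.diagonal (fun i => hC.1.eigenvalues i ^ m) * (Uᵀ * U) *
          Matrix.diagonal hC.1.eigenvalues * Uᵀ := by simp only [Matrix.mul_assoc]
      _ = U * (Matrix.diagonal (fun i => hC.1.eigenvalues i ^ m) *
          Matrix.diagonal hC.1.eigenvalues) * Uᵀ := by
          rw [hU1]; simp only [Matrix.mul_assoc, Matrix.one_mul]
      _ = _ := by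
          rw [Matrix.diagonal_mul_diagonal]
          simp only [pow_succ]

/-- The moment `⟨u, C ^ m u⟩`. -/
def moment (C : Matrix κ κ ℝ) (u : κ → ℝ) (m : ℕ) : ℝ := u ⬝ᵥ (C ^ m *ᵥ u)

theorem moment_eq_sum {C Q : Matrix κ κ ℝ} {l : κ → ℝ}
    (h : ∀ m : ℕ, C ^ m = Q * Matrix.diagonal (fun i => l i ^ m) * Qᵀ) (u : κ → ℝ) (m : ℕ) :
    moment C u m = ∑ i, l i ^ m * (Qᵀ *ᵥ u) i ^ 2 := by
  rw [moment, h, ← Matrix.mulVec_mulVec, ← Matrix.mulVec_mulVec, Matrix.dotProduct_mulVec,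
    ← Matrix.mulVec_transpose, dotProduct]
  refine Finset.sum_congr rfl fun i _ => ?_
  rw [Matrix.mulVec_diagonal]
  ring

theorem trace_pow_eq_sum {C Q : Matrix κ κ ℝ} {l : κ → ℝ} (hQ : Qᵀ * Q = 1)
    (h : ∀ m : ℕ, C ^ m = Q * Matrix.diagonal (fun i => l i ^ m) * Qᵀ) (m : ℕ) :
    (C ^ m).trace = ∑ i, l i ^ m := by
  rw [h, Matrix.trace_mul_comm, ← Matrix.mul_assoc, hQ, Matrix.one_mul, Matrix.trace_diagonal]

theorem moment_nonneg {C : Matrix κ κ ℝ} (hC : C.PosSemidef) (u : κ → ℝ) (m : ℕ) :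
    0 ≤ moment C u m := by
  obtain ⟨Q, l, -, hl, h⟩ := posSemidef_pow_spectral hC
  rw [moment_eq_sum h]
  exact Finset.sum_nonneg fun i _ => mul_nonneg (pow_nonneg (hl i) _) (sq_nonneg _)

/-- In an eigenbasis these are moments of the eigenvalues for the weights λ_i (Qᵀu)_i², to which
Chebyshev's inequality applies. -/
theorem moment_mul_le {C : Matrix κ κ ℝ} (hC : C.PosSemidef) (u : κ → ℝ) (a b : ℕ) :
    moment C u (a + 1) * moment C u (b + 1) ≤ moment C u 1 * moment C u (a + b + 1) := by
  obtain ⟨Q, l, -, hl, h⟩ := posSemidef_pow_spectral hC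
  have e : ∀ m, moment C u (m + 1) = ∑ i, (l i * (Qᵀ *ᵥ u) i ^ 2) * l i ^ m := fun m => by
    rw [moment_eq_sum h]
    exact Finset.sum_congr rfl fun i _ => by ring
  have e1 : moment C u 1 = ∑ i, l i * (Qᵀ *ᵥ u) i ^ 2 := by
    rw [moment_eq_sum h]; simp
  rw [e a, e b, e (a + b), e1]
  exact weighted_chebyshev _ l (fun i => mul_nonneg (hl i) (sq_nonneg _)) hl a b

/-- For each eigenvalue x this is the tangent inequality of the convex function y ↦ y^((p+1)/p), at
y = τ^p, evaluated at y = x^p. It bounds the expected decrease of the potential below by a linear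
function of the potential, so that the bound can be averaged over samples. -/
theorem trace_pow_tangent {C : Matrix κ κ ℝ} (hC : C.PosSemidef) (p : ℕ) {τ : ℝ} (hτ : 0 < τ) :
    (p + 1) * τ * (C ^ p).trace - Fintype.card κ * τ ^ (p + 1) ≤ p * (C ^ (p + 1)).trace := by
  obtain ⟨Q, l, hQ, hl, h⟩ := posSemidef_pow_spectral hC
  rw [trace_pow_eq_sum hQ h, trace_pow_eq_sum hQ h]
  have key : ∀ x : ℝ, 0 ≤ x → (p + 1) * τ * x ^ p - τ ^ (p + 1) ≤ p * x ^ (p + 1) := by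
    intro x hx
    induction p with
    | zero => simp
    | succ p ih =>
      push_cast
      have h2 : 0 ≤ (x ^ (p + 1) - τ ^ (p + 1)) * (x - τ) := by
        rcases le_total x τ with h | h
        · exact mul_nonneg_of_nonpos_of_nonpos
            (sub_nonpos.mpr (pow_le_pow_left₀ hx h _)) (sub_nonpos.mpr h)
        · exact mul_nonneg (sub_nonneg.mpr (pow_le_pow_left₀ hτ.le h _)) (sub_nonneg.mpr h)
      have h3 := mul_le_mul_of_nonneg_left ih hx
      have e1 : x ^ (p + 1) = x ^ p * x := pow_succ _ _
      rw [pow_succ x (p + 1), pow_succ τ (p + 1)]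
      rw [e1] at h2 h3 ⊢
      generalize τ ^ (p + 1) = T at *
      nlinarith
  rw [Finset.mul_sum, Finset.mul_sum]
  have e : (Fintype.card κ : ℝ) * τ ^ (p + 1) = ∑ _i : κ, τ ^ (p + 1) := by simp
  rw [e, ← Finset.sum_sub_distrib]
  exact Finset.sum_le_sum fun i _ => key (l i) (hl i)

/-- Effect on the trace of a power of subtracting a rank one matrix. -/
theorem trace_pow_sub_rankOne_le {C C' : Matrix κ κ ℝ} (hC : C.PosSemidef) (hC' : C'.PosSemidef)
    {w : κ → ℝ} (h : C' = C - Matrix.vecMulVec w w) {σ : ℝ} (hσ : 0 ≤ σ)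
    (hmom : ∀ a b, moment C w a * moment C w b ≤ σ * moment C w (a + b + 1)) (p : ℕ) :
    (C' ^ (p + 1)).trace ≤ (C ^ (p + 1)).trace - (p + 1) * (1 - (p + 1) * σ) * moment C w p := by
  have hμ := moment_nonneg hC w
  -- One factor C is exchanged for C' = C - wwᵀ at a time; the rank one term splits into a product
  -- of two moments.
  have hF : ∀ k m, w ⬝ᵥ ((C' ^ (k + 1) * C ^ m) *ᵥ w) =
      w ⬝ᵥ ((C' ^ k * C ^ (m + 1)) *ᵥ w) - moment C' w k * moment C w m := by
    intro k m
    have e : C' ^ (k + 1) * C ^ m = C' ^ k * C ^ (m + 1) - C' ^ k * (Matrix.vecMulVec w w * C ^ m) := by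
      rw [pow_succ C' k, pow_succ' C m]
      conv_lhs => rw [Matrix.mul_assoc]; arg 2; rw [h]
      rw [Matrix.sub_mul, Matrix.mul_sub]
    rw [e, Matrix.sub_mulVec, dotProduct_sub, ← Matrix.mulVec_mulVec, ← Matrix.mulVec_mulVec,
      ← Matrix.mulVec_mulVec, Matrix.vecMulVec_mulVec]
    simp [moment, Matrix.mulVec_smul, mul_comm]
  have hup : ∀ k m, w ⬝ᵥ ((C' ^ k * C ^ m) *ᵥ w) ≤ moment C w (k + m) := by
    intro k
    induction k with
    | zero => intro m; simp [moment]
    | succ k ih =>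
      intro m
      rw [hF]
      have h1 := ih (m + 1)
      have h2 := mul_nonneg (moment_nonneg hC' w k) (hμ m)
      rw [show k + 1 + m = k + (m + 1) by ring]
      linarith
  have hup' : ∀ k, moment C' w k ≤ moment C w k := fun k => by simpa [moment] using hup k 0
  -- Each exchange loses a product of moments, which `hmom` bounds by σ times a moment of the same
  -- total degree.
  have hlow : ∀ k m, (1 - k * σ) * moment C w (k + m) ≤ w ⬝ᵥ ((C' ^ k * C ^ m) *ᵥ w) := by
    intro k
    induction k with
    | zero => intro m; simp [moment]
    | succ k ih =>
      intro m
      rw [hF]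
      have h1 := ih (m + 1)
      have h2 := mul_le_mul_of_nonneg_right (hup' k) (hμ m)
      have h3 := hmom k m
      rw [show k + 1 + m = k + (m + 1) by ring] at *
      rw [← add_assoc] at *
      push_cast
      nlinarith
  have hG : ∀ k m, (C' ^ (k + 1) * C ^ m).trace =
      (C' ^ k * C ^ (m + 1)).trace - w ⬝ᵥ ((C' ^ k * C ^ m) *ᵥ w) := by
    intro k m
    have e : C' ^ (k + 1) * C ^ m = C' ^ k * C ^ (m + 1) - C' ^ k * (Matrix.vecMulVec w w * C ^ m) := by
      rw [pow_succ C' k, pow_succ' C m]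
      conv_lhs => rw [Matrix.mul_assoc]; arg 2; rw [h]
      rw [Matrix.sub_mul, Matrix.mul_sub]
    rw [e, Matrix.trace_sub, ← Matrix.mul_assoc, Matrix.mul_vecMulVec, Matrix.vecMulVec_mul,
      Matrix.trace_vecMulVec]
    congr 1
    rw [dotProduct_comm, ← Matrix.dotProduct_mulVec,
      dotProduct_mulVec_symm (by rw [Matrix.transpose_pow, posSemidef_transpose hC]),
      dotProduct_comm, ← Matrix.mulVec_mulVec,
      dotProduct_mulVec_symm (by rw [Matrix.transpose_pow, posSemidef_transpose hC'])]
  -- Telescoping over the p + 1 exchanges under the trace, each lowering it by at least 1 - (p+1)σ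
  -- times the moment.
  have hfin : ∀ k m, k ≤ p + 1 → (C' ^ k * C ^ m).trace ≤
      (C ^ (k + m)).trace - k * (1 - (p + 1) * σ) * moment C w (k + m - 1) := by
    intro k
    induction k with
    | zero => intro m _; simp
    | succ k ih =>
      intro m hk
      rw [hG]
      have h1 := ih (m + 1) (by omega)
      have h2 := hlow k m
      have h3 : (1 - (p + 1) * σ) * moment C w (k + m) ≤ (1 - k * σ) * moment C w (k + m) := by
        refine mul_le_mul_of_nonneg_right ?_ (hμ _)
        have : (k : ℝ) ≤ p + 1 := by exact_mod_cast (by omega : k ≤ p + 1)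
        nlinarith
      rw [show k + (m + 1) - 1 = k + m by omega] at h1
      rw [show k + 1 + m - 1 = k + m by omega, show k + 1 + m = k + (m + 1) by ring]
      push_cast
      nlinarith
  have := hfin (p + 1) 0 le_rfl
  simpa using this

end potential

/-! ### Expected decrease of the inverse trace potential -/

theorem add_rankOne_posDef {κ : Type*} [Fintype κ] {B : Matrix κ κ ℝ} (hB : B.PosDef) (u : κ → ℝ) :
    (B + Matrix.vecMulVec u u).PosDef := by
  refine hB.add_posSemidef ?_
  simpa using Matrix.posSemidef_vecMulVec_self_star u

/-- With x = c/β, (1+x)⁻¹ ≥ 1 - x, and Bernoulli's inequality handles the power. -/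
theorem potential_scalar_step {β c : ℝ} {p : ℕ} (hβ : 0 < β) (hc : 0 ≤ c) :
    (β⁻¹) ^ (p + 1) * (1 - c * (p + 1) * β⁻¹) ≤ ((β + c)⁻¹) ^ (p + 1) := by
  have h1 : (β + c)⁻¹ = β⁻¹ * (1 + c * β⁻¹)⁻¹ := by
    rw [← mul_inv]; congr 1; field_simp
  rw [h1, mul_pow]
  refine mul_le_mul_of_nonneg_left ?_ (by positivity)
  have hx : 0 ≤ c * β⁻¹ := by positivity
  have h2 : 1 - c * β⁻¹ ≤ (1 + c * β⁻¹)⁻¹ := by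
    generalize c * β⁻¹ = x at hx
    rw [← one_div, le_div_iff₀ (by positivity)]
    nlinarith
  have h3 : 0 ≤ (1 + c * β⁻¹)⁻¹ := by positivity
  have h4 := one_add_mul_le_pow (a := (1 + c * β⁻¹)⁻¹ - 1) (by linarith) (p + 1)
  rw [add_sub_cancel] at h4
  refine le_trans ?_ h4
  push_cast
  nlinarith [mul_le_mul_of_nonneg_left h2 (by positivity : (0 : ℝ) ≤ p + 1)]

section potential

variable {κ : Type*} [Fintype κ] [DecidableEq κ]

/-- Setting x = B⁻¹u, expand |u - b₀x|² ≥ 0 and use b₀ |x|² ≤ x·Bx = x·u. -/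
theorem dotProduct_inv_mulVec_le {B : Matrix κ κ ℝ} (hB : B.PosDef) {b₀ : ℝ} (hb : 0 < b₀)
    (hlow : ∀ z : κ → ℝ, b₀ * (z ⬝ᵥ z) ≤ z ⬝ᵥ (B *ᵥ z)) (u : κ → ℝ) :
    u ⬝ᵥ (B⁻¹ *ᵥ u) ≤ (u ⬝ᵥ u) / b₀ := by
  have hdet := (Matrix.isUnit_iff_isUnit_det B).mp hB.isUnit
  set x := B⁻¹ *ᵥ u with hx
  have hBx : B *ᵥ x = u := by
    rw [hx, Matrix.mulVec_mulVec, Matrix.mul_nonsing_inv _ hdet, Matrix.one_mulVec]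
  have h1 := hlow x
  rw [hBx] at h1
  have h2 : 0 ≤ (u - b₀ • x) ⬝ᵥ (u - b₀ • x) := by
    simpa using dotProduct_self_star_nonneg (u - b₀ • x)
  have h3 : (u - b₀ • x) ⬝ᵥ (u - b₀ • x) = u ⬝ᵥ u - 2 * b₀ * (u ⬝ᵥ x) + b₀ * (b₀ * (x ⬝ᵥ x)) := by
    simp only [sub_dotProduct, dotProduct_sub, smul_dotProduct, dotProduct_smul, smul_eq_mul,
      dotProduct_comm x u]
    ring
  rw [dotProduct_comm x u] at h1
  have h4 := mul_le_mul_of_nonneg_left h1 hb.le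
  rw [le_div_iff₀ hb]
  linarith

/-- By Sherman-Morrison the update subtracts wwᵀ from C = B⁻¹, with w = Cu/√(1+s) and s = u·Cu ≤ η.
Smallness of η makes the first order decrease dominant; `c` absorbs 1/(1+s) and the higher order
loss. -/
theorem trace_inv_pow_add_rankOne_le {B : Matrix κ κ ℝ} (hB : B.PosDef) {b₀ η : ℝ} (hb : 0 < b₀)
    (hlow : ∀ z : κ → ℝ, b₀ * (z ⬝ᵥ z) ≤ z ⬝ᵥ (B *ᵥ z)) {u : κ → ℝ} (hu : u ⬝ᵥ u ≤ η * b₀)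
    {p : ℕ} {c : ℝ} (hc : 0 ≤ c) (hcη : c * (1 + η) ≤ 1 - (p + 1) * η) :
    ((B + Matrix.vecMulVec u u)⁻¹ ^ (p + 1)).trace ≤ (B⁻¹ ^ (p + 1)).trace -
      (p + 1) * c * moment B⁻¹ u (p + 2) := by
  have hdet := (Matrix.isUnit_iff_isUnit_det B).mp hB.isUnit
  set C := B⁻¹ with hC
  have hCpos : C.PosDef := hB.inv
  have hCs := hCpos.posSemidef
  have hCT := posSemidef_transpose hCs
  set s := u ⬝ᵥ (C *ᵥ u) with hs
  have hs1 : moment C u 1 = s := by simp [moment, hs]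
  have hs0 : 0 ≤ s := hs1 ▸ moment_nonneg hCs u 1
  have hsη : s ≤ η := by
    refine (dotProduct_inv_mulVec_le hB hb hlow u).trans ?_
    rwa [div_le_iff₀ hb]
  set t := (√(1 + s))⁻¹ with ht
  have ht2 : t * t * (1 + s) = 1 := by
    have h1 : √(1 + s) * √(1 + s) = 1 + s := Real.mul_self_sqrt (by linarith)
    have h2 : √(1 + s) ≠ 0 := by positivity
    rw [ht]; field_simp; rw [sq, h1]
  set w := t • (C *ᵥ u) with hw
  have hinv : (B + Matrix.vecMulVec u u)⁻¹ = C - Matrix.vecMulVec w w := by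
    refine Matrix.inv_eq_right_inv ?_
    have e1 : Matrix.vecMulVec w w = (t * t) • Matrix.vecMulVec (C *ᵥ u) (C *ᵥ u) := by
      rw [hw, Matrix.smul_vecMulVec, Matrix.vecMulVec_smul, smul_smul]
    have e2 : u ᵥ* C = C *ᵥ u := by rw [← Matrix.mulVec_transpose, hCT]
    have e3 : B *ᵥ (C *ᵥ u) = u := by
      rw [hC, Matrix.mulVec_mulVec, Matrix.mul_nonsing_inv _ hdet, Matrix.one_mulVec]
    rw [e1, Matrix.mul_sub, Matrix.add_mul, Matrix.add_mul, hC, Matrix.mul_nonsing_inv _ hdet, ← hC,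
      Matrix.vecMulVec_mul, e2, Matrix.mul_smul, Matrix.mul_smul, Matrix.mul_vecMulVec, e3,
      Matrix.vecMulVec_mul_vecMulVec, ← hs]
    rw [Matrix.vecMulVec_smul, smul_smul, ← add_smul, ← mul_one_add, ht2, one_smul,
      add_sub_cancel_right]
  have hC's : (C - Matrix.vecMulVec w w).PosSemidef := by
    rw [← hinv]; exact (add_rankOne_posDef hB u).inv.posSemidef
  have hmw : ∀ m, moment C w m = t * t * moment C u (m + 2) := by
    intro m
    have e2 : C ^ (m + 2) = C * C ^ m * C := by rw [← pow_succ', ← pow_succ]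
    rw [moment, hw, Matrix.mulVec_smul, smul_dotProduct, dotProduct_smul, smul_eq_mul, smul_eq_mul,
      moment, e2, ← Matrix.mulVec_mulVec, ← Matrix.mulVec_mulVec, dotProduct_mulVec_symm hCT,
      dotProduct_comm (C *ᵥ u), mul_assoc]
  have ht0 : 0 ≤ t * t := mul_self_nonneg t
  have ht1 : t * t ≤ 1 := by nlinarith
  -- Passing from w to u raises each degree by 2, so Chebyshev's inequality leaves the first moment
  -- s of u as a factor, and t²s ≤ η.
  have hmom : ∀ a b, moment C w a * moment C w b ≤ η * moment C w (a + b + 1) := by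
    intro a b
    rw [hmw, hmw, hmw]
    have h1 := moment_mul_le hCs u (a + 1) (b + 1)
    rw [hs1, show a + 1 + (b + 1) + 1 = a + b + 1 + 2 by ring] at h1
    have h2 := moment_nonneg hCs u (a + b + 1 + 2)
    calc t * t * moment C u (a + 2) * (t * t * moment C u (b + 2))
        = (t * t) * (t * t) * (moment C u (a + 1 + 1) * moment C u (b + 1 + 1)) := by ring_nf
      _ ≤ (t * t) * (t * t) * (s * moment C u (a + b + 1 + 2)) :=
          mul_le_mul_of_nonneg_left h1 (mul_nonneg ht0 ht0)
      _ = (t * t * s) * (t * t * moment C u (a + b + 1 + 2)) := by ring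
      _ ≤ η * (t * t * moment C u (a + b + 1 + 2)) := by
          refine mul_le_mul_of_nonneg_right ?_ (mul_nonneg ht0 h2)
          nlinarith
  have hη : 0 ≤ η := hs0.trans hsη
  rw [hinv]
  refine (trace_pow_sub_rankOne_le hCs hC's rfl hη hmom p).trans ?_
  rw [hmw]
  have h2 := moment_nonneg hCs u (p + 2)
  have h3 : c ≤ (1 - (p + 1) * η) * (t * t) := by
    have h4 : c * (1 + s) ≤ 1 - (p + 1) * η := by nlinarith
    calc c = c * (1 + s) * (t * t) := by linear_combination (-c) * ht2
      _ ≤ _ := mul_le_mul_of_nonneg_right h4 ht0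
  have h4 := mul_le_mul_of_nonneg_right h3 h2
  have h5 : (0 : ℝ) ≤ p + 1 := by positivity
  have h6 := mul_le_mul_of_nonneg_left h4 h5
  linarith

/-- A multiple of the identity plus the sum of the rank one matrices of a sample. -/
def sampleSum {ι : Type*} (u : ι → κ → ℝ) (b₀ : ℝ) {r : ℕ} (f : Fin r → ι) : Matrix κ κ ℝ :=
  b₀ • (1 : Matrix κ κ ℝ) + ∑ t, Matrix.vecMulVec (u (f t)) (u (f t))

theorem dotProduct_sampleSum_mulVec {ι : Type*} (u : ι → κ → ℝ) (b₀ : ℝ) {r : ℕ} (f : Fin r → ι)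
    (z : κ → ℝ) :
    z ⬝ᵥ (sampleSum u b₀ f *ᵥ z) = b₀ * (z ⬝ᵥ z) + ∑ t, (u (f t) ⬝ᵥ z) ^ 2 := by
  rw [sampleSum, Matrix.add_mulVec, dotProduct_add, Matrix.smul_mulVec, Matrix.one_mulVec,
    dotProduct_smul, smul_eq_mul, Matrix.sum_mulVec, dotProduct_sum]
  congr 1
  refine Finset.sum_congr rfl fun t _ => ?_
  rw [Matrix.vecMulVec_mulVec]
  simp [dotProduct_comm z, sq]

theorem sampleSum_posDef {ι : Type*} (u : ι → κ → ℝ) {b₀ : ℝ} (hb : 0 < b₀) {r : ℕ}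
    (f : Fin r → ι) : (sampleSum u b₀ f).PosDef := by
  refine Matrix.PosDef.add_posSemidef (Matrix.PosDef.one.smul hb) ?_
  refine Matrix.posSemidef_sum _ fun t _ => ?_
  simpa using Matrix.posSemidef_vecMulVec_self_star (u (f t))

theorem sum_moment_eq {ι : Type*} [Fintype ι] {u : ι → κ → ℝ} {c : ℝ}
    (hu : ∑ i, Matrix.vecMulVec (u i) (u i) = c • (1 : Matrix κ κ ℝ)) (C : Matrix κ κ ℝ) (m : ℕ) :
    ∑ i, moment C (u i) m = c * (C ^ m).trace := by
  have h : ∀ i, moment C (u i) m = (C ^ m * Matrix.vecMulVec (u i) (u i)).trace := fun i => by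
    rw [Matrix.mul_vecMulVec, Matrix.trace_vecMulVec, moment, dotProduct_comm]
  simp only [h]
  rw [← Matrix.trace_sum, ← Finset.mul_sum, hu, Matrix.mul_smul, Matrix.mul_one, Matrix.trace_smul,
    smul_eq_mul]

/-- Induction on the sample size. Isotropy turns the average of the moments into tr C^(p+2), and the
tangent inequality at 1/β, with β = b₀ + cr, makes the recursion linear. The comparison value is
attained when each sample adds `c` times the identity. -/
theorem sum_trace_inv_pow_le {ι : Type*} [Fintype ι] {u : ι → κ → ℝ}
    (hu : ∑ i, Matrix.vecMulVec (u i) (u i) = (Fintype.card ι : ℝ) • (1 : Matrix κ κ ℝ))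
    {b₀ η c : ℝ} {p : ℕ} (hb : 0 < b₀) (hη : ∀ i, u i ⬝ᵥ u i ≤ η * b₀) (hc : 0 ≤ c)
    (hcη : c * (1 + η) ≤ 1 - (p + 1) * η) (hpb : c * (p + 2) ≤ b₀) (r : ℕ) :
    ∑ f : Fin r → ι, ((sampleSum u b₀ f)⁻¹ ^ (p + 1)).trace ≤
      (Fintype.card ι : ℝ) ^ r * (Fintype.card κ * ((b₀ + c * r)⁻¹) ^ (p + 1)) := by
  induction r with
  | zero =>
    have h1 : ∀ f : Fin 0 → ι, ((sampleSum u b₀ f)⁻¹ ^ (p + 1)).trace =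
        Fintype.card κ * (b₀⁻¹) ^ (p + 1) := by
      intro f
      have : (sampleSum u b₀ f)⁻¹ = b₀⁻¹ • (1 : Matrix κ κ ℝ) := by
        refine Matrix.inv_eq_right_inv ?_
        simp [sampleSum, smul_smul, hb.ne']
      rw [this, smul_pow, one_pow, Matrix.trace_smul, Matrix.trace_one, smul_eq_mul, mul_comm]
    rw [Fintype.sum_congr _ _ h1]
    simp
  | succ r ih =>
    set n : ℝ := (Fintype.card ι : ℝ) with hn
    set D : ℝ := (Fintype.card κ : ℝ) with hD
    set β : ℝ := b₀ + c * r with hβ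
    have hβ0 : 0 < β := by positivity
    have hββ : b₀ ≤ β := by rw [hβ]; nlinarith [mul_nonneg hc (Nat.cast_nonneg (α := ℝ) r)]
    have hstep : ∀ f : Fin r → ι,
        ∑ i, ((sampleSum u b₀ (Fin.cons i f : Fin (r + 1) → ι))⁻¹ ^ (p + 1)).trace ≤
        n * ((1 - c * (p + 2) * β⁻¹) * ((sampleSum u b₀ f)⁻¹ ^ (p + 1)).trace +
          c * D * (β⁻¹) ^ (p + 2)) := by
      intro f
      set B := sampleSum u b₀ f with hB
      have hcons : ∀ i, sampleSum u b₀ (Fin.cons i f : Fin (r + 1) → ι) =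
          B + Matrix.vecMulVec (u i) (u i) := by
        intro i
        simp only [sampleSum, hB, Fin.sum_univ_succ, Fin.cons_zero, Fin.cons_succ]
        abel
      have hlow : ∀ z : κ → ℝ, b₀ * (z ⬝ᵥ z) ≤ z ⬝ᵥ (B *ᵥ z) := by
        intro z
        rw [hB, dotProduct_sampleSum_mulVec]
        have := Finset.sum_nonneg fun t (_ : t ∈ Finset.univ) => sq_nonneg (u (f t) ⬝ᵥ z)
        linarith
      have hBp : B.PosDef := sampleSum_posDef u hb f
      have h1 : ∑ i, ((sampleSum u b₀ (Fin.cons i f : Fin (r + 1) → ι))⁻¹ ^ (p + 1)).trace ≤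
          ∑ i, ((B⁻¹ ^ (p + 1)).trace - (p + 1) * c * moment B⁻¹ (u i) (p + 2)) := by
        refine Finset.sum_le_sum fun i _ => ?_
        rw [hcons]
        exact trace_inv_pow_add_rankOne_le hBp hb hlow (hη i) hc hcη
      refine h1.trans ?_
      rw [Finset.sum_sub_distrib, ← Finset.mul_sum, sum_moment_eq hu, Finset.sum_const,
        Finset.card_univ, nsmul_eq_mul, ← hn]
      have h2 := trace_pow_tangent hBp.inv.posSemidef (p + 1) (inv_pos.mpr hβ0)
      rw [← hD] at h2
      push_cast at h2
      have h3 : 0 ≤ n := by positivity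
      have h4 := mul_le_mul_of_nonneg_left h2 (mul_nonneg h3 hc)
      have e1 : p + 1 + 1 = p + 2 := rfl
      rw [e1] at h4
      ring_nf at h4 ⊢
      linarith
    have hsum : ∑ f : Fin (r + 1) → ι, ((sampleSum u b₀ f)⁻¹ ^ (p + 1)).trace =
        ∑ f : Fin r → ι, ∑ i,
          ((sampleSum u b₀ (Fin.cons i f : Fin (r + 1) → ι))⁻¹ ^ (p + 1)).trace := by
      rw [← (Fin.consEquiv fun _ => ι).sum_comp, Fintype.sum_prod_type, Finset.sum_comm]
      rfl
    rw [hsum]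
    refine (Finset.sum_le_sum fun f _ => hstep f).trans ?_
    rw [← Finset.mul_sum, Finset.sum_add_distrib, ← Finset.mul_sum, Finset.sum_const,
      Finset.card_univ, nsmul_eq_mul, Fintype.card_fun, Fintype.card_fin]
    push_cast
    rw [← hn]
    -- The coefficient of the old potential must be nonnegative before the induction hypothesis can
    -- be inserted; this is the role of `hpb`.
    have hcoef : 0 ≤ 1 - c * (p + 2) * β⁻¹ := by
      rw [sub_nonneg, ← div_eq_mul_inv, div_le_one hβ0]
      linarith
    have h5 := mul_le_mul_of_nonneg_left ih hcoef
    have h6 := potential_scalar_step (p := p) hβ0 hc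
    have h7 : 0 ≤ n ^ r * D := by positivity
    have h8 := mul_le_mul_of_nonneg_left h6 h7
    have h9 : 0 ≤ n := by positivity
    have e : b₀ + c * ((r : ℝ) + 1) = β + c := by rw [hβ]; ring
    rw [e, pow_succ n, mul_comm (n ^ r) n, mul_assoc n]
    refine mul_le_mul_of_nonneg_left ?_ h9
    calc (1 - c * (p + 2) * β⁻¹) * ∑ f : Fin r → ι, ((sampleSum u b₀ f)⁻¹ ^ (p + 1)).trace +
          n ^ r * (c * D * β⁻¹ ^ (p + 2)) ≤
          (1 - c * (p + 2) * β⁻¹) * (n ^ r * (D * β⁻¹ ^ (p + 1))) +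
          n ^ r * (c * D * β⁻¹ ^ (p + 2)) := by linarith
      _ = n ^ r * D * (β⁻¹ ^ (p + 1) * (1 - c * (p + 1) * β⁻¹)) := by ring
      _ ≤ _ := h8
      _ = _ := by ring

/-- Each eigenvalue of B⁻¹, raised to the power p+1, is at most the trace, so B⁻¹ ≤ τ as quadratic
forms; it remains to invert this inequality. -/
theorem le_dotProduct_of_trace_inv_pow_le {B : Matrix κ κ ℝ} (hB : B.PosDef) {τ : ℝ} {p : ℕ}
    (hτ : 0 < τ) (h : (B⁻¹ ^ (p + 1)).trace ≤ τ ^ (p + 1)) (z : κ → ℝ) :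
    τ⁻¹ * (z ⬝ᵥ z) ≤ z ⬝ᵥ (B *ᵥ z) := by
  have hdet := (Matrix.isUnit_iff_isUnit_det B).mp hB.isUnit
  obtain ⟨Q, l, hQ, hl, hpow⟩ := posSemidef_pow_spectral hB.inv.posSemidef
  have hle : ∀ i, l i ≤ τ := by
    intro i
    rw [trace_pow_eq_sum hQ hpow] at h
    refine le_of_pow_le_pow_left₀ (Nat.succ_ne_zero p) hτ.le (le_trans ?_ h)
    exact Finset.single_le_sum (f := fun i => l i ^ (p + 1)) (fun j _ => pow_nonneg (hl j) _)
      (Finset.mem_univ i)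
  have hC : z ⬝ᵥ (B⁻¹ *ᵥ z) ≤ τ * (z ⬝ᵥ z) := by
    have h1 := moment_eq_sum hpow z 1
    have h0 := moment_eq_sum hpow z 0
    simp only [moment, pow_one, pow_zero, Matrix.one_mulVec, one_mul] at h1 h0
    rw [h1, h0, Finset.mul_sum]
    exact Finset.sum_le_sum fun i _ => mul_le_mul_of_nonneg_right (hle i) (sq_nonneg _)
  -- Expanding y·B⁻¹y ≥ 0 for this y and bounding z·B⁻¹z by τ|z|² yields z·Bz ≥ |z|²/τ.
  set y := B *ᵥ z - τ⁻¹ • z with hy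
  have h1 := moment_nonneg hB.inv.posSemidef y 1
  have hBT := posSemidef_transpose hB.posSemidef
  have hinv : B⁻¹ *ᵥ (B *ᵥ z) = z := by
    rw [Matrix.mulVec_mulVec, Matrix.nonsing_inv_mul _ hdet, Matrix.one_mulVec]
  have h2 : moment B⁻¹ y 1 = z ⬝ᵥ (B *ᵥ z) - 2 * τ⁻¹ * (z ⬝ᵥ z) + τ⁻¹ * (τ⁻¹ * (z ⬝ᵥ (B⁻¹ *ᵥ z))) := by
    have h3 : (B *ᵥ z) ⬝ᵥ (B⁻¹ *ᵥ z) = z ⬝ᵥ z := by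
      rw [dotProduct_mulVec_symm (posSemidef_transpose hB.inv.posSemidef), hinv]
    rw [moment, pow_one, hy, Matrix.mulVec_sub, Matrix.mulVec_smul, hinv]
    simp only [sub_dotProduct, dotProduct_sub, smul_dotProduct, dotProduct_smul, smul_eq_mul, h3,
      dotProduct_comm (B *ᵥ z) z]
    ring
  have h3 : τ⁻¹ * (τ⁻¹ * (z ⬝ᵥ (B⁻¹ *ᵥ z))) ≤ τ⁻¹ * (z ⬝ᵥ z) := by
    refine mul_le_mul_of_nonneg_left ?_ (inv_pos.mpr hτ).le
    rw [inv_mul_le_iff₀ hτ]; exact hC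
  rw [h2] at h1
  linarith

end potential

/-! ### Counting bad outcomes -/

open Classical in
theorem card_lt_mul_le_sum {α : Type*} [Fintype α] {g : α → ℝ} (hg : ∀ x, 0 ≤ g x) (c : ℝ) :
    ((Finset.univ.filter fun x => c < g x).card : ℝ) * c ≤ ∑ x, g x := by
  rw [← nsmul_eq_mul]
  refine (Finset.card_nsmul_le_sum _ g c fun x hx => (Finset.mem_filter.mp hx).2.le).trans ?_
  exact Finset.sum_le_univ_sum_of_nonneg hg

theorem sum_exp_signs_le {ι : Type*} [Fintype ι] [DecidableEq ι] (a : ι → ℝ) (t : ℝ) :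
    ∑ σ : ι → ℤˣ, Real.exp (t * ∑ i, a i * ((σ i : ℤ) : ℝ)) ≤
      2 ^ Fintype.card ι * Real.exp (t ^ 2 * (∑ i, a i ^ 2) / 2) := by
  have h1 : ∀ σ : ι → ℤˣ, Real.exp (t * ∑ i, a i * ((σ i : ℤ) : ℝ)) =
      ∏ i, Real.exp (t * a i * ((σ i : ℤ) : ℝ)) := fun σ => by
    rw [← Real.exp_sum, Finset.mul_sum]
    simp only [mul_assoc]
  have h2 : ∀ i, ∑ s : ℤˣ, Real.exp (t * a i * ((s : ℤ) : ℝ)) = 2 * Real.cosh (t * a i) := fun i => by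
    rw [Real.cosh_eq]
    have : (Finset.univ : Finset ℤˣ) = {1, -1} := rfl
    rw [this, Finset.sum_pair (by decide)]
    simp
    ring
  simp only [h1]
  rw [← Fintype.prod_sum (fun i (s : ℤˣ) => Real.exp (t * a i * ((s : ℤ) : ℝ)))]
  simp only [h2]
  rw [Finset.prod_mul_distrib, Finset.prod_const, Finset.card_univ]
  refine mul_le_mul_of_nonneg_left ?_ (by positivity)
  have h3 : t ^ 2 * (∑ i, a i ^ 2) / 2 = ∑ i, (t * a i) ^ 2 / 2 := by
    rw [Finset.mul_sum, Finset.sum_div]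
    exact Finset.sum_congr rfl fun i _ => by ring
  rw [h3, Real.exp_sum]
  exact Finset.prod_le_prod (fun i _ => (Real.cosh_pos _).le)
    fun i _ => Real.cosh_le_exp_half_sq _

open Classical in
/-- Hoeffding's inequality for a normalized sum of signs. -/
theorem card_signs_le {ι : Type*} [Fintype ι] [DecidableEq ι] {a : ι → ℝ} (ha : ∑ i, a i ^ 2 = 1) {ℓ : ℝ}
    (hℓ : 0 < ℓ) :
    ((Finset.univ.filter fun σ : ι → ℤˣ => 2 * ℓ < (∑ i, a i * ((σ i : ℤ) : ℝ)) ^ 2).card : ℝ) ≤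
      2 ^ Fintype.card ι * (2 * Real.exp (-ℓ)) := by
  -- This t is both the deviation and the optimal exponential parameter: each tail is at most
  -- exp(t²/2 - t²) = exp(-ℓ).
  set t := √(2 * ℓ) with ht
  have ht2 : t ^ 2 = 2 * ℓ := Real.sq_sqrt (by linarith)
  have ht0 : 0 < t := Real.sqrt_pos.mpr (by linarith)
  set S : (ι → ℤˣ) → ℝ := fun σ => ∑ i, a i * ((σ i : ℤ) : ℝ) with hS
  have hside : ∀ s : ℝ, s ^ 2 = t ^ 2 →
      ((Finset.univ.filter fun σ => Real.exp (2 * ℓ) < Real.exp (s * S σ)).card : ℝ) ≤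
      2 ^ Fintype.card ι * Real.exp (-ℓ) := by
    intro s hs
    have h1 := card_lt_mul_le_sum (g := fun σ => Real.exp (s * S σ)) (fun σ => (Real.exp_pos _).le)
      (Real.exp (2 * ℓ))
    have h2 := h1.trans (sum_exp_signs_le a s)
    rw [ha, hs, ht2] at h2
    have h3 : Real.exp (2 * ℓ * 1 / 2) = Real.exp (-ℓ) * Real.exp (2 * ℓ) := by
      rw [← Real.exp_add]; congr 1; ring
    rw [h3, ← mul_assoc] at h2
    exact le_of_mul_le_mul_right h2 (Real.exp_pos _)
  have hsub : (Finset.univ.filter fun σ => 2 * ℓ < S σ ^ 2) ⊆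
      (Finset.univ.filter fun σ => Real.exp (2 * ℓ) < Real.exp (t * S σ)) ∪
      (Finset.univ.filter fun σ => Real.exp (2 * ℓ) < Real.exp (-t * S σ)) := by
    intro σ hσ
    simp only [Finset.mem_union, Finset.mem_filter, Finset.mem_univ, true_and, Real.exp_lt_exp]
      at hσ ⊢
    rw [← ht2] at hσ ⊢
    have h1 : t < |S σ| := by
      rw [← abs_of_pos ht0]
      exact sq_lt_sq.mp hσ
    rcases lt_abs.mp h1 with h | h
    · left; nlinarith
    · right; nlinarith
  have h1 : ((Finset.univ.filter fun σ => 2 * ℓ < S σ ^ 2).card : ℝ) ≤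
      (Finset.univ.filter fun σ => Real.exp (2 * ℓ) < Real.exp (t * S σ)).card +
      (Finset.univ.filter fun σ => Real.exp (2 * ℓ) < Real.exp (-t * S σ)).card := by
    exact_mod_cast (Finset.card_le_card hsub).trans (Finset.card_union_le _ _)
  have h2 := hside t rfl
  have h3 := hside (-t) (by ring)
  linarith

/-- Additivity of second moments of independent centered vectors, written as a count and multiplied
by the population size to avoid division. -/
theorem sum_sq_sample_sum {ι κ : Type*} [Fintype ι] [Fintype κ] {y : ι → κ → ℝ}
    (hy : ∑ i, y i = 0) (r : ℕ) :
    (Fintype.card ι : ℝ) * ∑ f : Fin r → ι, (∑ t, y (f t)) ⬝ᵥ (∑ t, y (f t)) =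
      r * (Fintype.card ι : ℝ) ^ r * ∑ i, y i ⬝ᵥ y i := by
  induction r with
  | zero => simp
  | succ r ih =>
    have h1 : ∑ f : Fin (r + 1) → ι, (∑ t, y (f t)) ⬝ᵥ (∑ t, y (f t)) =
        ∑ f : Fin r → ι, ∑ i, (y i + ∑ t, y (f t)) ⬝ᵥ (y i + ∑ t, y (f t)) := by
      rw [← (Fin.consEquiv fun _ => ι).sum_comp, Fintype.sum_prod_type, Finset.sum_comm]
      refine Finset.sum_congr rfl fun f _ => Finset.sum_congr rfl fun i _ => ?_
      simp [Fin.consEquiv, Fin.sum_univ_succ]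
    have h2 : ∀ f : Fin r → ι, ∑ i, (y i + ∑ t, y (f t)) ⬝ᵥ (y i + ∑ t, y (f t)) =
        ∑ i, y i ⬝ᵥ y i + Fintype.card ι * ((∑ t, y (f t)) ⬝ᵥ (∑ t, y (f t))) := by
      intro f
      set Y := ∑ t, y (f t)
      have h3 : ∀ i, (y i + Y) ⬝ᵥ (y i + Y) = y i ⬝ᵥ y i + 2 * (y i ⬝ᵥ Y) + Y ⬝ᵥ Y := fun i => by
        rw [add_dotProduct, dotProduct_add, dotProduct_add, dotProduct_comm Y (y i)]; ring
      simp only [h3, Finset.sum_add_distrib]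
      rw [← Finset.mul_sum, ← sum_dotProduct, hy]
      simp
    rw [h1]
    simp only [h2]
    rw [Finset.sum_add_distrib, ← Finset.mul_sum, ih]
    simp only [Finset.sum_const, Finset.card_univ, Fintype.card_fun, Fintype.card_fin, nsmul_eq_mul]
    push_cast
    ring

open Classical in
-- Counting fibrewise, the failure fractions are 1/20 for the first factor and 3/20 over each good
-- point, 1/5 in all.
theorem card_prod_bad_le {α β : Type*} [Fintype α] [Fintype β] {G : α → Prop} {E : α → β → Prop}
    (hG : ((Finset.univ.filter fun a => ¬ G a).card : ℝ) * 20 ≤ Fintype.card α)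
    (hE : ∀ a, G a → ((Finset.univ.filter fun b => ¬ E a b).card : ℝ) * 20 ≤ 3 * Fintype.card β) :
    ((Finset.univ.filter fun x : α × β => ¬ E x.1 x.2).card : ℝ) * 5 ≤
      Fintype.card α * Fintype.card β := by
  have h1 : ((Finset.univ.filter fun x : α × β => ¬ E x.1 x.2).card : ℝ) =
      ∑ a, ((Finset.univ.filter fun b => ¬ E a b).card : ℝ) := by
    simp only [Finset.card_filter]
    push_cast
    rw [Fintype.sum_prod_type]
  have h2 : ∀ a, ((Finset.univ.filter fun b => ¬ E a b).card : ℝ) * 20 ≤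
      (if ¬ G a then 1 else 0) * (20 * Fintype.card β) + 3 * Fintype.card β := by
    intro a
    by_cases h : G a
    · simpa [h] using hE a h
    · have : ((Finset.univ.filter fun b => ¬ E a b).card : ℝ) ≤ Fintype.card β := by
        exact_mod_cast Finset.card_le_univ _
      simp only [h, not_false_eq_true, if_true]
      have h0 : (0 : ℝ) ≤ Fintype.card β := by positivity
      linarith
  have h3 := Finset.sum_le_sum fun a (_ : a ∈ Finset.univ) => h2 a
  rw [← Finset.sum_mul, ← h1, Finset.sum_add_distrib, ← Finset.sum_mul, Finset.sum_boole,
    Finset.sum_const, Finset.card_univ, nsmul_eq_mul] at h3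
  have h4 := mul_le_mul_of_nonneg_right hG (by positivity : (0 : ℝ) ≤ Fintype.card β)
  linarith

/-- The exponent is explained by ln 1.25 ≥ 1/5, that is, e ≤ 1.25⁵. The bound pays for the factor d
of the trace and for the failure probability 1/20. -/
theorem one_le_exp_bound (d : ℕ) (hd : 0 < d) :
    (20 * d : ℝ) ≤ 1.25 ^ (⌈5 * Real.log (20 * d)⌉₊ + 1) := by
  have hd' : (0 : ℝ) < 20 * d := by positivity
  have h1 : 1 / 5 ≤ Real.log 1.25 := by
    rw [Real.le_log_iff_exp_le (by norm_num)]
    refine le_of_pow_le_pow_left₀ (n := 5) (by norm_num) (by norm_num) ?_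
    rw [← Real.exp_nat_mul]
    have := Real.exp_one_lt_d9
    norm_num at this ⊢
    linarith
  have h2 := Nat.le_ceil (5 * Real.log (20 * d))
  have h3 : (0 : ℝ) ≤ ⌈5 * Real.log (20 * d)⌉₊ := by positivity
  rw [← Real.log_le_log_iff hd' (by positivity), Real.log_pow]
  push_cast
  nlinarith

open Classical in
/-- A sample of `r` rows determines a well conditioned matrix, up to probability `1 / 20`. -/
theorem card_ill_conditioned_le {ι : Type*} [Fintype ι] {d r : ℕ} (hd : 0 < d)
    {u : ι → Fin d → ℝ}
    (hu : ∑ i, Matrix.vecMulVec (u i) (u i) = (Fintype.card ι : ℝ) • (1 : Matrix (Fin d) (Fin d) ℝ))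
    {ℓ : ℝ} (hℓ : 3 ≤ ℓ) (hM : ∀ i, u i ⬝ᵥ u i ≤ 2 * d * ℓ)
    (hr : 48 ^ 2 * d * ℓ * Real.log (100 ^ 2 * d * ℓ) ≤ r) :
    ((Finset.univ.filter fun f : Fin r → ι =>
      ¬ ∀ z, 0.72 * r * (z ⬝ᵥ z) ≤ ∑ t, (u (f t) ⬝ᵥ z) ^ 2).card : ℝ) * 20 ≤
      (Fintype.card ι : ℝ) ^ r := by
  have hd1 : (1 : ℝ) ≤ d := by exact_mod_cast hd
  set Λ := Real.log (100 ^ 2 * d * ℓ) with hΛ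
  have hdℓ : 3 ≤ d * ℓ := by nlinarith
  have hΛ3 : 3 ≤ Λ := log_ge_three (by linarith)
  have hΛd : Real.log (20 * d) ≤ Λ := Real.log_le_log (by positivity) (by nlinarith)
  set p := ⌈5 * Real.log (20 * d)⌉₊ with hp
  have hp1 : (p : ℝ) ≤ 5 * Λ + 1 := by
    have h0 : 0 ≤ 5 * Real.log (20 * d) := by
      have := Real.log_nonneg (show (1 : ℝ) ≤ 20 * d by linarith)
      linarith
    have := (Nat.ceil_lt_add_one h0).le
    rw [← hp] at this
    linarith
  have hp0 : (0 : ℝ) ≤ p := by positivity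
  set R : ℝ := (r : ℝ) with hR
  have hRl : 2304 * (d * ℓ) * Λ ≤ R := by linarith
  have hdℓΛ : 3 * Λ ≤ d * ℓ * Λ := mul_le_mul_of_nonneg_right hdℓ (by linarith)
  have hR0 : 0 < R := by linarith
  -- Chosen so that η · 0.2R = 2dℓ, the available bound on the squared row norms.
  set η := 10 * (d * ℓ) / R with hη
  have hη0 : 0 ≤ η := by positivity
  have hηΛ : η * Λ ≤ 10 / 2304 := by
    rw [hη, div_mul_eq_mul_div, div_le_div_iff₀ hR0 (by norm_num)]
    linarith
  have hηs : η ≤ 10 / 6912 := by nlinarith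
  have hηp : p * η ≤ (5 * Λ + 1) * η := mul_le_mul_of_nonneg_right hp1 hη0
  -- The sample size makes pη a small constant, which leaves room for the value c = 0.95.
  have key := sum_trace_inv_pow_le (u := u) hu (b₀ := 0.2 * R) (η := η) (c := 0.95) (p := p)
    (by linarith) (fun i => (hM i).trans (by rw [hη]; field_simp; linarith)) (by norm_num)
    (by linarith) (by linarith) r
  rw [Fintype.card_fin, ← hR] at key
  -- The factor 1.25 over the scale 1/(1.15R) of the mean leaves a Markov quotient d/1.25^(p+1) ≤
  -- 1/20. It also gives 1/τ = 0.92R, that is 0.72R once the 0.2R of the starting matrix is removed.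
  set τ : ℝ := 1.25 * (0.2 * R + 0.95 * R)⁻¹ with hτ
  have hβ0 : 0 < 0.2 * R + 0.95 * R := by linarith
  have hτ0 : 0 < τ := by positivity
  have hmk := (card_lt_mul_le_sum (fun f => by
    have := sampleSum_posDef u (b₀ := 0.2 * R) (by linarith) f
    obtain ⟨Q, l, hQ, hl, hpow⟩ := posSemidef_pow_spectral this.inv.posSemidef
    rw [trace_pow_eq_sum hQ hpow]
    exact Finset.sum_nonneg fun i _ => pow_nonneg (hl i) _) (τ ^ (p + 1))).trans key
  have hsub : (Finset.univ.filter fun f : Fin r → ι =>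
      ¬ ∀ z, 0.72 * R * (z ⬝ᵥ z) ≤ ∑ t, (u (f t) ⬝ᵥ z) ^ 2) ⊆
      Finset.univ.filter fun f : Fin r → ι =>
        τ ^ (p + 1) < ((sampleSum u (0.2 * R) f)⁻¹ ^ (p + 1)).trace := by
    intro f
    simp only [Finset.mem_filter, Finset.mem_univ, true_and]
    contrapose!
    intro hf z
    have h1 := le_dotProduct_of_trace_inv_pow_le (sampleSum_posDef u (by linarith) f) hτ0 hf z
    rw [dotProduct_sampleSum_mulVec] at h1
    have h2 : τ⁻¹ = 0.92 * R := by
      rw [hτ, mul_inv, inv_inv]; norm_num; ring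
    rw [h2] at h1
    linarith
  have hcard : ((Finset.univ.filter fun f : Fin r → ι =>
      ¬ ∀ z, 0.72 * R * (z ⬝ᵥ z) ≤ ∑ t, (u (f t) ⬝ᵥ z) ^ 2).card : ℝ) ≤
      (Finset.univ.filter fun f : Fin r → ι =>
        τ ^ (p + 1) < ((sampleSum u (0.2 * R) f)⁻¹ ^ (p + 1)).trace).card := by
    exact_mod_cast Finset.card_le_card hsub
  refine (mul_le_mul_of_nonneg_right hcard (by norm_num)).trans ?_
  generalize ((Finset.univ.filter fun f : Fin r → ι =>
    τ ^ (p + 1) < ((sampleSum u (0.2 * R) f)⁻¹ ^ (p + 1)).trace).card : ℝ) = K at hmk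
  rw [hτ, mul_pow, ← mul_assoc, ← mul_assoc] at hmk
  have h1 := le_of_mul_le_mul_right hmk (by positivity)
  have h2 := one_le_exp_bound d hd
  rw [← hp] at h2
  by_cases hK : K ≤ 0
  · have : (0 : ℝ) ≤ (Fintype.card ι : ℝ) ^ r := by positivity
    linarith
  · push Not at hK
    have h3 := mul_le_mul_of_nonneg_left h2 hK.le
    have h4 : (K * 20) * d ≤ (Fintype.card ι : ℝ) ^ r * d := by linarith
    exact le_of_mul_le_mul_right h4 (by linarith)

/-! ### Deterministic error bounds -/

theorem l2_sq {ι : Type*} [Fintype ι] (v : ι → ℝ) : l2 v ^ 2 = v ⬝ᵥ v := by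
  rw [l2, EuclideanSpace.norm_sq_eq]
  simp [dotProduct, sq]

theorem l2_nonneg {ι : Type*} [Fintype ι] (v : ι → ℝ) : 0 ≤ l2 v := norm_nonneg _

theorem dotProduct_self_nonneg_real {ι : Type*} [Fintype ι] (v : ι → ℝ) : 0 ≤ v ⬝ᵥ v :=
  l2_sq v ▸ sq_nonneg _

theorem dotProduct_sq_le {ι : Type*} [Fintype ι] (v w : ι → ℝ) :
    (v ⬝ᵥ w) ^ 2 ≤ (v ⬝ᵥ v) * (w ⬝ᵥ w) := by
  have := Finset.sum_mul_sq_le_sq_mul_sq Finset.univ v w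
  simpa [dotProduct, sq] using this

theorem transpose_mulVec_pinv {ι κ : Type*} [Fintype ι] [Fintype κ] (M : Matrix ι κ ℝ)
    (y : ι → ℝ) : Mᵀ *ᵥ (y - M *ᵥ (pinv M *ᵥ y)) = 0 := by
  obtain ⟨h1, -, h3, -⟩ := pinv_spec M
  have h : Mᵀ * (M * pinv M) = Mᵀ := by
    rw [← h3, ← Matrix.transpose_mul, h1]
  rw [Matrix.mulVec_sub, Matrix.mulVec_mulVec, Matrix.mulVec_mulVec, Matrix.mul_assoc, h, sub_self]

theorem dotProduct_mulVec_eq_transpose {ι κ : Type*} [Fintype ι] [Fintype κ] (M : Matrix ι κ ℝ)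
    (y : ι → ℝ) (x : κ → ℝ) : y ⬝ᵥ (M *ᵥ x) = (Mᵀ *ᵥ y) ⬝ᵥ x := by
  rw [Matrix.dotProduct_mulVec, Matrix.mulVec_transpose]

/-- The residual of the least squares problem. -/
def resid {ι κ : Type*} [Fintype ι] [Fintype κ] (A : Matrix ι κ ℝ) (b : ι → ℝ) : ι → ℝ :=
  b - A *ᵥ xOpt A b

theorem transpose_mulVec_resid {ι κ : Type*} [Fintype ι] [Fintype κ] (A : Matrix ι κ ℝ)
    (b : ι → ℝ) : Aᵀ *ᵥ resid A b = 0 := transpose_mulVec_pinv A b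

theorem mulVec_dotProduct_resid {ι κ : Type*} [Fintype ι] [Fintype κ] (A : Matrix ι κ ℝ)
    (b : ι → ℝ) (x : κ → ℝ) : (A *ᵥ x) ⬝ᵥ resid A b = 0 := by
  rw [dotProduct_comm, dotProduct_mulVec_eq_transpose, transpose_mulVec_resid, zero_dotProduct]

theorem l2_sq_mulVec_sub {ι κ : Type*} [Fintype ι] [Fintype κ] (A : Matrix ι κ ℝ)
    (b : ι → ℝ) (x : κ → ℝ) : l2 (A *ᵥ x - b) ^ 2 =
      l2 (A *ᵥ (x - xOpt A b)) ^ 2 + l2 (resid A b) ^ 2 := by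
  have e : A *ᵥ x - b = A *ᵥ (x - xOpt A b) - resid A b := by
    rw [resid, Matrix.mulVec_sub]; abel
  rw [e, l2_sq, l2_sq, l2_sq, sub_dotProduct, dotProduct_sub, dotProduct_sub,
    mulVec_dotProduct_resid, dotProduct_comm (resid A b), mulVec_dotProduct_resid]
  ring

theorem l2_resid_le_lsqValue {ι κ : Type*} [Fintype ι] [Fintype κ] (A : Matrix ι κ ℝ)
    (b : ι → ℝ) : l2 (resid A b) ≤ lsqValue A b := by
  refine le_ciInf fun x => ?_
  refine le_of_sq_le_sq ?_ (l2_nonneg _)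
  rw [l2_sq_mulVec_sub]
  linarith [sq_nonneg (l2 (A *ᵥ (x - xOpt A b)))]

/-! ### From the projected error to the two accuracy claims -/

theorem colProj_eq {n d : ℕ} (A : Matrix (Fin n) (Fin d) ℝ) (b : Fin n → ℝ) :
    colProj A b = WithLp.toLp 2 (A *ᵥ xOpt A b) := by
  refine Submodule.eq_starProjection_of_mem_of_inner_eq_zero ?_ ?_
  · exact ⟨WithLp.toLp 2 (xOpt A b), by simp⟩
  · rintro w ⟨x, rfl⟩
    have h := mulVec_dotProduct_resid A b x.ofLp
    rw [← WithLp.toLp_sub]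
    change inner ℝ (WithLp.toLp 2 (resid A b)) _ = (0 : ℝ)
    rw [EuclideanSpace.inner_eq_star_dotProduct]
    simpa using h

/-- Both norms are expanded in an eigenbasis of the adjoint composed with the map, where the squared
singular values are the eigenvalues, in decreasing order. -/
theorem singularValues_bounds {n d : ℕ} (A : Matrix (Fin n) (Fin d) ℝ) (hd : 0 < d) (x : Fin d → ℝ) :
    l2 (A *ᵥ x) ≤ (Matrix.toEuclideanLin A).singularValues 0 * l2 x ∧
    (Matrix.toEuclideanLin A).singularValues (d - 1) * l2 x ≤ l2 (A *ᵥ x) := by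
  set T := Matrix.toEuclideanLin A with hT
  have hfin : Module.finrank ℝ (EuclideanSpace ℝ (Fin d)) = d := by simp
  set hS := T.isSymmetric_adjoint_comp_self
  set v := hS.eigenvectorBasis hfin
  set X : EuclideanSpace ℝ (Fin d) := WithLp.toLp 2 x with hX
  have hTX : T X = WithLp.toLp 2 (A *ᵥ x) := by simp [hT, hX]
  have h1 : l2 (A *ᵥ x) ^ 2 = ∑ i : Fin d, T.singularValues i ^ 2 * ‖inner ℝ (v i) X‖ ^ 2 := by
    have e1 : l2 (A *ᵥ x) ^ 2 = inner ℝ ((LinearMap.adjoint T ∘ₗ T) X) X := by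
      rw [LinearMap.comp_apply, LinearMap.adjoint_inner_left, real_inner_self_eq_norm_sq, hTX, l2]
    rw [e1, ← v.sum_inner_mul_inner]
    refine Finset.sum_congr rfl fun i _ => ?_
    rw [hS, hS.apply_eigenvectorBasis hfin i, inner_smul_right, T.sq_singularValues_fin hfin,
      Real.norm_eq_abs, sq_abs, real_inner_comm X]
    simp only [RCLike.ofReal_real_eq_id, id_eq]
    ring
  have h2 : l2 x ^ 2 = ∑ i : Fin d, ‖inner ℝ (v i) X‖ ^ 2 := by
    rw [v.sum_sq_norm_inner_right, l2]
  have hle : ∀ i j : ℕ, i ≤ j → T.singularValues j ^ 2 ≤ T.singularValues i ^ 2 := fun i j h =>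
    pow_le_pow_left₀ (T.singularValues_nonneg j) (T.singularValues_antitone h) 2
  constructor
  · refine le_of_sq_le_sq ?_ (mul_nonneg (T.singularValues_nonneg 0) (l2_nonneg x))
    rw [mul_pow, h1, h2, Finset.mul_sum]
    exact Finset.sum_le_sum fun i _ => mul_le_mul_of_nonneg_right (hle _ _ (Nat.zero_le _))
      (sq_nonneg _)
  · refine le_of_sq_le_sq ?_ (l2_nonneg _)
    rw [mul_pow, h1, h2, Finset.mul_sum]
    exact Finset.sum_le_sum fun i _ => mul_le_mul_of_nonneg_right (hle _ _ (by omega))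
      (sq_nonneg _)

/-- Z² ≤ (γ⁻² - 1)|A x_opt|² follows from |b|² = |A x_opt|² + Z². The largest singular value then
bounds |A x_opt|, and the smallest converts the error in the image into an error of the solution. -/
theorem accuracy_of_error_le {n d : ℕ} {A : Matrix (Fin n) (Fin d) ℝ} (hd : 0 < d)
    (hA : A.rank = d) {b : Fin n → ℝ} {ε : ℝ} (hε : 0 < ε) {x : Fin d → ℝ}
    (h : l2 (A *ᵥ (x - xOpt A b)) ^ 2 ≤ ε * l2 (resid A b) ^ 2) :
    l2 (A *ᵥ x - b) ≤ (1 + ε) * lsqValue A b ∧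
      ∀ γ : ℝ, 0 < γ → γ ≤ 1 → γ * l2 b ≤ ‖colProj A b‖ →
        l2 (xOpt A b - x) ≤ √ε * (condNumber A * √(γ ^ (-2 : ℤ) - 1)) * l2 (xOpt A b) := by
  set Z := l2 (resid A b) with hZ
  have hZ0 : 0 ≤ Z := l2_nonneg _
  constructor
  · refine le_trans ?_ (mul_le_mul_of_nonneg_left (l2_resid_le_lsqValue A b) (by linarith))
    refine le_of_sq_le_sq ?_ (by positivity)
    rw [l2_sq_mulVec_sub, ← hZ]
    -- The squared cost is at most (1+ε)Z², which is below (1+ε)²Z².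
    nlinarith [mul_nonneg hε.le (sq_nonneg Z), mul_nonneg (sq_nonneg ε) (sq_nonneg Z)]
  · intro γ hγ hγ1 hb
    rw [colProj_eq] at hb
    change γ * l2 b ≤ l2 (A *ᵥ xOpt A b) at hb
    obtain ⟨hmax, -⟩ := singularValues_bounds A hd (xOpt A b)
    obtain ⟨-, hmin⟩ := singularValues_bounds A hd (x - xOpt A b)
    rw [condNumber, hA]
    set smax := (Matrix.toEuclideanLin A).singularValues 0
    set smin := (Matrix.toEuclideanLin A).singularValues (d - 1) with hsmin
    have hpos : 0 < smin := by
      rw [hsmin, LinearMap.singularValues_pos_iff_lt_finrank_range]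
      have : Module.finrank ℝ (LinearMap.range (Matrix.toEuclideanLin A)) = A.rank := by
        rw [Matrix.rank_eq_finrank_range_toLin A (PiLp.basisFun 2 ℝ (Fin n))
          (PiLp.basisFun 2 ℝ (Fin d))]
        rfl
      rw [this, hA]
      omega
    set q := γ ^ (-2 : ℤ) - 1 with hq
    have hγ2 : γ ^ (-2 : ℤ) * γ ^ 2 = 1 := by
      rw [← zpow_natCast γ 2, ← zpow_add₀ hγ.ne']; simp
    have hq0 : 0 ≤ q := by
      have : γ ^ 2 ≤ 1 := pow_le_one₀ hγ.le hγ1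
      have h0 : 0 < γ ^ (-2 : ℤ) := by positivity
      rw [hq]
      nlinarith
    have hbsq : l2 b ^ 2 = l2 (A *ᵥ xOpt A b) ^ 2 + Z ^ 2 := by
      have e := l2_sq_mulVec_sub A b 0
      rw [l2_sq, l2_sq] at e ⊢
      simpa [Matrix.mulVec_neg, ← l2_sq] using e
    have hZq : Z ^ 2 ≤ q * l2 (A *ᵥ xOpt A b) ^ 2 := by
      have h1 : γ ^ 2 * l2 b ^ 2 ≤ l2 (A *ᵥ xOpt A b) ^ 2 := by
        rw [← mul_pow]
        exact pow_le_pow_left₀ (mul_nonneg hγ.le (l2_nonneg b)) hb 2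
      rw [hbsq] at h1
      have h2 := mul_le_mul_of_nonneg_left h1 (by positivity : 0 ≤ γ ^ (-2 : ℤ))
      rw [← mul_assoc, hγ2] at h2
      rw [hq]; linarith
    have hsymm : l2 (xOpt A b - x) = l2 (x - xOpt A b) := by
      rw [l2, l2, WithLp.toLp_sub, WithLp.toLp_sub, norm_sub_rev]
    have hnn : 0 ≤ smax := LinearMap.singularValues_nonneg _ _
    have hxo := l2_nonneg (xOpt A b)
    have goal_sq : (smin * l2 (x - xOpt A b)) ^ 2 ≤ (√ε * (smax * √q) * l2 (xOpt A b)) ^ 2 := by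
      calc (smin * l2 (x - xOpt A b)) ^ 2 ≤ l2 (A *ᵥ (x - xOpt A b)) ^ 2 :=
            pow_le_pow_left₀ (mul_nonneg hpos.le (l2_nonneg _)) hmin 2
        _ ≤ ε * Z ^ 2 := h
        _ ≤ ε * (q * l2 (A *ᵥ xOpt A b) ^ 2) := mul_le_mul_of_nonneg_left hZq hε.le
        _ ≤ ε * (q * (smax * l2 (xOpt A b)) ^ 2) := by
            refine mul_le_mul_of_nonneg_left (mul_le_mul_of_nonneg_left ?_ hq0) hε.le
            exact pow_le_pow_left₀ (l2_nonneg _) hmax 2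
        _ = (√ε) ^ 2 * (smax ^ 2 * (√q) ^ 2) * l2 (xOpt A b) ^ 2 := by
            rw [Real.sq_sqrt hε.le, Real.sq_sqrt hq0]; ring
        _ = _ := by ring
    have h3 := le_of_sq_le_sq goal_sq (by positivity)
    rw [hsymm]
    calc l2 (x - xOpt A b) = smin * l2 (x - xOpt A b) / smin := by field_simp
      _ ≤ (√ε * (smax * √q) * l2 (xOpt A b)) / smin := by gcongr
      _ = _ := by ring

/-- With AᵀA = QΛQᵀ take U = A Q Λ^(-1/2). Full rank makes Λ invertible, and since QΛ^(-1/2) is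
square, a one-sided inverse is two-sided, so A is recovered from U. -/
theorem exists_orthonormal_columns {n d : ℕ} {A : Matrix (Fin n) (Fin d) ℝ} (hA : A.rank = d) :
    ∃ (U : Matrix (Fin n) (Fin d) ℝ) (B B' : Matrix (Fin d) (Fin d) ℝ), Uᵀ * U = 1 ∧ U = A * B ∧
      A = U * B' := by
  have hinj : Function.Injective A.mulVec := by
    have h1 := LinearMap.finrank_range_add_finrank_ker A.mulVecLin
    rw [show Module.finrank ℝ (LinearMap.range A.mulVecLin) = A.rank from rfl, hA] at h1
    simp only [Module.finrank_fintype_fun_eq_card, Fintype.card_fin, Nat.add_eq_left] at h1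
    exact LinearMap.ker_eq_bot.mp (Submodule.finrank_eq_zero.mp h1)
  have hpd : (Aᵀ * A).PosDef := by
    simpa using Matrix.PosDef.conjTranspose_mul_self A hinj
  obtain ⟨Q, l, hQ, hl, hpow⟩ := posSemidef_pow_spectral hpd.posSemidef
  have hG : Aᵀ * A = Q * Matrix.diagonal l * Qᵀ := by simpa using hpow 1
  have hdiag : Qᵀ * (Aᵀ * A) * Q = Matrix.diagonal l := by
    rw [hG]
    calc Qᵀ * (Q * Matrix.diagonal l * Qᵀ) * Q = (Qᵀ * Q) * Matrix.diagonal l * (Qᵀ * Q) := by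
          simp only [Matrix.mul_assoc]
      _ = _ := by rw [hQ, Matrix.one_mul, Matrix.mul_one]
  have hl0 : ∀ i, l i ≠ 0 := by
    have h1 : (Qᵀ * (Aᵀ * A) * Q).det ≠ 0 := by
      have hq : Q.det ≠ 0 := fun h0 => by
        have := congrArg Matrix.det hQ
        rw [Matrix.det_mul, h0] at this
        simp at this
      rw [Matrix.det_mul, Matrix.det_mul, Matrix.det_transpose]
      exact mul_ne_zero (mul_ne_zero hq hpd.det_pos.ne') hq
    rw [hdiag, Matrix.det_diagonal] at h1
    exact fun i => Finset.prod_ne_zero_iff.mp h1 i (Finset.mem_univ i)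
  set E : Matrix (Fin d) (Fin d) ℝ := Matrix.diagonal fun i => (√(l i))⁻¹ with hE
  have hUU : (A * (Q * E))ᵀ * (A * (Q * E)) = 1 := by
    calc (A * (Q * E))ᵀ * (A * (Q * E)) = Eᵀ * (Qᵀ * (Aᵀ * A) * Q) * E := by
          simp only [Matrix.transpose_mul, Matrix.mul_assoc]
      _ = 1 := by
          rw [hdiag, hE, Matrix.diagonal_transpose, Matrix.diagonal_mul_diagonal,
            Matrix.diagonal_mul_diagonal, ← Matrix.diagonal_one]
          congr 1
          funext i
          have h1 : √(l i) * √(l i) = l i := Real.mul_self_sqrt (hl i)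
          have h2 : √(l i) ≠ 0 := (Real.sqrt_pos.mpr ((hl i).lt_of_ne' (hl0 i))).ne'
          field_simp
          rw [sq, h1]
  refine ⟨A * (Q * E), Q * E, (A * (Q * E))ᵀ * A, hUU, rfl, ?_⟩
  have h1 : ((A * (Q * E))ᵀ * A) * (Q * E) = 1 := by rw [Matrix.mul_assoc, hUU]
  have h2 := mul_eq_one_comm.mp h1
  rw [Matrix.mul_assoc, h2, Matrix.mul_one]

/-- A sketch `T` that is well conditioned on the column space and nearly preserves orthogonality to
the residual gives a good approximate solution. -/
theorem sketch_error_le {n d r : ℕ} {A U : Matrix (Fin n) (Fin d) ℝ}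
    {B B' : Matrix (Fin d) (Fin d) ℝ} (hU : Uᵀ * U = 1) (hUB : U = A * B) (hAB : A = U * B')
    (b : Fin n → ℝ) (T : Matrix (Fin r) (Fin n) ℝ) {ε : ℝ} (hr : 0 < r)
    (h1 : ∀ z, 0.72 * r * (z ⬝ᵥ z) ≤ ((T * U) *ᵥ z) ⬝ᵥ ((T * U) *ᵥ z))
    (h2 : ((T * U)ᵀ *ᵥ (T *ᵥ resid A b)) ⬝ᵥ ((T * U)ᵀ *ᵥ (T *ᵥ resid A b)) ≤
      ε / 2 * r ^ 2 * l2 (resid A b) ^ 2) :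
    l2 (A *ᵥ (pinv (T * A) *ᵥ (T *ᵥ b) - xOpt A b)) ^ 2 ≤ ε * l2 (resid A b) ^ 2 := by
  set x := pinv (T * A) *ᵥ (T *ᵥ b) with hx
  set y := resid A b with hy
  set z := B' *ᵥ (x - xOpt A b) with hz
  have hAz : A *ᵥ (x - xOpt A b) = U *ᵥ z := by
    rw [hz, Matrix.mulVec_mulVec, ← hAB]
  have hnorm : l2 (A *ᵥ (x - xOpt A b)) ^ 2 = z ⬝ᵥ z := by
    rw [hAz, l2_sq, dotProduct_mulVec_eq_transpose, Matrix.mulVec_mulVec, hU, Matrix.one_mulVec]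
  have hne : (T * A)ᵀ *ᵥ (T *ᵥ b - (T * A) *ᵥ x) = 0 := transpose_mulVec_pinv (T * A) (T *ᵥ b)
  have hres : T *ᵥ b - (T * A) *ᵥ x = T *ᵥ y - (T * U) *ᵥ z := by
    rw [← Matrix.mulVec_mulVec, ← Matrix.mulVec_mulVec, ← Matrix.mulVec_sub, ← Matrix.mulVec_sub,
      ← hAz, hy, resid]
    rw [Matrix.mulVec_sub A]
    congr 1; abel
  rw [hres] at hne
  -- The sketched normal equations for A become those for U: z is the sketched least squares fit of
  -- the residual by U.
  have hne2 : (T * U)ᵀ *ᵥ (T *ᵥ y) = (T * U)ᵀ *ᵥ ((T * U) *ᵥ z) := by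
    have e : (T * U)ᵀ = Bᵀ * (T * A)ᵀ := by
      rw [← Matrix.transpose_mul, Matrix.mul_assoc, ← hUB]
    have h3 : (T * U)ᵀ *ᵥ (T *ᵥ y - (T * U) *ᵥ z) = 0 := by
      conv_lhs => rw [e, ← Matrix.mulVec_mulVec]
      rw [hne, Matrix.mulVec_zero]
    rw [Matrix.mulVec_sub] at h3
    exact sub_eq_zero.mp h3
  set w := (T * U)ᵀ *ᵥ (T *ᵥ y) with hw
  have h3 : ((T * U) *ᵥ z) ⬝ᵥ ((T * U) *ᵥ z) = w ⬝ᵥ z := by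
    rw [dotProduct_mulVec_eq_transpose, hne2]
  have h4 := h1 z
  rw [h3] at h4
  have h5 := dotProduct_sq_le w z
  rw [hnorm]
  set s := z ⬝ᵥ z with hs
  have hs0 : 0 ≤ s := dotProduct_self_nonneg_real z
  have hr0 : (0 : ℝ) < r := by exact_mod_cast hr
  rcases hs0.eq_or_lt with h0 | h0
  · rw [← h0]
    have : 0 ≤ ε / 2 * (r : ℝ) ^ 2 * l2 y ^ 2 := (dotProduct_self_nonneg_real w).trans h2
    have h6 : (r : ℝ) ^ 2 * (0 : ℝ) ≤ (r : ℝ) ^ 2 * (ε * l2 y ^ 2) := by linarith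
    exact le_of_mul_le_mul_left h6 (by positivity)
  · have h6 : (0.72 * r * s) ^ 2 ≤ (w ⬝ᵥ w) * s :=
      (pow_le_pow_left₀ (by positivity) h4 2).trans h5
    have h7 : (0.72 * r) ^ 2 * s * s ≤ (ε / 2 * r ^ 2 * l2 y ^ 2) * s := by
      calc _ = (0.72 * r * s) ^ 2 := by ring
        _ ≤ _ := h6
        _ ≤ _ := mul_le_mul_of_nonneg_right h2 hs0
    have h8 := le_of_mul_le_mul_right h7 h0
    -- 0.72² = 0.5184 exceeds 1/2, which is why ε/2 is the tolerance in the second hypothesis.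
    have h9 : (r : ℝ) ^ 2 * (0.5184 * s) ≤ (r : ℝ) ^ 2 * (ε / 2 * l2 y ^ 2) := by
      calc _ = (0.72 * r) ^ 2 * s := by norm_num; ring
        _ ≤ _ := h8
        _ = _ := by ring
    have h10 := le_of_mul_le_mul_left h9 (by positivity)
    linarith

/-! ### Success probability -/

theorem hadamardMat_mul_self (k : ℕ) :
    hadamardMat k * hadamardMat k = (2 ^ k : ℝ) • (1 : Matrix (Fin (2 ^ k)) (Fin (2 ^ k)) ℝ) := by
  induction k with
  | zero =>
    ext i j
    have : i = j := Fin.ext (by have := i.2; have := j.2; simp only [pow_zero] at *; omega)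
    subst this
    simp [hadamardMat, Matrix.mul_apply]
  | succ k ih =>
    rw [hadamardMat, Matrix.reindex_apply, Matrix.submatrix_mul_equiv, Matrix.fromBlocks_multiply]
    simp only [Matrix.mul_neg, Matrix.neg_mul, neg_neg, ih, add_neg_cancel]
    have h : (2 ^ k : ℝ) • (1 : Matrix (Fin (2 ^ k)) (Fin (2 ^ k)) ℝ) + (2 ^ k : ℝ) • 1 =
        (2 ^ (k + 1) : ℝ) • 1 := by
      rw [← add_smul, pow_succ, mul_two]
    have h0 : (0 : Matrix (Fin (2 ^ k)) (Fin (2 ^ k)) ℝ) = (2 ^ (k + 1) : ℝ) • 0 :=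
      (smul_zero _).symm
    rw [h, h0, ← Matrix.fromBlocks_smul, Matrix.fromBlocks_one,
      Matrix.submatrix_smul]
    exact congrArg (fun M : Matrix (Fin (2 ^ (k + 1))) (Fin (2 ^ (k + 1))) ℝ =>
      (2 ^ (k + 1) : ℝ) • M) (Matrix.submatrix_one_equiv (halves k).symm)

/-- The Hadamard matrix with its columns multiplied by signs. -/
def signedHadamard {k : ℕ} (σ : Fin (2 ^ k) → ℤˣ) : Matrix (Fin (2 ^ k)) (Fin (2 ^ k)) ℝ :=
  Matrix.of fun i j => hadamardMat k i j * ((σ j : ℤ) : ℝ)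

theorem signedHadamard_transpose_mul {k : ℕ} (σ : Fin (2 ^ k) → ℤˣ) :
    (signedHadamard σ)ᵀ * signedHadamard σ = ((2 ^ k : ℕ) : ℝ) • 1 := by
  ext a b
  have h := congrFun (congrFun (hadamardMat_mul_self k) a) b
  have hsymm : ∀ i j, hadamardMat k i j = hadamardMat k j i := fun i j => by
    rw [hadamardMat_apply, hadamardMat_apply, walsh_comm]
  have h2 : ((σ b : ℤ) : ℝ) * ((σ b : ℤ) : ℝ) = 1 := by
    rcases Int.units_eq_one_or (σ b) with h | h <;> simp [h]
  rw [Matrix.mul_apply] at h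
  calc ∑ i, hadamardMat k i a * ((σ a : ℤ) : ℝ) * (hadamardMat k i b * ((σ b : ℤ) : ℝ))
      = ((σ a : ℤ) : ℝ) * ((σ b : ℤ) : ℝ) * ∑ i, hadamardMat k a i * hadamardMat k i b := by
        rw [Finset.mul_sum]
        exact Finset.sum_congr rfl fun i _ => by rw [hsymm a i]; ring
    _ = _ := by
        rw [h]
        by_cases hab : a = b
        · subst hab; simp [h2]
        · simp [hab]

theorem sampledTransform_apply {k r : ℕ} (ω : Coins (2 ^ k) r) (t : Fin r) :
    sampledTransform ω t = signedHadamard ω.1 (ω.2 t) := by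
  ext i
  simp [sampledTransform, signedHadamard, hadamardMat_apply]

theorem sampledTransform_mul_apply {k r : ℕ} {κ : Type*} (ω : Coins (2 ^ k) r)
    (M : Matrix (Fin (2 ^ k)) κ ℝ) (t : Fin r) :
    (sampledTransform ω * M) t = (signedHadamard ω.1 * M) (ω.2 t) := by
  ext c
  rw [Matrix.mul_apply, Matrix.mul_apply, sampledTransform_apply]

/-! ### Flattening by random signs, then success of the sampling -/

open Classical in
theorem card_not_flat_le {ι μ : Type*} [Fintype ι] [DecidableEq ι] [Fintype μ] {a : μ → ι → ℝ}
    (ha : ∀ m, ∑ i, a m i ^ 2 = 1) {ℓ : ℝ} (hℓ : 0 < ℓ) :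
    ((Finset.univ.filter fun σ : ι → ℤˣ =>
      ¬ ∀ m, (∑ i, a m i * ((σ i : ℤ) : ℝ)) ^ 2 ≤ 2 * ℓ).card : ℝ) ≤
      Fintype.card μ * (2 ^ Fintype.card ι * (2 * Real.exp (-ℓ))) := by
  have h1 : (Finset.univ.filter fun σ : ι → ℤˣ =>
      ¬ ∀ m, (∑ i, a m i * ((σ i : ℤ) : ℝ)) ^ 2 ≤ 2 * ℓ) =
      Finset.univ.biUnion fun m => Finset.univ.filter fun σ : ι → ℤˣ =>
        2 * ℓ < (∑ i, a m i * ((σ i : ℤ) : ℝ)) ^ 2 := by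
    ext σ; simp
  rw [h1]
  refine (Nat.cast_le.mpr Finset.card_biUnion_le).trans ?_
  push_cast
  refine (Finset.sum_le_card_nsmul _ _ _ fun m _ => card_signs_le (ha m) hℓ).trans ?_
  simp

open Classical in
theorem card_not_flat_signedHadamard_le {k d : ℕ} (hd : 0 < d)
    {U : Matrix (Fin (2 ^ k)) (Fin d) ℝ} (hU : Uᵀ * U = 1) :
    ((Finset.univ.filter fun σ : Fin (2 ^ k) → ℤˣ =>
      ¬ ∀ m : Fin (2 ^ k) × Fin d, ((signedHadamard σ * U) m.1 m.2) ^ 2 ≤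
        2 * Real.log (40 * (2 ^ k : ℕ) * d)).card : ℝ) * 20 ≤
      Fintype.card (Fin (2 ^ k) → ℤˣ) := by
  have h40 := forty_le (n := 2 ^ k) (by positivity) hd
  have hpos : (0 : ℝ) < 40 * (2 ^ k : ℕ) * d := by linarith
  have h3 := log_ge_three h40
  have ha : ∀ m : Fin (2 ^ k) × Fin d, ∑ j, (hadamardMat k m.1 j * U j m.2) ^ 2 = 1 := fun m => by
    have h1 : ∀ i j, hadamardMat k i j ^ 2 = 1 := fun i j => by
      rw [hadamardMat_apply, sq, walsh_mul_self]
    have h2 := congrFun (congrFun hU m.2) m.2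
    rw [Matrix.mul_apply, Matrix.one_apply_eq] at h2
    rw [← h2]
    exact Finset.sum_congr rfl fun j _ => by rw [mul_pow, h1, one_mul, sq]; rfl
  have h := card_not_flat_le ha (ℓ := Real.log (40 * (2 ^ k : ℕ) * d)) (by linarith)
  have e : ∀ (σ : Fin (2 ^ k) → ℤˣ) (m : Fin (2 ^ k) × Fin d), (signedHadamard σ * U) m.1 m.2 =
      ∑ j, hadamardMat k m.1 j * U j m.2 * ((σ j : ℤ) : ℝ) := fun σ m => by
    rw [Matrix.mul_apply]
    exact Finset.sum_congr rfl fun j _ => by simp only [signedHadamard, Matrix.of_apply]; ring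
  simp only [e]
  refine (mul_le_mul_of_nonneg_right h (by norm_num : (0 : ℝ) ≤ 20)).trans ?_
  -- The union bound over nd entries with two tails each gives 2nd/(40nd) = 1/20.
  rw [Real.exp_neg, Real.exp_log hpos]
  simp only [Fintype.card_prod, Fintype.card_fin, Fintype.card_fun, Fintype.card_units_int]
  have hn : (0 : ℝ) < (2 ^ k : ℕ) := by positivity
  have hd' : (0 : ℝ) < d := by exact_mod_cast hd
  clear h e ha hpos h3 h40 hU
  generalize 2 ^ k = N at hn ⊢
  push_cast
  apply le_of_eq
  field_simp
  norm_num

open Classical in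
/-- For fixed signs that flatten the column space, sampling fails with probability at most
`3 / 20`. -/
theorem card_sample_bad_le {ι : Type*} [Fintype ι] [Nonempty ι] {d r : ℕ} (hd : 0 < d)
    {u : ι → Fin d → ℝ} {g : ι → ℝ}
    (hu : ∑ i, Matrix.vecMulVec (u i) (u i) = (Fintype.card ι : ℝ) • (1 : Matrix (Fin d) (Fin d) ℝ))
    (hgu : ∑ i, g i • u i = 0) {Z : ℝ} (hg : ∑ i, g i ^ 2 = Fintype.card ι * Z)
    {ℓ ε : ℝ} (hε : 0 < ε) (hℓ : 3 ≤ ℓ) (hM : ∀ i, u i ⬝ᵥ u i ≤ 2 * d * ℓ)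
    (hr : 48 ^ 2 * d * ℓ * Real.log (100 ^ 2 * d * ℓ) ≤ r) (hr' : 40 * d * ℓ / ε ≤ r) :
    ((Finset.univ.filter fun f : Fin r → ι =>
      ¬ ((∀ z, 0.72 * r * (z ⬝ᵥ z) ≤ ∑ t, (u (f t) ⬝ᵥ z) ^ 2) ∧
        (∑ t, g (f t) • u (f t)) ⬝ᵥ (∑ t, g (f t) • u (f t)) ≤ ε / 2 * r ^ 2 * Z)).card : ℝ) * 20 ≤
      3 * (Fintype.card ι : ℝ) ^ r := by
  have hn : (0 : ℝ) < Fintype.card ι := by exact_mod_cast Fintype.card_pos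
  have hd' : (0 : ℝ) < d := by exact_mod_cast hd
  have hr0 : (0 : ℝ) < r := lt_of_lt_of_le (by positivity) hr'
  have hZ0 : 0 ≤ Z := by
    have : 0 ≤ (Fintype.card ι : ℝ) * Z := by
      rw [← hg]; exact Finset.sum_nonneg fun i _ => sq_nonneg _
    exact nonneg_of_mul_nonneg_right this hn
  have h1 := card_ill_conditioned_le hd hu hℓ hM hr
  have h2 : ((Finset.univ.filter fun f : Fin r → ι => ε / 2 * r ^ 2 * Z <
      (∑ t, g (f t) • u (f t)) ⬝ᵥ (∑ t, g (f t) • u (f t))).card : ℝ) * 20 ≤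
      2 * (Fintype.card ι : ℝ) ^ r := by
    -- Markov's inequality is void at threshold 0, but for Z = 0 all `g i` vanish and the event is
    -- empty.
    rcases hZ0.eq_or_lt with hZ | hZ
    · have hg0 : ∀ i, g i = 0 := fun i => by
        rw [← hZ, mul_zero, Finset.sum_eq_zero_iff_of_nonneg fun i _ => sq_nonneg _] at hg
        exact pow_eq_zero_iff two_ne_zero |>.mp (hg i (Finset.mem_univ i))
      simp [hg0, ← hZ]
    · have h3 := card_lt_mul_le_sum (g := fun f : Fin r → ι =>
        (∑ t, g (f t) • u (f t)) ⬝ᵥ (∑ t, g (f t) • u (f t)))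
        (fun f => dotProduct_self_nonneg_real _) (ε / 2 * r ^ 2 * Z)
      have h4 := sum_sq_sample_sum hgu r
      have h5 : ∑ i, (g i • u i) ⬝ᵥ (g i • u i) ≤ (Fintype.card ι : ℝ) * Z * (2 * d * ℓ) := by
        rw [← hg, Finset.sum_mul]
        refine Finset.sum_le_sum fun i _ => ?_
        rw [smul_dotProduct, dotProduct_smul, smul_eq_mul, smul_eq_mul, ← mul_assoc, ← sq]
        exact mul_le_mul_of_nonneg_left (hM i) (sq_nonneg _)
      set N : ℝ := (Fintype.card ι : ℝ) with hN
      set C := ((Finset.univ.filter fun f : Fin r → ι => ε / 2 * r ^ 2 * Z <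
        (∑ t, g (f t) • u (f t)) ⬝ᵥ (∑ t, g (f t) • u (f t))).card : ℝ) with hC
      have h6 : N * (C * (ε / 2 * r ^ 2 * Z)) ≤ r * N ^ r * (N * Z * (2 * d * ℓ)) :=
        (mul_le_mul_of_nonneg_left h3 hn.le).trans
          (h4.trans_le (mul_le_mul_of_nonneg_left h5 (by positivity)))
      have h7 : 40 * d * ℓ ≤ r * ε := by rwa [div_le_iff₀ hε] at hr'
      -- The failure fraction is at most 4dℓ/(rε), and r ≥ 40dℓ/ε makes this 1/10.
      have h8 : C * 20 * (r * ε) ≤ 2 * N ^ r * (r * ε) := by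
        have h9 : (N * Z * r / 2) * (C * (ε * r)) ≤ (N * Z * r / 2) * (N ^ r * (4 * d * ℓ)) := by
          calc _ = N * (C * (ε / 2 * r ^ 2 * Z)) := by ring
            _ ≤ _ := h6
            _ = _ := by ring
        have h10 := le_of_mul_le_mul_left h9 (by positivity)
        have h11 : N ^ r * (40 * d * ℓ) ≤ N ^ r * (r * ε) :=
          mul_le_mul_of_nonneg_left h7 (by positivity)
        linarith
      exact le_of_mul_le_mul_right h8 (by positivity)
  have h3 : ((Finset.univ.filter fun f : Fin r → ι =>
      ¬ ((∀ z, 0.72 * r * (z ⬝ᵥ z) ≤ ∑ t, (u (f t) ⬝ᵥ z) ^ 2) ∧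
        (∑ t, g (f t) • u (f t)) ⬝ᵥ (∑ t, g (f t) • u (f t)) ≤ ε / 2 * r ^ 2 * Z)).card : ℝ) ≤ _ :=
    Nat.cast_le.mpr ((Finset.card_le_card (t := (Finset.univ.filter fun f : Fin r → ι =>
      ¬ ∀ z, 0.72 * r * (z ⬝ᵥ z) ≤ ∑ t, (u (f t) ⬝ᵥ z) ^ 2) ∪
      (Finset.univ.filter fun f : Fin r → ι => ε / 2 * r ^ 2 * Z <
        (∑ t, g (f t) • u (f t)) ⬝ᵥ (∑ t, g (f t) • u (f t)))) (by
          intro f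
          simp only [Finset.mem_filter, Finset.mem_univ, true_and, Finset.mem_union]
          intro hf
          by_contra! hc
          exact hf hc)).trans (Finset.card_union_le _ _))
  push_cast at h3
  linarith

open Classical in
-- Isotropy of the rows of WU and the vanishing of ∑ g_i u_i both come from WᵀW = nI, together with
-- UᵀU = 1 and orthogonality of the residual to the columns of U.
theorem card_inaccurate_sample_le {k d r : ℕ} {A U : Matrix (Fin (2 ^ k)) (Fin d) ℝ}
    {B B' : Matrix (Fin d) (Fin d) ℝ} (hU : Uᵀ * U = 1) (hUB : U = A * B) (hAB : A = U * B')
    (b : Fin (2 ^ k) → ℝ) {ε ℓ : ℝ} (hd : 0 < d) (hr0 : 0 < r) (hε : 0 < ε) (hℓ3 : 3 ≤ ℓ)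
    (hr1 : 48 ^ 2 * d * ℓ * Real.log (100 ^ 2 * d * ℓ) ≤ r) (hr2 : 40 * d * ℓ / ε ≤ r)
    {σ : Fin (2 ^ k) → ℤˣ}
    (hσ : ∀ m : Fin (2 ^ k) × Fin d, ((signedHadamard σ * U) m.1 m.2) ^ 2 ≤ 2 * ℓ) :
    ((Finset.univ.filter fun f : Fin r → Fin (2 ^ k) =>
      ¬ l2 (A *ᵥ (xTilde A b (r := r) (σ, f) - xOpt A b)) ^ 2 ≤
        ε * l2 (resid A b) ^ 2).card : ℝ) * 20 ≤
      3 * Fintype.card (Fin r → Fin (2 ^ k)) := by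
  have hUres : Uᵀ *ᵥ resid A b = 0 := by
    rw [hUB, Matrix.transpose_mul, ← Matrix.mulVec_mulVec, transpose_mulVec_resid,
      Matrix.mulVec_zero]
  set W := signedHadamard σ with hW
  have hWW := signedHadamard_transpose_mul σ
  set u : Fin (2 ^ k) → Fin d → ℝ := fun i => (W * U) i with hu
  set g : Fin (2 ^ k) → ℝ := W *ᵥ resid A b with hg
  have hsum : ∑ i, Matrix.vecMulVec (u i) (u i) =
      (Fintype.card (Fin (2 ^ k)) : ℝ) • (1 : Matrix (Fin d) (Fin d) ℝ) := by
    have h1 : (W * U)ᵀ * (W * U) = ((2 ^ k : ℕ) : ℝ) • (1 : Matrix (Fin d) (Fin d) ℝ) := by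
      calc (W * U)ᵀ * (W * U) = Uᵀ * (Wᵀ * W) * U := by
            simp only [Matrix.transpose_mul, Matrix.mul_assoc]
        _ = _ := by rw [hWW, Matrix.mul_smul, Matrix.smul_mul, Matrix.mul_one, hU]
    rw [Fintype.card_fin, ← h1]
    ext a c
    rw [Matrix.sum_apply, Matrix.mul_apply]
    rfl
  have hgu : ∑ i, g i • u i = 0 := by
    have h1 : ∑ i, g i • u i = (W * U)ᵀ *ᵥ g := by
      ext c
      simp only [Finset.sum_apply, Pi.smul_apply, smul_eq_mul, Matrix.mulVec, dotProduct,
        Matrix.transpose_apply, hu]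
      exact Finset.sum_congr rfl fun i _ => mul_comm _ _
    rw [h1, hg, Matrix.mulVec_mulVec, Matrix.transpose_mul, Matrix.mul_assoc, hWW,
      Matrix.mul_smul, Matrix.mul_one, Matrix.smul_mulVec, hUres, smul_zero]
  have hgsq : ∑ i, g i ^ 2 = Fintype.card (Fin (2 ^ k)) * l2 (resid A b) ^ 2 := by
    have h1 : ∑ i, g i ^ 2 = g ⬝ᵥ g := by simp [dotProduct, sq]
    rw [h1, hg, dotProduct_mulVec_eq_transpose, Matrix.mulVec_mulVec, hWW, Matrix.smul_mulVec,
      Matrix.one_mulVec, smul_dotProduct, l2_sq, Fintype.card_fin, smul_eq_mul]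
  have hM : ∀ i, u i ⬝ᵥ u i ≤ 2 * d * ℓ := fun i => by
    have h1 : u i ⬝ᵥ u i ≤ ∑ _c : Fin d, 2 * ℓ :=
      Finset.sum_le_sum fun c _ => by rw [← sq]; exact hσ (i, c)
    refine h1.trans_eq ?_
    simp only [Finset.sum_const, Finset.card_univ, Fintype.card_fin, nsmul_eq_mul]
    ring
  have hbad := card_sample_bad_le (r := r) hd hsum hgu hgsq hε hℓ3 hM hr1 hr2
  have hcard : (Fintype.card (Fin r → Fin (2 ^ k)) : ℝ) =
      (Fintype.card (Fin (2 ^ k)) : ℝ) ^ r := by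
    simp
  rw [hcard]
  refine le_trans (mul_le_mul_of_nonneg_right (Nat.cast_le.mpr (Finset.card_le_card ?_))
    (by norm_num)) hbad
  intro f
  simp only [Finset.mem_filter, Finset.mem_univ, true_and]
  refine mt fun ⟨h1, h2⟩ => ?_
  rw [xTilde_eq hr0]
  set T := sampledTransform (r := r) (σ, f) with hT
  have hTU : ∀ t, (T * U) t = u (f t) := fun t => sampledTransform_mul_apply _ _ _
  have hTg : ∀ t, (T *ᵥ resid A b) t = g (f t) := fun t => by
    rw [Matrix.mulVec, hT, sampledTransform_apply]; rfl
  refine sketch_error_le hU hUB hAB b T hr0 (fun z => ?_) ?_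
  · refine (h1 z).trans_eq ?_
    rw [dotProduct]
    refine Finset.sum_congr rfl fun t _ => ?_
    rw [Matrix.mulVec, hTU, sq]
  · have h3 : (T * U)ᵀ *ᵥ (T *ᵥ resid A b) = ∑ t, g (f t) • u (f t) := by
      ext c
      simp only [Finset.sum_apply, Pi.smul_apply, smul_eq_mul]
      rw [Matrix.mulVec, dotProduct]
      refine Finset.sum_congr rfl fun t _ => ?_
      rw [Matrix.transpose_apply, hTU, hTg, mul_comm]
    rw [h3]
    exact h2

open Classical in
theorem card_inaccurate_le {k d r : ℕ} {A : Matrix (Fin (2 ^ k)) (Fin d) ℝ} (b : Fin (2 ^ k) → ℝ)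
    {ε ℓ : ℝ} (hd : 0 < d) (hA : A.rank = d) (hr0 : 0 < r) (hε : 0 < ε)
    (hℓ : ℓ = Real.log (40 * (2 ^ k : ℕ) * d))
    (hr1 : 48 ^ 2 * d * ℓ * Real.log (100 ^ 2 * d * ℓ) ≤ r) (hr2 : 40 * d * ℓ / ε ≤ r) :
    ((Finset.univ.filter fun ω : Coins (2 ^ k) r =>
      ¬ l2 (A *ᵥ (xTilde A b ω - xOpt A b)) ^ 2 ≤ ε * l2 (resid A b) ^ 2).card : ℝ) * 5 ≤
      Fintype.card (Coins (2 ^ k) r) := by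
  have hℓ3 : 3 ≤ ℓ := hℓ ▸ log_ge_three (forty_le (by positivity) hd)
  obtain ⟨U, B, B', hU, hUB, hAB⟩ := exists_orthonormal_columns hA
  have hG := card_not_flat_signedHadamard_le hd hU
  rw [← hℓ] at hG
  have h := card_prod_bad_le
    (G := fun σ => ∀ m : Fin (2 ^ k) × Fin d, ((signedHadamard σ * U) m.1 m.2) ^ 2 ≤ 2 * ℓ)
    (E := fun (σ : Fin (2 ^ k) → ℤˣ) (f : Fin r → Fin (2 ^ k)) =>
      l2 (A *ᵥ (xTilde A b (r := r) (σ, f) - xOpt A b)) ^ 2 ≤ ε * l2 (resid A b) ^ 2)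
    (by convert hG) fun σ hσ => by
      convert card_inaccurate_sample_le hU hUB hAB b hd hr0 hε hℓ3 hr1 hr2 hσ
  rw [Fintype.card_prod, Nat.cast_mul]
  convert h

theorem four_fifths_le_uniformOfFintype {α : Type*} [Fintype α] [Nonempty α] {s : Set α}
    {E : α → Prop} (hs : ∀ x, E x → x ∈ s) [DecidablePred fun x => ¬ E x]
    (hE : ((Finset.univ.filter fun x => ¬ E x).card : ℝ) * 5 ≤ Fintype.card α) :
    (4 / 5 : ENNReal) ≤ (PMF.uniformOfFintype α).toOuterMeasure s := by
  classical
  have hpos : 0 < Fintype.card α := Fintype.card_pos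
  rw [PMF.toOuterMeasure_uniformOfFintype_apply]
  have h1 : Fintype.card α ≤ (Finset.univ.filter fun x => ¬ E x).card + Fintype.card s := by
    rw [← Set.toFinset_card, ← Finset.card_univ]
    refine (Finset.card_le_card fun x _ => ?_).trans (Finset.card_union_le _ _)
    by_cases hx : E x
    · simp [hs x hx]
    · simp [hx]
  have h2 : (Finset.univ.filter fun x => ¬ E x).card * 5 ≤ Fintype.card α := by exact_mod_cast hE
  have h3 : 4 * Fintype.card α ≤ Fintype.card s * 5 := by omega
  rw [ENNReal.le_div_iff_mul_le (by simp [hpos.ne']) (by simp), ENNReal.div_eq_inv_mul, mul_assoc,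
    ENNReal.inv_mul_le_iff (by simp) (by simp)]
  rw [mul_comm 5]
  exact_mod_cast h3

theorem accuracy {k d : ℕ} (A : Matrix (Fin (2 ^ k)) (Fin d) ℝ) (b : Fin (2 ^ k) → ℝ) {ε : ℝ}
    (hd : 0 < d) (hA : A.rank = d) (hε : 0 < ε) :
    (4 / 5 : ENNReal) ≤
      (PMF.uniformOfFintype (Coins (2 ^ k) (sampleSize (2 ^ k) d ε))).toOuterMeasure
        {ω | l2 (A *ᵥ xTilde A b ω - b) ≤ (1 + ε) * lsqValue A b ∧
          ∀ γ : ℝ, 0 < γ → γ ≤ 1 → γ * l2 b ≤ ‖colProj A b‖ →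
            l2 (xOpt A b - xTilde A b ω) ≤
              √ε * (condNumber A * √(γ ^ (-2 : ℤ) - 1)) * l2 (xOpt A b)} := by
  classical
  have hr0 : 0 < sampleSize (2 ^ k) d ε :=
    lt_of_lt_of_le (by omega) (sampleSize_ge (n := 2 ^ k) (by positivity) hd ε)
  have hr : max _ _ ≤ (sampleSize (2 ^ k) d ε : ℝ) := Nat.le_ceil _
  have hr1 := (le_max_left _ _).trans hr
  have hr2 := (le_max_right _ _).trans hr
  clear hr
  generalize sampleSize (2 ^ k) d ε = r at *
  exact four_fifths_le_uniformOfFintype (fun ω hω => accuracy_of_error_le hd hA hε hω)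
    (card_inaccurate_le b hd hA hr0 hε rfl hr1 hr2)

end FastLS

end

theorem theorem2 :
    -- accuracy
    (∀ (k d : ℕ) (A : Matrix (Fin (2 ^ k)) (Fin d) ℝ) (b : Fin (2 ^ k) → ℝ) (ε : ℝ),
      0 < d → A.rank = d → 0 < ε → ε < 1 →
      (4 / 5 : ENNReal) ≤
        (PMF.uniformOfFintype
            (FastLS.Coins (2 ^ k) (FastLS.sampleSize (2 ^ k) d ε))).toOuterMeasure
          {ω | FastLS.l2 (A *ᵥ FastLS.xTilde A b ω - b) ≤ (1 + ε) * FastLS.lsqValue A b ∧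
            ∀ γ : ℝ, 0 < γ → γ ≤ 1 → γ * FastLS.l2 b ≤ ‖FastLS.colProj A b‖ →
              FastLS.l2 (FastLS.xOpt A b - FastLS.xTilde A b ω) ≤
                √ε * (FastLS.condNumber A * √(γ ^ (-2 : ℤ) - 1)) *
                  FastLS.l2 (FastLS.xOpt A b)}) ∧
    -- running time
    (∃ (P : FastLS.Prog) (C : ℝ),
      ∀ (k d : ℕ) (A : Matrix (Fin (2 ^ k)) (Fin d) ℝ) (b : Fin (2 ^ k) → ℝ) (ε : ℝ),
      0 < d → A.rank = d → 0 < ε → ε < 1 →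
      ∀ (n r : ℕ), n = 2 ^ k → r = FastLS.sampleSize n d ε →
      ∀ ω : FastLS.Coins (2 ^ k) r,
        (P.run (FastLS.initState A b ω)).Outputs (FastLS.xTilde A b ω) ∧
        ((P.run (FastLS.initState A b ω)).ops : ℝ) ≤
          n * (d + 1) + 2 * n * (d + 1) * Real.logb 2 (r + 1) + C * (r * d ^ 2) ∧
        ((P.run (FastLS.initState A b ω)).steps : ℝ) ≤
          C * (n * (d + 1) * Real.logb 2 (r + 1) + r * d ^ 2)) := by
  exact ⟨fun k d A b ε hd hA hε _ => FastLS.accuracy A b hd hA hε, FastLS.mainProg, 200,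
    fun k d A b ε hd _ _ _ n r hn hr ω => FastLS.mainProg_cost A b ε hd n r hn hr ω⟩
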